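/- \textbf{Proposition (Linearized energy estimate).} There is an absolute constant $C>0$ with the following property. Let $d\ge 2$, $T>0$, and let $(\Omega_t)_{t\in[0,T]}$ be bounded connected domains in $\mathbb{R}^d$, contained in a common ball, whose boundaries $\Gamma_t=\partial\Omega_t$ form a hypersurface $\bigcup_t\{t\}\times\Gamma_t$ of class $C^2$ in spacetime (locally $\Omega_t=\{\rho(t,\cdot)<0\}$ with $\rho\in C^2$, $\nabla_x\rho\neq0$ on $\Gamma_t$), with outward unit normal $n_{\Gamma_t}$. Let $W^\pm=v\pm B$ be $C^1$ vector fields and $P$ a $C^2$ function on $\{(t,x):t\in[0,T],\,x\in\overline{\Omega}_t\}$ which solve the free boundary MHD equations: with $D_t^\pm:=\partial_t+W^\pm\cdot\nabla$, $$D_t^\pm W^\mp=-\nabla P,\qquad \nabla\cdot W^\pm=0\quad\text{in }\Omega_t,\qquad P=0\quad\text{on }\Gamma_t,$$ $D_t^\pm$ are tangent to $\bigcup_t\{t\}\times\Gamma_t$, and the Taylor sign condition $a:=-\nabla P\cdot n_{\Gamma_t}>c_0>0$ holds on $\Gamma_t$ for some constant $c_0$. Let $w^\pm$ (vector fields) and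 $P_{lin}$ (a function) be $C^1$ on $\{(t,x):t\in[0,T],\,x\in\overline\Omega_t\}$, let $s$ be a $C^1$ function on $\bigcup_t\{t\}\times\Gamma_t$, and suppose that they solve the linearized system $$\begin{cases} D_t^\pm w^\mp+\nabla P_{lin}=-w^\pm\cdot\nabla W^\mp & \text{in }\Omega_t,\\ \nabla\cdot w^\pm=0 & \text{in }\Omega_t,\\ D_t^\pm s-w^\pm\cdot n_{\Gamma_t}=s\,(n_{\Gamma_t}\cdot\nabla W^\pm)\cdot n_{\Gamma_t} & \text{on }\Gamma_t,\\ P_{lin}=a s& \text{on }\Gamma_t,\end{cases}$$ and that for each $t$ the state $(w^\pm,s)(t)$ lies in the constrained space $\mathcal{H}^0_{lin}$, i.e. $w^\pm\in L^2(\Omega_t)$, $s\in L^2(\Gamma_t)$, $\nabla\cdot w^\pm=0$ and $\nabla_B s-b\cdot n_{\Gamma_t}=s\,(n_{\Gamma_t}\cdot\nabla B)\cdot n_{\Gamma_t}$ on $\Gamma_t$, where $\nabla_B=B\cdot\nabla$, $B=\frac12(W^+-W^-)$ and $b=\frac12(w^+-w^-)$. Suppose that $$A^{\frac12}_{lin}(t):=\|(W^+,W^-)\|_{W^{1,\infty}(\Omega_t)}+\|a^{-1}(D_t^+a,D_t^-a)\|_{L^\infty(\Gamma_t)}$$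 is bounded uniformly in $t\in[0,T]$ (norms of pairs are sums of the norms, and the $W^{1,\infty}$ norm is the $L^\infty$ norm of the field plus that of the operator norm of its gradient). Then the linearized energy $$E_{lin}(t):=\frac12\int_{\Omega_t}|w^+|^2\,dx+\frac12\int_{\Omega_t}|w^-|^2\,dx+\int_{\Gamma_t}a s^2\,dS$$ is differentiable on $[0,T]$ (one-sidedly at the endpoints), and for all $t\in[0,T]$ $$\left|\frac{d}{dt}E_{lin}(t)\right|\le C\,A^{\frac12}_{lin}(t)\,E_{lin}(t).$$ -/

import Mathlib

open MeasureTheory Set Filter Topology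
open scoped ENNReal NNReal RealInnerProductSpace

noncomputable section

namespace FreeBoundaryMHD

/-- Physical space `ℝ^d` with its Euclidean norm. -/
abbrev Space (d : ℕ) : Type := EuclideanSpace ℝ (Fin d)

variable {d : ℕ} {F : Type*} [NormedAddCommGroup F] [NormedSpace ℝ F]

/-! ### Moving domains -/

/-- The closed spacetime region `{(t, x) : t ∈ I, x ∈ closure (Ω t)}`. -/
def region (I : Set ℝ) (Ω : ℝ → Set (Space d)) : Set (ℝ × Space d) :=
  {p | p.1 ∈ I ∧ p.2 ∈ closure (Ω p.1)}

/-- The spacetime free hypersurface `⋃ t ∈ I, {t} × Γ_t`, with `Γ_t = ∂Ω_t`. -/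
def freeSurface (I : Set ℝ) (Ω : ℝ → Set (Space d)) : Set (ℝ × Space d) :=
  {p | p.1 ∈ I ∧ p.2 ∈ frontier (Ω p.1)}

/-- `(Ω t)`, `t ∈ I`, is a family of bounded connected domains with boundary of class `C²` in
spacetime.  Near every spacetime point `(t₀, x₀)` there is a `C²` function `ρ` such that the moving
domain is `{ρ < 0}` and such that `∇ₓρ ≠ 0` at the point if `ρ` vanishes there.  (At interior and
exterior points, `ρ` can be a nonzero constant, and the condition says that nearby points are
interior, respectively exterior, as well.) -/
structure IsMovingDomain (I : Set ℝ) (Ω : ℝ → Set (Space d)) : Prop where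
  isConnected : ∀ t ∈ I, IsConnected (Ω t)
  bounded : ∃ R : ℝ, ∀ t ∈ I, Ω t ⊆ Metric.ball 0 R
  exists_definingFunction : ∀ t₀ ∈ I, ∀ x₀ : Space d, ∃ ρ : ℝ × Space d → ℝ,
    ContDiffAt ℝ 2 ρ (t₀, x₀) ∧
    (∀ᶠ p in 𝓝 (t₀, x₀), p.1 ∈ I → (p.2 ∈ Ω p.1 ↔ ρ p < 0)) ∧
    (ρ (t₀, x₀) = 0 → gradient (fun x => ρ (t₀, x)) x₀ ≠ 0)

/-- `n` is the outward unit normal of the domain `U` at its boundary point `x`: it is a unit vector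
pointing along the gradient of a `C¹` function `ρ` which defines `U` as `{ρ < 0}` near `x`. -/
def IsOuterUnitNormal (U : Set (Space d)) (x n : Space d) : Prop :=
  ‖n‖ = 1 ∧ ∃ ρ : Space d → ℝ, ContDiffAt ℝ 1 ρ x ∧ ρ x = 0 ∧
    (∀ᶠ y in 𝓝 x, y ∈ U ↔ ρ y < 0) ∧ ∃ c : ℝ, 0 < c ∧ gradient ρ x = c • n

/-- The outward unit normal `n_Γ` of `U` at a point `x` of `Γ = ∂U`. -/
def outerNormal (U : Set (Space d)) (x : Space d) : Space d :=
  Classical.epsilon (IsOuterUnitNormal U x)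

/-! ### Differential operators

Time-dependent functions on the closed fluid domain, and on the free surface, are functions
`ℝ → Space d → F`; their values off `region I Ω`, respectively off `freeSurface I Ω`, play no role.
Derivatives are therefore taken within these sets. -/

/-- The spatial derivative `v ↦ v · ∇f` of `f t` at `x`, for `x` in the closure of `Ω t`. -/
def spaceDeriv (Ω : ℝ → Set (Space d)) (f : ℝ → Space d → F) (t : ℝ) (x : Space d) :
    Space d →L[ℝ] F :=
  fderivWithin ℝ (f t) (closure (Ω t)) x

/-- The spatial gradient. -/
def grad (Ω : ℝ → Set (Space d)) (f : ℝ → Space d → ℝ) (t : ℝ) (x : Space d) : Space d :=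
  gradientWithin (f t) (closure (Ω t)) x

/-- The spatial divergence. -/
def div (Ω : ℝ → Set (Space d)) (w : ℝ → Space d → Space d) (t : ℝ) (x : Space d) : ℝ :=
  ∑ i : Fin d, (spaceDeriv Ω w t x (EuclideanSpace.single i 1)) i

/-- The material derivative `(∂_t + V · ∇) f` of a function on the closed moving domain. -/
def matDeriv (I : Set ℝ) (Ω : ℝ → Set (Space d)) (V : ℝ → Space d → Space d)
    (f : ℝ → Space d → F) (t : ℝ) (x : Space d) : F :=
  fderivWithin ℝ (Function.uncurry f) (region I Ω) (t, x) (1, V t x)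

/-- The material derivative `(∂_t + V · ∇) g` of a function on the free surface, where `∂_t + V · ∇`
is tangent to the spacetime free surface.  (All derivatives of `g` within the spacetime surface
agree in tangential directions, so that this is the derivative of `g` along the tangent vector
`(1, V)`.) -/
def surfMatDeriv (I : Set ℝ) (Ω : ℝ → Set (Space d)) (V : ℝ → Space d → Space d)
    (g : ℝ → Space d → F) (t : ℝ) (x : Space d) : F :=
  fderivWithin ℝ (Function.uncurry g) (freeSurface I Ω) (t, x) (1, V t x)

/-- The derivative `V · ∇ g` at a fixed time of a function on the free surface `Γ_t` along a
field `V` that is tangent to `Γ_t`. -/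
def surfDirDeriv (Ω : ℝ → Set (Space d)) (V : ℝ → Space d → Space d)
    (g : ℝ → Space d → F) (t : ℝ) (x : Space d) : F :=
  fderivWithin ℝ (g t) (frontier (Ω t)) x (V t x)

/-- `∂_t + V · ∇` is tangent to the spacetime free surface `⋃ t, {t} × Γ_t`. -/
def IsTangent (I : Set ℝ) (Ω : ℝ → Set (Space d)) (V : ℝ → Space d → Space d) : Prop :=
  ∀ p ∈ freeSurface I Ω, ((1, V p.1 p.2) : ℝ × Space d) ∈ tangentConeAt ℝ (freeSurface I Ω) p

/-- The quantity `(n · ∇V) · n` on the free surface, `n` being the outward unit normal. -/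
def normalStrain (Ω : ℝ → Set (Space d)) (V : ℝ → Space d → Space d) (t : ℝ) (x : Space d) : ℝ :=
  ⟪spaceDeriv Ω V t x (outerNormal (Ω t) x), outerNormal (Ω t) x⟫

/-! ### The free boundary MHD equations in Elsässer variables -/

/-- The Taylor coefficient `a = -∇P · n` on the free surface. -/
def taylorCoeff (Ω : ℝ → Set (Space d)) (P : ℝ → Space d → ℝ) (t : ℝ) (x : Space d) : ℝ :=
  -⟪grad Ω P t x, outerNormal (Ω t) x⟫

/-- `(W⁺, W⁻, P, Ω)` is a classical solution of the free boundary MHD equations on the time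
interval `I`, where `W⁺ = v + B` and `W⁻ = v - B`:
`D_t^± W^∓ = -∇P` and `∇ · W^± = 0` in `Ω t`; `D_t^± = ∂_t + W^± · ∇` are tangent to the spacetime
free surface and `P = 0` on it, and the Taylor sign condition holds. -/
structure IsMHDSolution (I : Set ℝ) (Ω : ℝ → Set (Space d))
    (Wp Wm : ℝ → Space d → Space d) (P : ℝ → Space d → ℝ) : Prop where
  domain : IsMovingDomain I Ω
  regular_Wp : ContDiffOn ℝ 1 (Function.uncurry Wp) (region I Ω)
  regular_Wm : ContDiffOn ℝ 1 (Function.uncurry Wm) (region I Ω)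
  regular_P : ContDiffOn ℝ 2 (Function.uncurry P) (region I Ω)
  momentum_p : ∀ t ∈ I, ∀ x ∈ Ω t, matDeriv I Ω Wp Wm t x = -grad Ω P t x
  momentum_m : ∀ t ∈ I, ∀ x ∈ Ω t, matDeriv I Ω Wm Wp t x = -grad Ω P t x
  div_Wp : ∀ t ∈ I, ∀ x ∈ Ω t, div Ω Wp t x = 0
  div_Wm : ∀ t ∈ I, ∀ x ∈ Ω t, div Ω Wm t x = 0
  tangent_p : IsTangent I Ω Wp
  tangent_m : IsTangent I Ω Wm
  pressure_eq_zero : ∀ t ∈ I, ∀ x ∈ frontier (Ω t), P t x = 0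
  taylor_sign : ∃ c₀ : ℝ, 0 < c₀ ∧ ∀ t ∈ I, ∀ x ∈ frontier (Ω t), c₀ < taylorCoeff Ω P t x

/-! ### The linearized equations -/

/-- `(w⁺, w⁻, s)`, with the linearized pressure `q`, is a classical solution on the time
interval `I` of the linearization of the free boundary MHD equations around `(W⁺, W⁻, P, Ω)`. -/
structure IsLinearizedSolution (I : Set ℝ) (Ω : ℝ → Set (Space d))
    (Wp Wm : ℝ → Space d → Space d) (P : ℝ → Space d → ℝ)
    (wp wm : ℝ → Space d → Space d) (s q : ℝ → Space d → ℝ) : Prop where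
  regular_wp : ContDiffOn ℝ 1 (Function.uncurry wp) (region I Ω)
  regular_wm : ContDiffOn ℝ 1 (Function.uncurry wm) (region I Ω)
  regular_q : ContDiffOn ℝ 1 (Function.uncurry q) (region I Ω)
  regular_s : ContDiffOn ℝ 1 (Function.uncurry s) (freeSurface I Ω)
  momentum_p : ∀ t ∈ I, ∀ x ∈ Ω t,
    matDeriv I Ω Wp wm t x + grad Ω q t x = -spaceDeriv Ω Wm t x (wp t x)
  momentum_m : ∀ t ∈ I, ∀ x ∈ Ω t,
    matDeriv I Ω Wm wp t x + grad Ω q t x = -spaceDeriv Ω Wp t x (wm t x)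
  div_wp : ∀ t ∈ I, ∀ x ∈ Ω t, div Ω wp t x = 0
  div_wm : ∀ t ∈ I, ∀ x ∈ Ω t, div Ω wm t x = 0
  kinematic_p : ∀ t ∈ I, ∀ x ∈ frontier (Ω t),
    surfMatDeriv I Ω Wp s t x - ⟪wp t x, outerNormal (Ω t) x⟫ = s t x * normalStrain Ω Wp t x
  kinematic_m : ∀ t ∈ I, ∀ x ∈ frontier (Ω t),
    surfMatDeriv I Ω Wm s t x - ⟪wm t x, outerNormal (Ω t) x⟫ = s t x * normalStrain Ω Wm t x
  pressure : ∀ t ∈ I, ∀ x ∈ frontier (Ω t), q t x = taylorCoeff Ω P t x * s t x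

/-- The surface measure on `Γ_t = ∂Ω_t`, that is `(d-1)`-dimensional Hausdorff measure with the
Euclidean normalization. -/
def surfaceMeasure (Ω : ℝ → Set (Space d)) (t : ℝ) : Measure (Space d) :=
  (Measure.euclideanHausdorffMeasure (d - 1) : Measure (Space d)).restrict (frontier (Ω t))

/-- The magnetic field `B = (W⁺ - W⁻) / 2`, and likewise its linearization `b = (w⁺ - w⁻) / 2`. -/
def magnetic (Wp Wm : ℝ → Space d → Space d) (t : ℝ) (x : Space d) : Space d :=
  (1 / 2 : ℝ) • (Wp t x - Wm t x)

/-- The state `(w⁺, w⁻, s)` at time `t` lies in the constrained linearized state space: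
it is square integrable, `w⁺` and `w⁻` are divergence-free, and
`∇_B s - b · n = s (n · ∇B) · n` on `Γ_t`. -/
structure MemLinearizedSpace (Ω : ℝ → Set (Space d)) (Wp Wm : ℝ → Space d → Space d)
    (wp wm : ℝ → Space d → Space d) (s : ℝ → Space d → ℝ) (t : ℝ) : Prop where
  memLp_wp : MemLp (wp t) 2 (volume.restrict (Ω t))
  memLp_wm : MemLp (wm t) 2 (volume.restrict (Ω t))
  memLp_s : MemLp (s t) 2 (surfaceMeasure Ω t)
  div_wp : ∀ x ∈ Ω t, div Ω wp t x = 0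
  div_wm : ∀ x ∈ Ω t, div Ω wm t x = 0
  linConstraint : ∀ x ∈ frontier (Ω t),
    surfDirDeriv Ω (magnetic Wp Wm) s t x - ⟪magnetic wp wm t x, outerNormal (Ω t) x⟫ =
      s t x * normalStrain Ω (magnetic Wp Wm) t x

/-- The linearized energy
`½ ∫_{Ω_t} |w⁺|² dx + ½ ∫_{Ω_t} |w⁻|² dx + ∫_{Γ_t} a s² dS`. -/
def linEnergy (Ω : ℝ → Set (Space d)) (P : ℝ → Space d → ℝ)
    (wp wm : ℝ → Space d → Space d) (s : ℝ → Space d → ℝ) (t : ℝ) : ℝ :=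
  (1 / 2) * (∫ x in Ω t, ‖wp t x‖ ^ 2) + (1 / 2) * (∫ x in Ω t, ‖wm t x‖ ^ 2) +
    ∫ x, taylorCoeff Ω P t x * s t x ^ 2 ∂(surfaceMeasure Ω t)

/-- The `W^{1,∞}(Ω_t)` norm of a field that is continuously differentiable on `Ω_t`. -/
def w1infNorm (Ω : ℝ → Set (Space d)) (V : ℝ → Space d → Space d) (t : ℝ) : ℝ≥0∞ :=
  eLpNorm (V t) ∞ (volume.restrict (Ω t)) + eLpNorm (spaceDeriv Ω V t) ∞ (volume.restrict (Ω t))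

/-- The control parameter
`‖(W⁺, W⁻)‖_{W^{1,∞}(Ω_t)} + ‖a⁻¹ (D_t⁺ a, D_t⁻ a)‖_{L^∞(Γ_t)}`. -/
def linControl (I : Set ℝ) (Ω : ℝ → Set (Space d)) (Wp Wm : ℝ → Space d → Space d)
    (P : ℝ → Space d → ℝ) (t : ℝ) : ℝ≥0∞ :=
  (w1infNorm Ω Wp t + w1infNorm Ω Wm t) +
    (eLpNorm (fun x => (taylorCoeff Ω P t x)⁻¹ * surfMatDeriv I Ω Wp (taylorCoeff Ω P) t x) ∞
        (surfaceMeasure Ω t) +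
      eLpNorm (fun x => (taylorCoeff Ω P t x)⁻¹ * surfMatDeriv I Ω Wm (taylorCoeff Ω P) t x) ∞
        (surfaceMeasure Ω t))

end FreeBoundaryMHD

end

open FreeBoundaryMHD

/-! The energy is built so that the pressure work on the free surface cancels. Transport `w⁻` by
`D_t⁺` and `w⁺` by `D_t⁻`. Since `W^±` and `w^±` are divergence-free and `D_t^±` is tangent to the
moving boundary, Reynolds' theorem and Green's formula give for the kinetic energies the interior
terms `-∫ w⁻·(w⁺·∇W⁻)` and `-∫ w⁺·(w⁻·∇W⁺)`, together with the fluxes `-∫ a s w^∓·n`, because the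
linearized pressure equals `a s` on `Γ_t`.

The surface energy can be transported by either field. For a divergence-free tangent `V`, the
surface element stretches at the rate `-(n·∇V)·n`, so `d/dt ∫ g dS = ∫ (D_t g - g (n·∇V)·n) dS`.
With `g = a s²` and the kinematic equation for `s`, this gives `∫ (D_t^± a + a (n·∇W^±)·n) s² + 2 ∫
a s w^±·n`. Both signs compute the same number, so it equals its mean, whose flux part `∫ a s (w⁺ +
w⁻)·n` cancels the pressure fluxes exactly. What remains is quadratic in `(w^±, s)`, with
coefficients controlled by `∇W^±` and `a⁻¹ D_t^± a`. Young's inequality then closes the estimate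
with constant one.

The bulk of the work is calculus on moving `C²` domains, uniform up to the boundary and one-sided at
the endpoint times. Near each spacetime point the implicit function theorem presents the domain as
the region below a `C²` graph in an orthogonal frame (`exists_isGraphChart`). A volume-preserving
shear flattens this region to a fixed half-space, and the area formula turns surface measure into a
density over the horizontal space. The divergence theorem (`divergence_theorem`) and the two
transport theorems (`hasDerivWithinAt_setIntegral`, `hasDerivWithinAt_surfaceIntegral`) hold in one
chart for functions cut off there. A finite, time-independent partition of unity
(`IsMovingDomain.induction_on_cutoff`) makes them global.

The geometric core is `graph_strain_identity`. Differentiating the tangency condition along the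
graph determines the material derivative of the surface element, and the vanishing trace of `∇V`
then turns the surface divergence into the normal strain. -/

noncomputable section

namespace FreeBoundaryMHD

/-! ### Orthogonal frames -/

section Frame

variable {Y E : Type*} [NormedAddCommGroup Y] [InnerProductSpace ℝ Y] [NormedAddCommGroup E]
  [InnerProductSpace ℝ E]

/-- `A` identifies `E` with the Euclidean product of the horizontal space `Y` and the vertical
axis `ℝ`. -/
def IsOrthogonalFrame (A : (Y × ℝ) ≃L[ℝ] E) : Prop :=
  ∀ p q, ⟪A p, A q⟫ = ⟪p.1, q.1⟫ + p.2 * q.2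

theorem IsOrthogonalFrame.norm_sq {A : (Y × ℝ) ≃L[ℝ] E} (hA : IsOrthogonalFrame A) (p : Y × ℝ) :
    ‖A p‖ ^ 2 = ‖p.1‖ ^ 2 + p.2 ^ 2 := by
  rw [← real_inner_self_eq_norm_sq, hA, real_inner_self_eq_norm_sq, sq p.2]

variable [FiniteDimensional ℝ Y] [MeasurableSpace Y] [BorelSpace Y] [FiniteDimensional ℝ E]
  [MeasurableSpace E] [BorelSpace E]

/-- The product norm on `Y × ℝ` is the maximum norm, for which a frame is not an isometry. It is one
for the `L²` product norm, and passing to that norm preserves volume. -/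
theorem IsOrthogonalFrame.measurePreserving {A : (Y × ℝ) ≃L[ℝ] E} (hA : IsOrthogonalFrame A) :
    MeasurePreserving A := by
  let B : WithLp 2 (Y × ℝ) ≃ₗᵢ[ℝ] E :=
    { ((WithLp.prodContinuousLinearEquiv 2 ℝ Y ℝ).trans A).toLinearEquiv with
      norm_map' := fun x => by
        have h := hA.norm_sq (WithLp.ofLp x)
        rw [← sq_eq_sq₀ (norm_nonneg _) (norm_nonneg _), WithLp.prod_norm_sq_eq_of_L2]
        simpa using h }
  exact B.measurePreserving.comp (WithLp.volume_preserving_toLp Y ℝ)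

end Frame

section ExistsFrame

variable {d : ℕ}

/-- The vertical axis must be free to choose: at a boundary point it will be the normalized gradient
of the defining function. An orthonormal basis of `e`'s orthogonal complement supplies the
horizontal space. -/
theorem exists_isOrthogonalFrame (e : Space d) (he : ‖e‖ = 1) :
    ∃ A : (Space (d - 1) × ℝ) ≃L[ℝ] Space d, IsOrthogonalFrame A ∧ A (0, 1) = e := by
  have he0 : e ≠ 0 := by rintro rfl; simp at he
  have hfin : Module.finrank ℝ (ℝ ∙ e)ᗮ = d - 1 := by
    have h1 := Submodule.finrank_add_finrank_orthogonal (ℝ ∙ e)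
    rw [finrank_span_singleton he0, finrank_euclideanSpace_fin] at h1
    omega
  let L : Space (d - 1) →ₗᵢ[ℝ] Space d :=
    (ℝ ∙ e)ᗮ.subtypeₗᵢ.comp ((stdOrthonormalBasis ℝ (ℝ ∙ e)ᗮ).reindex
      (finCongr hfin)).repr.symm.toLinearIsometry
  have hL : ∀ y, ⟪e, L y⟫ = 0 := fun y =>
    Submodule.mem_orthogonal_singleton_iff_inner_right.1
      (((stdOrthonormalBasis ℝ (ℝ ∙ e)ᗮ).reindex (finCongr hfin)).repr.symm y).2
  let f : (Space (d - 1) × ℝ) →ₗ[ℝ] Space d :=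
    L.toLinearMap.coprod (LinearMap.toSpanSingleton ℝ _ e)
  have hf : ∀ p, f p = L p.1 + p.2 • e := fun p => rfl
  have hin : ∀ p q, ⟪f p, f q⟫ = ⟪p.1, q.1⟫ + p.2 * q.2 := fun p q => by
    have h1 : ⟪L p.1, e⟫ = 0 := by rw [real_inner_comm]; exact hL _
    simp only [hf, inner_add_left, inner_add_right, inner_smul_left, inner_smul_right, hL, h1,
      LinearIsometry.inner_map_map, real_inner_self_eq_norm_sq, he]
    simp [mul_comm]
  have hinj : Function.Injective f := by
    rw [injective_iff_map_eq_zero]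
    intro p hp
    have h := hin p p
    rw [hp, inner_zero_left, real_inner_self_eq_norm_sq] at h
    have h1 : ‖p.1‖ = 0 := by nlinarith [norm_nonneg p.1, mul_self_nonneg p.2]
    have h2 : p.2 = 0 := by nlinarith [norm_nonneg p.1, mul_self_nonneg p.2]
    exact Prod.ext (norm_eq_zero.1 h1) h2
  have hd : 1 ≤ d := by
    have := Submodule.finrank_le (ℝ ∙ e)
    rwa [finrank_span_singleton he0, finrank_euclideanSpace_fin] at this
  have hdim : Module.finrank ℝ (Space (d - 1) × ℝ) = Module.finrank ℝ (Space d) := by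
    simp; omega
  refine ⟨(LinearEquiv.ofInjectiveOfFinrankEq f hinj hdim).toContinuousLinearEquiv, ?_, ?_⟩
  · intro p q
    exact hin p q
  · change f (0, 1) = e
    simp [hf]

end ExistsFrame

/-! ### Comparison of measures -/

section MeasureComparison

/-- The hypothesis forces `f` to factor through `g` on `s`, even where `g` is not injective, and the
factor is `K`-Lipschitz on `g '' s`. Lipschitz maps scale Hausdorff measure by at most `K ^ n`. -/
theorem hausdorffMeasure_image_le_of_edist_le {X Z W : Type*} [EMetricSpace X] [EMetricSpace Z]
    [MeasurableSpace X] [BorelSpace X] [MeasurableSpace Z] [BorelSpace Z]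
    {f : W → X} {g : W → Z} {s : Set W} {K : ℝ≥0}
    (h : ∀ x ∈ s, ∀ y ∈ s, edist (f x) (f y) ≤ K * edist (g x) (g y)) {n : ℕ} :
    μHE[n] (f '' s) ≤ (K : ℝ≥0∞) ^ n * μHE[n] (g '' s) := by
  rcases s.eq_empty_or_nonempty with rfl | ⟨w, hw⟩
  · simp
  have : Nonempty W := ⟨w⟩
  have hlip : LipschitzOnWith K (f ∘ Function.invFunOn g s) (g '' s) := by
    rintro _ ⟨x, hx, rfl⟩ _ ⟨y, hy, rfl⟩
    have hx' : ∃ a ∈ s, g a = g x := ⟨x, hx, rfl⟩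
    have hy' : ∃ a ∈ s, g a = g y := ⟨y, hy, rfl⟩
    have := h _ (Function.invFunOn_mem hx') _ (Function.invFunOn_mem hy')
    rwa [Function.invFunOn_eq hx', Function.invFunOn_eq hy'] at this
  have himg : (f ∘ Function.invFunOn g s) '' (g '' s) = f '' s := by
    ext z
    constructor
    · rintro ⟨_, ⟨x, hx, rfl⟩, rfl⟩
      exact ⟨_, Function.invFunOn_mem ⟨x, hx, rfl⟩, rfl⟩
    · rintro ⟨x, hx, rfl⟩
      refine ⟨g x, ⟨x, hx, rfl⟩, ?_⟩
      have hx' : ∃ a ∈ s, g a = g x := ⟨x, hx, rfl⟩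
      have h0 := h _ (Function.invFunOn_mem hx') _ hx
      rw [Function.invFunOn_eq hx', edist_self, mul_zero] at h0
      exact edist_eq_zero.1 (le_antisymm h0 (zero_le))
  have := hlip.hausdorffMeasure_image_le (d := n) (by positivity)
  rw [himg, ENNReal.rpow_natCast] at this
  simp_rw [Measure.euclideanHausdorffMeasure_def, Measure.smul_apply, ENNReal.smul_def, smul_eq_mul]
  rw [mul_left_comm]
  gcongr

/-- A measure inequality that holds locally holds globally. -/
theorem measure_le_of_locally_le {X : Type*} [TopologicalSpace X] [SecondCountableTopology X]
    [MeasurableSpace X] [OpensMeasurableSpace X] {μ ν : Measure X}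
    (h : ∀ x, ∃ u ∈ 𝓝 x, ∀ s ⊆ u, MeasurableSet s → μ s ≤ ν s) : μ ≤ ν := by
  choose u hu hle using h
  obtain ⟨c, hc, hcov⟩ := TopologicalSpace.countable_cover_nhds (f := fun x => interior (u x))
    fun x => interior_mem_nhds.2 (hu x)
  rcases c.eq_empty_or_nonempty with rfl | hne
  · have : IsEmpty X := by
      simp only [mem_empty_iff_false, iUnion_of_empty, iUnion_empty] at hcov
      exact univ_eq_empty_iff.1 hcov.symm
    exact Measure.le_iff.2 fun s _ => by simp [Set.eq_empty_of_isEmpty s]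
  obtain ⟨x, rfl⟩ := hc.exists_eq_range hne
  have hcov' : ⋃ n, disjointed (fun n => interior (u (x n))) n = univ := by
    rw [iUnion_disjointed]
    simpa using hcov
  refine Measure.le_iff.2 fun s hs => ?_
  have hm : ∀ n, MeasurableSet (s ∩ disjointed (fun n => interior (u (x n))) n) := fun n =>
    hs.inter (MeasurableSet.disjointed (fun _ => isOpen_interior.measurableSet) n)
  have hdis : Pairwise (Function.onFun Disjoint
      fun n => s ∩ disjointed (fun n => interior (u (x n))) n) := fun i j hij =>
    (disjoint_disjointed _ hij).mono inter_subset_right inter_subset_right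
  have hs' : s = ⋃ n, s ∩ disjointed (fun n => interior (u (x n))) n := by
    rw [← inter_iUnion, hcov', inter_univ]
  rw [hs', measure_iUnion hdis hm, measure_iUnion hdis hm]
  exact ENNReal.tsum_le_tsum fun n => hle (x n) _ ((inter_subset_right.trans
    (disjointed_subset _ _)).trans interior_subset) (hm n)

end MeasureComparison

/-! ### The area formula for graphs -/

section AreaFormula

variable {Y E : Type*} [NormedAddCommGroup Y] [InnerProductSpace ℝ Y] [NormedAddCommGroup E]
  [InnerProductSpace ℝ E]

/-- An injective linear map on a finite-dimensional space is bounded below, so the `o(‖p.1 - p.2‖)`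
error of strict differentiability is a small fraction of `‖T p.1 - T p.2‖`. -/
theorem eventually_almost_isometric_of_hasStrictFDerivAt [FiniteDimensional ℝ Y] {γ : Y → E}
    {T : Y →L[ℝ] E} {y₀ : Y}
    (h : HasStrictFDerivAt γ T y₀) (hT : Function.Injective T) {K : ℝ} (hK : 1 < K) :
    ∀ᶠ p in 𝓝 (y₀, y₀), ‖γ p.1 - γ p.2‖ ≤ K * ‖T p.1 - T p.2‖ ∧
      ‖T p.1 - T p.2‖ ≤ K * ‖γ p.1 - γ p.2‖ := by
  obtain ⟨c, hc, hcT⟩ := (T : Y →ₗ[ℝ] E).exists_antilipschitzWith (LinearMap.ker_eq_bot.2 hT)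
  have hK0 : 0 < K := by linarith
  -- The relative error `δ = (K - 1) / K` satisfies both `1 + δ ≤ K` and `1 - δ = 1 / K`, which
  -- serve the two inequalities.
  have hδ : 0 < (K - 1) / K := div_pos (by linarith) hK0
  filter_upwards [h.isLittleO.def (c := (K - 1) / K / c) (by positivity)] with p hp
  have h1 : ‖p.1 - p.2‖ ≤ c * ‖T p.1 - T p.2‖ := by
    simpa [dist_eq_norm] using hcT.le_mul_dist p.1 p.2
  have h2 : ‖γ p.1 - γ p.2 - T (p.1 - p.2)‖ ≤ (K - 1) / K * ‖T p.1 - T p.2‖ := by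
    refine hp.trans ?_
    have hc' : (0 : ℝ) < c := hc
    calc (K - 1) / K / c * ‖p.1 - p.2‖ ≤ (K - 1) / K / c * (c * ‖T p.1 - T p.2‖) := by gcongr
      _ = _ := by field_simp
  rw [map_sub] at h2
  have h3 : ‖γ p.1 - γ p.2‖ ≤ ‖γ p.1 - γ p.2 - (T p.1 - T p.2)‖ + ‖T p.1 - T p.2‖ := by
    simpa using norm_add_le (γ p.1 - γ p.2 - (T p.1 - T p.2)) (T p.1 - T p.2)
  have h4 : ‖T p.1 - T p.2‖ ≤ ‖γ p.1 - γ p.2 - (T p.1 - T p.2)‖ + ‖γ p.1 - γ p.2‖ := by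
    have := norm_sub_le (γ p.1 - γ p.2) (γ p.1 - γ p.2 - (T p.1 - T p.2))
    rw [sub_sub_cancel] at this
    linarith
  have h5 : 0 ≤ ‖T p.1 - T p.2‖ := norm_nonneg _
  have h6 : (K - 1) / K + 1 ≤ K := by
    rw [div_add_one hK0.ne', div_le_iff₀ hK0]; nlinarith [sq_nonneg (K - 1)]
  constructor
  · nlinarith
  · have h7 : (1 - (K - 1) / K) * ‖T p.1 - T p.2‖ ≤ ‖γ p.1 - γ p.2‖ := by linarith
    have h8 : 1 - (K - 1) / K = K⁻¹ := by field_simp; ring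
    rw [h8] at h7
    calc ‖T p.1 - T p.2‖ = K * (K⁻¹ * ‖T p.1 - T p.2‖) := by field_simp
      _ ≤ _ := by gcongr

/-- Let `K` decrease to `1`. Continuity of the product needs `ν s` finite, and the other case is
trivial. -/
theorem measure_le_of_forall_one_lt_pow_mul {X : Type*} [MeasurableSpace X] {μ ν : Measure X}
    {n : ℕ} (h : ∀ K : ℝ≥0, 1 < K → μ ≤ (K : ℝ≥0∞) ^ n • ν) : μ ≤ ν := by
  refine Measure.le_iff.2 fun s _ => ?_
  rcases eq_or_ne (ν s) ∞ with htop | htop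
  · simp [htop]
  have ht : Tendsto (fun K : ℝ≥0 => (K : ℝ≥0∞) ^ n * ν s) (𝓝[>] 1) (𝓝 (1 ^ n * ν s)) := by
    refine ENNReal.Tendsto.mul_const ?_ (Or.inr htop)
    have : Tendsto (fun K : ℝ≥0 => ((K ^ n : ℝ≥0) : ℝ≥0∞)) (𝓝 1) (𝓝 ((1 ^ n : ℝ≥0) : ℝ≥0∞)) :=
      ENNReal.tendsto_coe.2 ((continuous_pow n).tendsto 1)
    simpa using this.mono_left nhdsWithin_le_nhds
  rw [one_pow, one_mul] at ht
  refine ge_of_tendsto ht ?_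
  filter_upwards [self_mem_nhdsWithin] with K hK
  simpa using h K hK s

/-- **Area formula** for embedded `C¹` submanifolds given by a global parametrization. -/
theorem comap_euclideanHausdorffMeasure [FiniteDimensional ℝ Y] [MeasurableSpace Y] [BorelSpace Y]
    [MeasurableSpace E] [BorelSpace E] {γ : Y → E} {γ' : Y → Y →L[ℝ] E} {J : Y → ℝ}
    (hγ : MeasurableEmbedding γ) (hγ' : ∀ y, HasStrictFDerivAt γ (γ' y) y)
    (hinj : ∀ y, Function.Injective (γ' y)) (hJ : Continuous J)
    (hJ' : ∀ y, J y = (γ' y : Y →ₗ[ℝ] E).normDet) :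
    (μHE[Module.finrank ℝ Y] : Measure E).comap γ =
      volume.withDensity (fun y => ENNReal.ofReal (J y)) := by
  set n := Module.finrank ℝ Y
  have hJpos : ∀ y, 0 < J y := fun y => by
    rw [hJ']
    have h := ((γ' y : Y →ₗ[ℝ] E).normDet_ne_zero_tfae.out 0 4).2 (hinj y)
    exact lt_of_le_of_ne (LinearMap.normDet_nonneg _) (Ne.symm h)
  -- Of the exponent `n + 1`, the part `n` comes from replacing `γ` by its derivative at `y`, which
  -- is `K`-close to isometric with it. The extra factor `K` pays for the oscillation of `J` near
  -- `y`.
  have key : ∀ K : ℝ≥0, 1 < K → ∀ y, ∃ u ∈ 𝓝 y, ∀ s ⊆ u, MeasurableSet s →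
      ((μHE[n] : Measure E).comap γ s ≤
        (K : ℝ≥0∞) ^ (n + 1) * volume.withDensity (fun y => ENNReal.ofReal (J y)) s) ∧
      (volume.withDensity (fun y => ENNReal.ofReal (J y)) s ≤
        (K : ℝ≥0∞) ^ (n + 1) * (μHE[n] : Measure E).comap γ s) := by
    intro K hK y
    have hK' : (1 : ℝ) < K := by exact_mod_cast hK
    obtain ⟨u, hu, huiso⟩ := Filter.eventually_prod_iff.1 (nhds_prod_eq (x := y) (y := y) ▸
      eventually_almost_isometric_of_hasStrictFDerivAt (hγ' y) (hinj y) hK')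
    obtain ⟨v, hv, huv⟩ := huiso
    have hJ1 : ∀ᶠ z in 𝓝 y, J z < K * J y :=
      hJ.continuousAt.eventually (gt_mem_nhds (by nlinarith [hJpos y]))
    have hJ2 : ∀ᶠ z in 𝓝 y, J y < K * J z := by
      have : ContinuousAt (fun z => K * J z) y := by fun_prop
      exact this.eventually (lt_mem_nhds (by nlinarith [hJpos y]))
    refine ⟨{z | u z ∧ v z ∧ J z < K * J y ∧ J y < K * J z}, hu.and (hv.and (hJ1.and hJ2)),
      fun s hsu hs => ?_⟩
    rw [hγ.comap_apply, withDensity_apply _ hs]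
    -- For the linearization at `y` the formula is exact, with constant density.
    have himg : μHE[n] (γ' y '' s) = ENNReal.ofReal (J y) * volume s := by
      rw [hJ']
      exact (γ' y : Y →ₗ[ℝ] E).euclideanHausdorffMeasure_image_eq_normDet_mul_volume s
    have hconst : ∫⁻ _ in s, ENNReal.ofReal (J y) = ENNReal.ofReal (J y) * volume s := by
      simp
    have hKr : ENNReal.ofReal (K : ℝ) = K := ENNReal.ofReal_coe_nnreal
    constructor
    · calc μHE[n] (γ '' s) ≤ (K : ℝ≥0∞) ^ n * μHE[n] (γ' y '' s) := by
            refine hausdorffMeasure_image_le_of_edist_le fun a ha b hb => ?_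
            have := (huv (hsu ha).1 (hsu hb).2.1).1
            rw [edist_dist, edist_dist, dist_eq_norm, dist_eq_norm, ← hKr,
              ← ENNReal.ofReal_mul (by positivity)]
            exact ENNReal.ofReal_le_ofReal this
        _ = (K : ℝ≥0∞) ^ n * ∫⁻ _ in s, ENNReal.ofReal (J y) := by rw [himg, hconst]
        _ ≤ (K : ℝ≥0∞) ^ n * ∫⁻ z in s, K * ENNReal.ofReal (J z) := by
            gcongr (K : ℝ≥0∞) ^ n * ?_
            refine setLIntegral_mono' hs fun z hz => ?_
            rw [← hKr, ← ENNReal.ofReal_mul (by positivity)]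
            exact ENNReal.ofReal_le_ofReal (hsu hz).2.2.2.le
        _ = _ := by
            rw [lintegral_const_mul' _ _ ENNReal.coe_ne_top, pow_succ, mul_assoc]
    · calc ∫⁻ z in s, ENNReal.ofReal (J z) ≤ ∫⁻ _ in s, K * ENNReal.ofReal (J y) := by
            refine setLIntegral_mono' hs fun z hz => ?_
            rw [← hKr, ← ENNReal.ofReal_mul (by positivity)]
            exact ENNReal.ofReal_le_ofReal (hsu hz).2.2.1.le
        _ = K * μHE[n] (γ' y '' s) := by
            rw [lintegral_const_mul' _ _ ENNReal.coe_ne_top, himg, hconst]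
        _ ≤ K * ((K : ℝ≥0∞) ^ n * μHE[n] (γ '' s)) := by
            gcongr
            refine hausdorffMeasure_image_le_of_edist_le fun a ha b hb => ?_
            have := (huv (hsu ha).1 (hsu hb).2.1).2
            rw [edist_dist, edist_dist, dist_eq_norm, dist_eq_norm, ← hKr,
              ← ENNReal.ofReal_mul (by positivity)]
            exact ENNReal.ofReal_le_ofReal this
        _ = _ := by rw [pow_succ', mul_assoc]
  apply le_antisymm
  · refine measure_le_of_forall_one_lt_pow_mul (n := n + 1) fun K hK =>
      measure_le_of_locally_le fun y => ?_
    obtain ⟨u, hu, h⟩ := key K hK y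
    exact ⟨u, hu, fun s hs hm => (h s hs hm).1⟩
  · refine measure_le_of_forall_one_lt_pow_mul (n := n + 1) fun K hK =>
      measure_le_of_locally_le fun y => ?_
    obtain ⟨u, hu, h⟩ := key K hK y
    exact ⟨u, hu, fun s hs hm => (h s hs hm).2⟩

/-- The parametrization of the graph of `h` in an orthogonal frame. -/
def graphMap (A : (Y × ℝ) ≃L[ℝ] E) (h : Y → ℝ) (y : Y) : E := A (y, h y)

/-- The surface element of the graph of `h`. -/
def graphDensity (h : Y → ℝ) (y : Y) : ℝ := √(1 + ‖fderiv ℝ h y‖ ^ 2)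

/-- The Gram operator `T* T` of the tangent map is the identity plus the rank-one map `v ↦ l v • b`,
with `b` dual to `l`. It is a transvection of determinant `1 + l b = 1 + ‖l‖²`, and this is the
square of the normalized determinant. -/
theorem normDet_graph [FiniteDimensional ℝ Y] {A : (Y × ℝ) ≃L[ℝ] E}
    (hA : IsOrthogonalFrame A) [CompleteSpace E] (l : Y →L[ℝ] ℝ) :
    LinearMap.normDet (((A : (Y × ℝ) →L[ℝ] E) ∘L (.prod (.id ℝ Y) l) : Y →L[ℝ] E) : Y →ₗ[ℝ] E) =
      √(1 + ‖l‖ ^ 2) := by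
  set T : Y →L[ℝ] E := (A : (Y × ℝ) →L[ℝ] E) ∘L (.prod (.id ℝ Y) l)
  set b := (InnerProductSpace.toDual ℝ Y).symm l
  have hb : ∀ v, l v = ⟪b, v⟫ := fun v => by simp [b]
  have hnb : ‖l‖ = ‖b‖ := by simp [b]
  have hadj : (T.adjoint ∘L T : Y →L[ℝ] Y).toLinearMap =
      LinearMap.transvection (l : Y →ₗ[ℝ] ℝ) b := by
    ext v
    refine ext_inner_right ℝ fun w => ?_
    have h1 : ⟪T v, T w⟫ = ⟪v, w⟫ + l v * l w := hA _ _
    simp only [ContinuousLinearMap.coe_coe, ContinuousLinearMap.comp_apply,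
      ContinuousLinearMap.adjoint_inner_left, h1, LinearMap.transvection.apply, inner_add_left,
      inner_smul_left, ← hb]
    simp
  have hsq : (T : Y →ₗ[ℝ] E).normDet ^ 2 = 1 + ‖l‖ ^ 2 := by
    have := T.normDet_sq
    rw [ContinuousLinearMap.det, hadj, LinearMap.transvection.det] at this
    rw [show ((T : Y →ₗ[ℝ] E).normDet ^ 2 : ℝ) = 1 + l b by simpa using this, hb,
      real_inner_self_eq_norm_sq, hnb]
  rw [← hsq, Real.sqrt_sq (LinearMap.normDet_nonneg _)]

theorem isClosedEmbedding_graphMap (A : (Y × ℝ) ≃L[ℝ] E) {h : Y → ℝ} (hh : Continuous h) :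
    IsClosedEmbedding (graphMap A h) :=
  A.toHomeomorph.isClosedEmbedding.comp
    (.of_continuous_injective_isClosedMap (by fun_prop) (fun a b hab => congrArg Prod.fst hab)
      fun s hs => by
        have : (fun y => (y, h y)) '' s = {p | p.1 ∈ s} ∩ {p | p.2 = h p.1} := by
          ext ⟨y, r⟩
          simp only [mem_image, Prod.mk.injEq, mem_inter_iff, Set.mem_ofPred_eq]
          constructor
          · rintro ⟨z, hz, rfl, rfl⟩
            exact ⟨hz, rfl⟩
          · rintro ⟨hy, rfl⟩
            exact ⟨y, hy, rfl, rfl⟩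
        rw [this]
        exact (hs.preimage continuous_fst).inter (isClosed_eq continuous_snd (by fun_prop)))

theorem continuous_graphDensity {h : Y → ℝ} (hh : ContDiff ℝ 1 h) :
    Continuous (graphDensity h) := by
  have hdiff : Continuous (fderiv ℝ h) := hh.continuous_fderiv one_ne_zero
  unfold graphDensity
  fun_prop

variable [FiniteDimensional ℝ Y] [MeasurableSpace Y] [BorelSpace Y] [FiniteDimensional ℝ E]
  [MeasurableSpace E] [BorelSpace E]

theorem comap_graphMap_euclideanHausdorffMeasure {A : (Y × ℝ) ≃L[ℝ] E} (hA : IsOrthogonalFrame A)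
    {h : Y → ℝ} (hh : ContDiff ℝ 1 h) :
    (μHE[Module.finrank ℝ Y] : Measure E).comap (graphMap A h) =
      volume.withDensity (fun y => ENNReal.ofReal (graphDensity h y)) :=
  comap_euclideanHausdorffMeasure (E := E)
    (isClosedEmbedding_graphMap A hh.continuous).measurableEmbedding
    (γ' := fun y => (A : (Y × ℝ) →L[ℝ] E) ∘L (.prod (.id ℝ Y) (fderiv ℝ h y)))
    (fun _ => A.toContinuousLinearMap.hasStrictFDerivAt.comp _
      ((hasStrictFDerivAt_id _).prodMk (hh.contDiffAt.hasStrictFDerivAt one_ne_zero)))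
    (fun _ _ _ hvw => congrArg Prod.fst (A.injective hvw)) (continuous_graphDensity hh)
    (fun _ => (normDet_graph hA _).symm)

/-- The surface integral over a graph. -/
theorem setIntegral_range_graphMap {A : (Y × ℝ) ≃L[ℝ] E} (hA : IsOrthogonalFrame A) {h : Y → ℝ}
    (hh : ContDiff ℝ 1 h) (g : E → ℝ) :
    ∫ x in range (graphMap A h), g x ∂(μHE[Module.finrank ℝ Y]) =
      ∫ y, graphDensity h y * g (graphMap A h y) := by
  have hemb : MeasurableEmbedding (graphMap A h) :=
    (isClosedEmbedding_graphMap A hh.continuous).measurableEmbedding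
  have hJ := continuous_graphDensity hh
  rw [← hemb.map_comap, comap_graphMap_euclideanHausdorffMeasure hA hh, hemb.integral_map,
    integral_withDensity_eq_integral_toReal_smul (by fun_prop) (by simp)]
  refine integral_congr_ae (.of_forall fun y => ?_)
  simp only [graphDensity, ENNReal.toReal_ofReal (Real.sqrt_nonneg _), smul_eq_mul]

end AreaFormula

/-! ### Differentiation under the integral sign -/

section Leibniz

variable {Z : Type*} [NormedAddCommGroup Z] [NormedSpace ℝ Z] [FiniteDimensional ℝ Z]
  [MeasurableSpace Z] [BorelSpace Z]

/-- Differentiation under the integral sign for a `C¹` function of compact support on a closed set,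
one-sided at the endpoints of the time interval. -/
theorem hasDerivWithinAt_setIntegral_of_contDiffOn {μ : Measure Z} [IsFiniteMeasureOnCompacts μ]
    {a b : ℝ} (hab : a < b) {S : Set Z} (hS : IsClosed S) (hSu : UniqueDiffOn ℝ S)
    {k : ℝ × Z → ℝ} (hk : ContDiffOn ℝ 1 k (Icc a b ×ˢ S)) {K : Set Z} (hK : IsCompact K)
    (hsupp : ∀ t ∈ Icc a b, ∀ z ∈ S, z ∉ K → k (t, z) = 0) {t₀ : ℝ} (ht₀ : t₀ ∈ Icc a b) :
    HasDerivWithinAt (fun t => ∫ z in S, k (t, z) ∂μ)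
      (∫ z in S, fderivWithin ℝ k (Icc a b ×ˢ S) (t₀, z) (1, 0) ∂μ) (Icc a b) t₀ := by
  have : ProperSpace Z := FiniteDimensional.proper ℝ Z
  have hU : UniqueDiffOn ℝ (Icc a b ×ˢ S) := (uniqueDiffOn_Icc hab).prod hSu
  have hderiv : ∀ t ∈ Icc a b, ∀ z ∈ S, HasDerivWithinAt (fun t => k (t, z))
      (fderivWithin ℝ k (Icc a b ×ˢ S) (t, z) (1, 0)) (Icc a b) t := fun t ht z hz =>
    (hk.differentiableOn one_ne_zero _ (mk_mem_prod ht hz)).hasFDerivWithinAt.comp_hasDerivWithinAt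
      (f := fun t => (t, z)) t ((hasDerivWithinAt_id t _).prodMk (hasDerivWithinAt_const _ _ _))
      fun s hs => mk_mem_prod hs hz
  have hD : ContinuousOn (fun p => fderivWithin ℝ k (Icc a b ×ˢ S) p (1, 0)) (Icc a b ×ˢ S) :=
    (hk.continuousOn_fderivWithin hU le_rfl).clm_apply continuousOn_const
  -- By the mean value inequality this bound also dominates every difference quotient in time over
  -- `S ∩ K`. Off `K` the quotients vanish, so `C` times the indicator of `S ∩ K` is the dominating
  -- function.
  obtain ⟨C, hC⟩ := (isCompact_Icc.prod (hK.inter_left hS)).exists_bound_of_continuousOn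
    (hD.mono (prod_mono_right inter_subset_left))
  have hmeas : ∀ t ∈ Icc a b, AEStronglyMeasurable (fun z => k (t, z)) (μ.restrict S) :=
    fun t ht => (hk.continuousOn.comp (by fun_prop) fun z hz => mk_mem_prod ht hz :
      ContinuousOn (fun z => k (t, z)) S).aestronglyMeasurable hS.measurableSet
  have hint : ∀ t ∈ Icc a b, IntegrableOn (fun z => k (t, z)) S μ := by
    intro t ht
    have h1 : IntegrableOn (fun z => k (t, z)) (S ∩ K) μ :=
      ((hk.continuousOn.comp (by fun_prop) fun z hz => mk_mem_prod ht hz :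
        ContinuousOn (fun z => k (t, z)) S).mono inter_subset_left).integrableOn_compact
        (hK.inter_left hS)
    refine h1.of_forall_sdiff_eq_zero hS.measurableSet fun z hz => ?_
    exact hsupp t ht z hz.1 fun h => hz.2 ⟨hz.1, h⟩
  rw [hasDerivWithinAt_iff_tendsto_slope]
  have hslope : ∀ t ∈ Icc a b, slope (fun t => ∫ z in S, k (t, z) ∂μ) t₀ t =
      ∫ z in S, slope (fun t => k (t, z)) t₀ t ∂μ := fun t ht => by
    simp only [slope, vsub_eq_sub, smul_eq_mul]
    rw [integral_const_mul, integral_sub (hint t ht) (hint t₀ ht₀)]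
  refine Tendsto.congr' (f₁ := fun t => ∫ z in S, slope (fun t => k (t, z)) t₀ t ∂μ) ?_ ?_
  · filter_upwards [self_mem_nhdsWithin] with t ht using (hslope t ht.1).symm
  refine tendsto_integral_filter_of_dominated_convergence
    (fun z => (S ∩ K).indicator (fun _ => C) z) ?_ ?_ ?_ ?_
  · filter_upwards [self_mem_nhdsWithin] with t ht
    simp only [slope, vsub_eq_sub, smul_eq_mul]
    exact ((hmeas t ht.1).sub (hmeas t₀ ht₀)).const_mul _
  · filter_upwards [self_mem_nhdsWithin] with t ht
    filter_upwards [ae_restrict_mem hS.measurableSet] with z hz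
    by_cases hzK : z ∈ K
    · rw [indicator_of_mem (show z ∈ S ∩ K from ⟨hz, hzK⟩)]
      have := (convex_Icc a b).norm_image_sub_le_of_norm_hasDerivWithin_le
        (fun s hs => hderiv s hs z hz) (fun s hs => hC (s, z) (mk_mem_prod hs ⟨hz, hzK⟩)) ht₀ ht.1
      rw [slope, vsub_eq_sub, norm_smul, norm_inv, inv_mul_le_iff₀, mul_comm]
      · exact this
      · exact norm_pos_iff.2 (sub_ne_zero.2 ht.2)
    · rw [indicator_of_notMem (fun h => hzK h.2)]
      simp [slope, hsupp t ht.1 z hz hzK, hsupp t₀ ht₀ z hz hzK]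
  · refine (Integrable.mono_measure (ν := μ) ?_ Measure.restrict_le_self)
    exact (integrable_indicator_iff ((hK.inter_left hS).measurableSet)).2
      (integrableOn_const (hs := (hK.inter_left hS).measure_lt_top.ne))
  · filter_upwards [ae_restrict_mem hS.measurableSet] with z hz
    exact hasDerivWithinAt_iff_tendsto_slope.1 (hderiv t₀ ht₀ z hz)

end Leibniz

/-! ### Integration of derivatives over a half-space -/

section HalfSpace

variable {Y : Type*} [NormedAddCommGroup Y] [InnerProductSpace ℝ Y]

variable (Y) in
/-- The closed lower half-space of `Y × ℝ`. -/
def lowerHalf : Set (Y × ℝ) := univ ×ˢ Iic 0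

theorem isClosed_lowerHalf {Y : Type*} [NormedAddCommGroup Y] : IsClosed (lowerHalf Y) :=
  isClosed_univ.prod isClosed_Iic

theorem uniqueDiffOn_lowerHalf : UniqueDiffOn ℝ (lowerHalf Y) :=
  uniqueDiffOn_univ.prod (uniqueDiffOn_Iic 0)

variable {k : Y × ℝ → ℝ} {K : Set (Y × ℝ)}

theorem fderivWithin_eq_zero_of_notMem (hK : IsCompact K)
    (hsupp : ∀ p ∈ lowerHalf Y, p ∉ K → k p = 0) {p : Y × ℝ} (hp : p ∈ lowerHalf Y)
    (hpK : p ∉ K) : fderivWithin ℝ k (lowerHalf Y) p = 0 := by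
  have h : k =ᶠ[𝓝[lowerHalf Y] p] fun _ => 0 := by
    filter_upwards [self_mem_nhdsWithin, mem_nhdsWithin_of_mem_nhds
      (hK.isClosed.isOpen_compl.mem_nhds hpK)] with q hq hqK using hsupp q hq hqK
  rw [h.fderivWithin_eq (hsupp p hp hpK)]
  simp

variable [FiniteDimensional ℝ Y] [MeasurableSpace Y] [BorelSpace Y]

theorem restrict_lowerHalf : (volume : Measure (Y × ℝ)).restrict (lowerHalf Y) =
    (volume : Measure Y).prod ((volume : Measure ℝ).restrict (Iic 0)) := by
  rw [lowerHalf, Measure.volume_eq_prod, ← Measure.prod_restrict, Measure.restrict_univ]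

/-- Integration by parts against the constant function `1`. -/
theorem integral_fderiv_eq_zero {g : Y → ℝ} (hg : ContDiff ℝ 1 g) (hc : HasCompactSupport g)
    (v : Y) : ∫ y, fderiv ℝ g y v = 0 := by
  have hcont : Continuous (fun y => fderiv ℝ g y v) :=
    (hg.continuous_fderiv one_ne_zero).clm_apply continuous_const
  have h := integral_mul_fderiv_eq_neg_fderiv_mul_of_integrable (μ := (volume : Measure Y))
    (f := fun _ : Y => (1 : ℝ)) (g := g) (v := v) (by simp)
    (by simpa using hcont.integrable_of_hasCompactSupport (hc.fderiv_apply (𝕜 := ℝ) v))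
    (by simpa using hg.continuous.integrable_of_hasCompactSupport hc)
    (fun _ _ => by fun_prop) (fun x _ => hg.differentiable one_ne_zero x)
  simpa using h

theorem integrableOn_fderivWithin_lowerHalf (hk : ContDiffOn ℝ 1 k (lowerHalf Y))
    (hK : IsCompact K) (hsupp : ∀ p ∈ lowerHalf Y, p ∉ K → k p = 0) (v : Y × ℝ) :
    IntegrableOn (fun p => fderivWithin ℝ k (lowerHalf Y) p v) (lowerHalf Y) := by
  have hD : ContinuousOn (fun p => fderivWithin ℝ k (lowerHalf Y) p v) (lowerHalf Y) :=
    (hk.continuousOn_fderivWithin uniqueDiffOn_lowerHalf le_rfl).clm_apply continuousOn_const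
  refine ((hD.mono inter_subset_left).integrableOn_compact
    (hK.inter_left isClosed_lowerHalf)).of_forall_sdiff_eq_zero
    isClosed_lowerHalf.measurableSet fun p hp => ?_
  rw [fderivWithin_eq_zero_of_notMem hK hsupp hp.1 fun h => hp.2 ⟨hp.1, h⟩]
  rfl

/-- Fubini and the fundamental theorem of calculus on each vertical half-line. Compact support kills
the end at `-∞`, leaving the trace on the boundary hyperplane. -/
theorem setIntegral_fderivWithin_vertical (hk : ContDiffOn ℝ 1 k (lowerHalf Y))
    (hK : IsCompact K) (hsupp : ∀ p ∈ lowerHalf Y, p ∉ K → k p = 0) :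
    ∫ p in lowerHalf Y, fderivWithin ℝ k (lowerHalf Y) p (0, 1) = ∫ y, k (y, 0) := by
  have hint := integrableOn_fderivWithin_lowerHalf hk hK hsupp (0, 1)
  have hmem : ∀ y : Y, ∀ r ≤ (0 : ℝ), (y, r) ∈ lowerHalf Y := fun y r hr => ⟨trivial, hr⟩
  rw [IntegrableOn, restrict_lowerHalf] at hint
  rw [restrict_lowerHalf, integral_prod _ hint]
  refine integral_congr_ae (.of_forall fun y => ?_)
  have hderiv : ∀ r ≤ (0 : ℝ), HasDerivWithinAt (fun r => k (y, r))
      (fderivWithin ℝ k (lowerHalf Y) (y, r) (0, 1)) (Iic 0) r := fun r hr =>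
    ((hk.differentiableOn one_ne_zero _ (hmem y r hr)).hasFDerivWithinAt).comp_hasDerivWithinAt
      (f := fun r => (y, r)) r ((hasDerivWithinAt_const _ _ _).prodMk (hasDerivWithinAt_id r _))
      fun s hs => hmem y s hs
  obtain ⟨R, hR⟩ := hK.isBounded.subset_closedBall 0
  have hzero : ∀ r ≤ (0 : ℝ), r < -R → (y, r) ∉ K := fun r hr hrR hmemK => by
    have h1 := hR hmemK
    rw [mem_closedBall_zero_iff, Prod.norm_def] at h1
    have h2 : |r| ≤ R := (le_max_right _ _).trans h1
    linarith [abs_le.1 h2]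
  have hcontD : ContinuousOn (fun r => fderivWithin ℝ k (lowerHalf Y) (y, r) (0, 1)) (Iic 0) :=
    ((hk.continuousOn_fderivWithin uniqueDiffOn_lowerHalf le_rfl).clm_apply
      continuousOn_const).comp (by fun_prop) fun r hr => hmem y r hr
  have := integral_Iic_of_hasDerivAt_of_tendsto (a := 0) (m := 0) (f := fun r => k (y, r))
    (f' := fun r => fderivWithin ℝ k (lowerHalf Y) (y, r) (0, 1))
    (hderiv 0 le_rfl).continuousWithinAt
    (fun r hr => (hderiv r (le_of_lt hr)).hasDerivAt (Iic_mem_nhds hr)) ?_ ?_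
  · simpa using this
  · refine ((hcontD.mono Icc_subset_Iic_self).integrableOn_compact
      (isCompact_Icc (a := min 0 (-R)))).of_forall_sdiff_eq_zero measurableSet_Iic fun r hr => ?_
    have hr0 : r ≤ 0 := hr.1
    have : r < min 0 (-R) := not_le.1 fun h => hr.2 ⟨h, hr0⟩
    rw [fderivWithin_eq_zero_of_notMem hK hsupp (hmem y r hr0)
      (hzero r hr0 (lt_min_iff.1 this).2)]
    rfl
  · refine tendsto_const_nhds.congr' ?_
    filter_upwards [Iio_mem_atBot (min 0 (-R))] with r hr
    have hr' := lt_min_iff.1 (mem_Iio.1 hr)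
    exact (hsupp _ (hmem y r hr'.1.le) (hzero r hr'.1.le hr'.2)).symm

/-- Each horizontal slice is a whole copy of `Y`, on which a compactly supported derivative
integrates to zero, so no boundary term arises. -/
theorem setIntegral_fderivWithin_horizontal (hk : ContDiffOn ℝ 1 k (lowerHalf Y))
    (hK : IsCompact K) (hsupp : ∀ p ∈ lowerHalf Y, p ∉ K → k p = 0) (v : Y) :
    ∫ p in lowerHalf Y, fderivWithin ℝ k (lowerHalf Y) p (v, 0) = 0 := by
  have hint := integrableOn_fderivWithin_lowerHalf hk hK hsupp (v, 0)
  have hmem : ∀ y : Y, ∀ r ≤ (0 : ℝ), (y, r) ∈ lowerHalf Y := fun y r hr => ⟨trivial, hr⟩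
  rw [IntegrableOn, restrict_lowerHalf] at hint
  rw [restrict_lowerHalf, integral_prod_symm _ hint]
  refine (integral_congr_ae (g := fun _ => (0 : ℝ)) ?_).trans (by simp)
  filter_upwards [ae_restrict_mem measurableSet_Iic] with r hr
  have hslice : ContDiff ℝ 1 (fun y => k (y, r)) :=
    contDiffOn_univ.1 (hk.comp (by fun_prop) fun y _ => hmem y r hr)
  have hD : ∀ y, fderiv ℝ (fun y => k (y, r)) y v =
      fderivWithin ℝ k (lowerHalf Y) (y, r) (v, 0) := fun y => by
    have h1 := ((hk.differentiableOn one_ne_zero _ (hmem y r hr)).hasFDerivWithinAt).comp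
      (s := univ) (f := fun y => (y, r)) y
      ((hasFDerivWithinAt_id y _).prodMk (hasFDerivWithinAt_const _ _ _))
      fun z _ => hmem z r hr
    rw [hasFDerivWithinAt_univ] at h1
    have h2 := h1.fderiv
    simp only [Function.comp_def] at h2
    rw [h2]
    rfl
  have hc : HasCompactSupport (fun y => k (y, r)) :=
    HasCompactSupport.intro (hK.image continuous_fst) fun y hy =>
      hsupp _ (hmem y r hr) fun h => hy ⟨_, h, rfl⟩
  exact (integral_congr_ae (.of_forall fun y => (hD y).symm)).trans
    (integral_fderiv_eq_zero hslice hc v)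

end HalfSpace

/-! ### The divergence theorem below a graph -/

section Subgraph

variable {Y E : Type*} [NormedAddCommGroup Y] [InnerProductSpace ℝ Y] [NormedAddCommGroup E]
  [InnerProductSpace ℝ E]

/-- The closed region below the graph of `h` in the frame `A`. -/
def subgraph (A : (Y × ℝ) ≃L[ℝ] E) (h : Y → ℝ) : Set E := {x | (A.symm x).2 ≤ h (A.symm x).1}

/-- The shear that maps the lower half-space onto the region below the graph of `h`. -/
def shear (A : (Y × ℝ) ≃L[ℝ] E) (h : Y → ℝ) (p : Y × ℝ) : E := A (p.1, p.2 + h p.1)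

/-- The inverse of `shear`. -/
def unshear (A : (Y × ℝ) ≃L[ℝ] E) (h : Y → ℝ) (x : E) : Y × ℝ :=
  ((A.symm x).1, (A.symm x).2 - h (A.symm x).1)

theorem unshear_shear (A : (Y × ℝ) ≃L[ℝ] E) (h : Y → ℝ) (p : Y × ℝ) :
    unshear A h (shear A h p) = p := by
  simp [unshear, shear]

theorem shear_unshear (A : (Y × ℝ) ≃L[ℝ] E) (h : Y → ℝ) (x : E) :
    shear A h (unshear A h x) = x := by
  simp [unshear, shear]

theorem continuous_shear (A : (Y × ℝ) ≃L[ℝ] E) {h : Y → ℝ} (hh : Continuous h) :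
    Continuous (shear A h) := by unfold shear; fun_prop

theorem continuous_unshear (A : (Y × ℝ) ≃L[ℝ] E) {h : Y → ℝ} (hh : Continuous h) :
    Continuous (unshear A h) := by unfold unshear; fun_prop

theorem shear_mem_subgraph_iff (A : (Y × ℝ) ≃L[ℝ] E) (h : Y → ℝ) (p : Y × ℝ) :
    shear A h p ∈ subgraph A h ↔ p ∈ lowerHalf Y := by
  simp [subgraph, shear, lowerHalf]

theorem shear_zero (A : (Y × ℝ) ≃L[ℝ] E) (h : Y → ℝ) (y : Y) :
    shear A h (y, 0) = graphMap A h y := by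
  simp [shear, graphMap]

theorem measurableEmbedding_shear [MeasurableSpace Y] [BorelSpace Y]
    [MeasurableSpace E] [BorelSpace E] (A : (Y × ℝ) ≃L[ℝ] E) {h : Y → ℝ} (hh : Continuous h) :
    MeasurableEmbedding (shear A h) :=
  (Homeomorph.mk ⟨shear A h, unshear A h, unshear_shear A h, shear_unshear A h⟩
    (continuous_shear A hh) (continuous_unshear A hh)).measurableEmbedding

theorem hasFDerivAt_shear (A : (Y × ℝ) ≃L[ℝ] E) {h : Y → ℝ} (hh : ContDiff ℝ 1 h) (p : Y × ℝ) :
    HasFDerivAt (shear A h) ((A : (Y × ℝ) →L[ℝ] E) ∘L ((ContinuousLinearMap.fst ℝ Y ℝ).prod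
      (ContinuousLinearMap.snd ℝ Y ℝ + (fderiv ℝ h p.1) ∘L ContinuousLinearMap.fst ℝ Y ℝ))) p :=
  A.toContinuousLinearMap.hasFDerivAt.comp p (hasFDerivAt_fst.prodMk (hasFDerivAt_snd.add
    (((hh.differentiable one_ne_zero p.1).hasFDerivAt).comp p hasFDerivAt_fst)))

theorem contDiff_shear (A : (Y × ℝ) ≃L[ℝ] E) {h : Y → ℝ} {n : WithTop ℕ∞} (hh : ContDiff ℝ n h) :
    ContDiff ℝ n (shear A h) := by
  unfold shear; fun_prop

/-- The region is the image of the half-space under the shear, whose derivative is surjective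
everywhere. -/
theorem uniqueDiffOn_subgraph (A : (Y × ℝ) ≃L[ℝ] E) {h : Y → ℝ} (hh : ContDiff ℝ 1 h) :
    UniqueDiffOn ℝ (subgraph A h) := by
  have himg : subgraph A h = shear A h '' lowerHalf Y := by
    ext x
    constructor
    · intro hx
      refine ⟨unshear A h x, ?_, shear_unshear A h x⟩
      rwa [← shear_mem_subgraph_iff A h, shear_unshear]
    · rintro ⟨p, hp, rfl⟩
      exact (shear_mem_subgraph_iff A h p).2 hp
  rw [himg]
  refine uniqueDiffOn_lowerHalf.image (fun p _ => (hasFDerivAt_shear A hh p).hasFDerivWithinAt)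
    fun p _ => Function.Surjective.denseRange fun x => ?_
  refine ⟨((A.symm x).1, (A.symm x).2 - fderiv ℝ h p.1 (A.symm x).1), ?_⟩
  simp

/-- The trace of an endomorphism, computed in an orthogonal frame. -/
theorem trace_eq_sum_frame (A : (Y × ℝ) ≃L[ℝ] E) {ι : Type*} [Fintype ι]
    (b : OrthonormalBasis ι ℝ Y) (M : E →L[ℝ] E) :
    LinearMap.trace ℝ E M = (∑ j, ⟪b j, (A.symm (M (A (b j, 0)))).1⟫) +
      (A.symm (M (A (0, 1)))).2 := by
  classical
  let B : Module.Basis (ι ⊕ Unit) ℝ E :=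
    (b.toBasis.prod (Module.Basis.singleton Unit ℝ)).map A.toLinearEquiv
  rw [LinearMap.trace_eq_matrix_trace ℝ B, Matrix.trace, Fintype.sum_sum_type]
  simp only [Matrix.diag_apply, LinearMap.toMatrix_apply, B]
  simp [b.repr_apply_apply]

/-- The divergence theorem for the region below a `C²` graph and a field of compact support. -/
theorem setIntegral_trace_fderivWithin_subgraph [FiniteDimensional ℝ Y]
    [MeasurableSpace Y] [BorelSpace Y] {A : (Y × ℝ) ≃L[ℝ] E}
    {h : Y → ℝ} (hh : ContDiff ℝ 2 h) {F : E → E} (hF : ContDiffOn ℝ 1 F (subgraph A h))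
    {K : Set E} (hK : IsCompact K) (hsupp : ∀ x ∈ subgraph A h, x ∉ K → F x = 0) :
    ∫ p in lowerHalf Y, LinearMap.trace ℝ E (fderivWithin ℝ F (subgraph A h) (shear A h p)) =
      ∫ y, ((A.symm (F (graphMap A h y))).2 - fderiv ℝ h y (A.symm (F (graphMap A h y))).1) := by
  have hh1 : ContDiff ℝ 1 h := hh.of_le (by norm_num)
  have hmaps : MapsTo (shear A h) (lowerHalf Y) (subgraph A h) := fun p hp =>
    (shear_mem_subgraph_iff A h p).2 hp
  set G : Y × ℝ → Y × ℝ := fun p => A.symm (F (shear A h p))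
  have hG : ContDiffOn ℝ 1 G (lowerHalf Y) :=
    A.symm.contDiff.comp_contDiffOn (hF.comp (contDiff_shear A hh1).contDiffOn hmaps)
  set K' : Set (Y × ℝ) := unshear A h '' K
  have hK' : IsCompact K' := hK.image (continuous_unshear A hh.continuous)
  have hG0 : ∀ p ∈ lowerHalf Y, p ∉ K' → G p = 0 := fun p hp hpK => by
    have : F (shear A h p) = 0 := hsupp _ (hmaps hp) fun hx => hpK ⟨_, hx, unshear_shear A h p⟩
    simp [G, this]
  have hDG : ∀ p ∈ lowerHalf Y, HasFDerivWithinAt G (fderivWithin ℝ G (lowerHalf Y) p)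
      (lowerHalf Y) p := fun p hp => (hG.differentiableOn one_ne_zero p hp).hasFDerivWithinAt
  have hchain : ∀ p ∈ lowerHalf Y, ∀ v : Y × ℝ, fderivWithin ℝ G (lowerHalf Y) p v =
      A.symm (fderivWithin ℝ F (subgraph A h) (shear A h p) 
        (A (v.1, v.2 + fderiv ℝ h p.1 v.1))) := by
    intro p hp v
    have h1 := ((hF.differentiableOn one_ne_zero _ (hmaps hp)).hasFDerivWithinAt).comp p
      (hasFDerivAt_shear A hh1 p).hasFDerivWithinAt hmaps
    have h2 := A.symm.toContinuousLinearMap.hasFDerivAt.comp_hasFDerivWithinAt p h1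
    have h3 := h2.fderivWithin (uniqueDiffOn_lowerHalf p hp)
    change fderivWithin ℝ G (lowerHalf Y) p = _ at h3
    rw [h3]
    rfl
  let b := stdOrthonormalBasis ℝ Y
  -- In flattened coordinates the divergence is the sum of the horizontal derivatives of the
  -- components `k j` and the vertical derivative of `m`, the pairing of the field with the conormal
  -- `(-∇h, 1)`. On the boundary hyperplane `m` is the flux density. As `m` contains `∇h`, its `C¹`
  -- regularity uses that `h` is `C²`.
  let k : Fin (Module.finrank ℝ Y) → Y × ℝ → ℝ := fun j p => ⟪b j, (G p).1⟫
  let m : Y × ℝ → ℝ := fun p => (G p).2 - fderiv ℝ h p.1 (G p).1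
  have hk : ∀ j, ContDiffOn ℝ 1 (k j) (lowerHalf Y) := fun j =>
    contDiffOn_const.inner ℝ hG.fst
  have hdh : ContDiff ℝ 1 (fun p : Y × ℝ => fderiv ℝ h p.1) :=
    (hh.fderiv_right (m := 1) (by norm_num)).comp contDiff_fst
  have hm : ContDiffOn ℝ 1 m (lowerHalf Y) :=
    hG.snd.sub (hdh.contDiffOn.clm_apply hG.fst)
  have hk0 : ∀ j, ∀ p ∈ lowerHalf Y, p ∉ K' → k j p = 0 := fun j p hp hpK => by
    simp [k, hG0 p hp hpK]
  have hm0 : ∀ p ∈ lowerHalf Y, p ∉ K' → m p = 0 := fun p hp hpK => by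
    simp [m, hG0 p hp hpK]
  have hDk : ∀ j, ∀ p ∈ lowerHalf Y, fderivWithin ℝ (k j) (lowerHalf Y) p (b j, 0) =
      ⟪b j, (fderivWithin ℝ G (lowerHalf Y) p (b j, 0)).1⟫ := fun j p hp => by
    have h1 := ((innerSL ℝ (b j)).hasFDerivAt (x := (G p).1)).comp_hasFDerivWithinAt p
      ((ContinuousLinearMap.fst ℝ Y ℝ).hasFDerivAt.comp_hasFDerivWithinAt p (hDG p hp))
    have h2 := h1.fderivWithin (uniqueDiffOn_lowerHalf p hp)
    change fderivWithin ℝ (k j) (lowerHalf Y) p = _ at h2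
    rw [h2]
    rfl
  have hDm : ∀ p ∈ lowerHalf Y, fderivWithin ℝ m (lowerHalf Y) p (0, 1) =
      (fderivWithin ℝ G (lowerHalf Y) p (0, 1)).2 -
        fderiv ℝ h p.1 (fderivWithin ℝ G (lowerHalf Y) p (0, 1)).1 := fun p hp => by
    have hd : HasFDerivAt (fun p : Y × ℝ => fderiv ℝ h p.1)
        ((fderiv ℝ (fderiv ℝ h) p.1) ∘L ContinuousLinearMap.fst ℝ Y ℝ) p :=
      (((hh.fderiv_right (m := 1) (by norm_num)).differentiable one_ne_zero
        p.1).hasFDerivAt).comp p hasFDerivAt_fst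
    have h1 := ((ContinuousLinearMap.snd ℝ Y ℝ).hasFDerivAt.comp_hasFDerivWithinAt p
      (hDG p hp)).sub (hd.hasFDerivWithinAt.clm_apply
      ((ContinuousLinearMap.fst ℝ Y ℝ).hasFDerivAt.comp_hasFDerivWithinAt p (hDG p hp)))
    have h2 := h1.fderivWithin (uniqueDiffOn_lowerHalf p hp)
    change fderivWithin ℝ m (lowerHalf Y) p = _ at h2
    rw [h2]
    simp
  have htrace : ∀ p ∈ lowerHalf Y,
      LinearMap.trace ℝ E (fderivWithin ℝ F (subgraph A h) (shear A h p)) =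
        (∑ j, fderivWithin ℝ (k j) (lowerHalf Y) p (b j, 0)) +
          fderivWithin ℝ m (lowerHalf Y) p (0, 1) := by
    intro p hp
    -- The shear tilts horizontal directions by the slope of `h`, so the direction `(b j, 0)` of the
    -- frame corresponds to `(b j, -h' (b j))` in flattened coordinates.
    have hv : ∀ j, A.symm (fderivWithin ℝ F (subgraph A h) (shear A h p) (A (b j, 0))) =
        fderivWithin ℝ G (lowerHalf Y) p (b j, 0) -
          fderiv ℝ h p.1 (b j) • fderivWithin ℝ G (lowerHalf Y) p (0, 1) := fun j => by
      rw [← map_smul, ← map_sub, hchain p hp]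
      simp
    have hw : A.symm (fderivWithin ℝ F (subgraph A h) (shear A h p) (A (0, 1))) =
        fderivWithin ℝ G (lowerHalf Y) p (0, 1) := by
      rw [hchain p hp]; simp
    have hsum : ∀ w : Y, ∑ j, fderiv ℝ h p.1 (b j) * ⟪b j, w⟫ = fderiv ℝ h p.1 w := fun w => by
      conv_rhs => rw [← b.sum_repr' w, map_sum]
      simp [mul_comm]
    rw [trace_eq_sum_frame A b, hDm p hp, hw]
    simp only [hDk _ p hp, hv, Prod.fst_sub, Prod.smul_fst, inner_sub_right, inner_smul_right,
      Finset.sum_sub_distrib, hsum]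
    ring
  rw [setIntegral_congr_fun isClosed_lowerHalf.measurableSet htrace, integral_add,
    integral_finsetSum,
    Finset.sum_eq_zero, zero_add, setIntegral_fderivWithin_vertical hm hK' hm0]
  · simp only [m, G, shear_zero]
  · exact fun j _ => setIntegral_fderivWithin_horizontal (hk j) hK' (hk0 j) _
  · exact fun j _ => integrableOn_fderivWithin_lowerHalf (hk j) hK' (hk0 j) _
  · exact integrable_finsetSum _ fun j _ =>
      integrableOn_fderivWithin_lowerHalf (hk j) hK' (hk0 j) _
  · exact integrableOn_fderivWithin_lowerHalf hm hK' hm0 _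

variable [FiniteDimensional ℝ Y] [MeasurableSpace Y] [BorelSpace Y] [FiniteDimensional ℝ E]
  [MeasurableSpace E] [BorelSpace E]

/-- The shear translates each vertical line, so it preserves volume by Fubini. No Jacobian appears
in the flattened integrals. -/
theorem IsOrthogonalFrame.measurePreserving_shear {A : (Y × ℝ) ≃L[ℝ] E} (hA : IsOrthogonalFrame A)
    {h : Y → ℝ} (hh : Continuous h) : MeasurePreserving (shear A h) := by
  have h1 : MeasurePreserving (fun p : Y × ℝ => (p.1, p.2 + h p.1)) :=
    (MeasurePreserving.id (volume : Measure Y)).skew_product (g := fun y r => r + h y)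
      (by fun_prop) (.of_forall fun y => map_add_right_eq_self volume (h y))
  exact hA.measurePreserving.comp h1

/-- The region strictly below a graph has the same integrals as the closed region. -/
theorem IsOrthogonalFrame.setIntegral_lt_graph {A : (Y × ℝ) ≃L[ℝ] E} (hA : IsOrthogonalFrame A)
    {h : Y → ℝ} (hh : Continuous h) (g : E → ℝ) :
    ∫ x in {x | (A.symm x).2 < h (A.symm x).1}, g x = ∫ p in lowerHalf Y, g (shear A h p) := by
  rw [← (hA.measurePreserving_shear hh).setIntegral_preimage_emb (measurableEmbedding_shear A hh)]
  have : shear A h ⁻¹' {x | (A.symm x).2 < h (A.symm x).1} = univ ×ˢ Iio 0 := by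
    ext p; simp [shear]
  rw [this]
  -- Only the hyperplane `r = 0`, a null set, separates the open from the closed half-space.
  refine setIntegral_congr_set ?_
  rw [lowerHalf, Measure.volume_eq_prod]
  exact Measure.set_prod_ae_eq (ae_eq_refl _) Iio_ae_eq_Iic

end Subgraph

/-! ### Existence of graph charts -/

section ChartExistence

variable {d : ℕ}

/-- On the open set `U` and for times in `J`, the moving domain `Ω` is the region below the graph
of the `C²` function `h` in the frame `A`. -/
structure IsGraphChart (Ω : ℝ → Set (Space d)) (J : Set ℝ) (U : Set (Space d))
    (A : (Space (d - 1) × ℝ) ≃L[ℝ] Space d) (h : ℝ × Space (d - 1) → ℝ) : Prop where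
  frame : IsOrthogonalFrame A
  contDiff : ContDiff ℝ 2 h
  isOpen : IsOpen U
  mem_iff : ∀ t ∈ J, ∀ x ∈ U, x ∈ Ω t ↔ (A.symm x).2 < h (t, (A.symm x).1)

/-- `J = [a, b]` is a nondegenerate interval which is a neighbourhood of `t₀` in `I`. -/
structure IsTimeInterval (I : Set ℝ) (t₀ a b : ℝ) : Prop where
  lt : a < b
  mem : t₀ ∈ Icc a b
  subset : Icc a b ⊆ I
  mem_nhdsWithin : Icc a b ∈ 𝓝[I] t₀

/-- At `0` and `T` the interval is clipped, yet it keeps positive length. Thus derivatives within it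
are unique and coincide with the one-sided derivatives on `[0, T]`. -/
theorem exists_isTimeInterval {T t₀ : ℝ} (hT : 0 < T) (ht₀ : t₀ ∈ Icc 0 T) {N : Set ℝ}
    (hN : N ∈ 𝓝 t₀) : ∃ a b, IsTimeInterval (Icc 0 T) t₀ a b ∧ Icc a b ⊆ N := by
  obtain ⟨δ, hδ, hδN⟩ := Metric.nhds_basis_closedBall.mem_iff.1 hN
  refine ⟨max 0 (t₀ - δ), min T (t₀ + δ), ⟨?_, ?_, ?_, ?_⟩, fun t ht => hδN ?_⟩
  · rcases ht₀ with ⟨h0, h1⟩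
    rw [max_lt_iff, lt_min_iff, lt_min_iff]
    refine ⟨⟨hT, ?_⟩, ?_, ?_⟩ <;> linarith
  · rcases ht₀ with ⟨h0, h1⟩
    refine ⟨max_le h0 ?_, le_min h1 ?_⟩ <;> linarith
  · exact fun t ht => ⟨(le_max_left _ _).trans ht.1, ht.2.trans (min_le_left _ _)⟩
  · filter_upwards [self_mem_nhdsWithin,
      mem_nhdsWithin_of_mem_nhds (Metric.closedBall_mem_nhds t₀ hδ)] with t htI ht
    rw [Real.closedBall_eq_Icc] at ht
    exact ⟨max_le htI.1 ht.1, le_min htI.2 ht.2⟩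
  · rw [Real.closedBall_eq_Icc]
    exact ⟨(le_max_right _ _).trans ht.1, ht.2.trans (min_le_right _ _)⟩

theorem exists_isGraphChart_of_eventually {T t₀ : ℝ} (hT : 0 < T) (ht₀ : t₀ ∈ Icc 0 T)
    {Ω : ℝ → Set (Space d)} {x₀ : Space d} {A : (Space (d - 1) × ℝ) ≃L[ℝ] Space d}
    (hA : IsOrthogonalFrame A) {h : ℝ × Space (d - 1) → ℝ} (hh : ContDiff ℝ 2 h)
    (hev : ∀ᶠ p in 𝓝 (t₀, x₀), p.1 ∈ Icc 0 T →
      (p.2 ∈ Ω p.1 ↔ (A.symm p.2).2 < h (p.1, (A.symm p.2).1))) :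
    ∃ a b U, IsTimeInterval (Icc 0 T) t₀ a b ∧ x₀ ∈ U ∧ IsGraphChart Ω (Icc a b) U A h := by
  rw [nhds_prod_eq] at hev
  obtain ⟨N, hN, V, hV, hNV⟩ := Filter.eventually_prod_iff.1 hev
  obtain ⟨a, b, hab, habN⟩ := exists_isTimeInterval hT ht₀ hN
  refine ⟨a, b, interior {x | V x}, hab, mem_interior_iff_mem_nhds.2 hV, hA, hh, isOpen_interior,
    fun t ht x hx => hNV (habN ht) (interior_subset hx) (hab.subset ht)⟩

theorem contDiff_smul_of_tsupport {X F : Type*} [NormedAddCommGroup X] [NormedSpace ℝ X]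
    [NormedAddCommGroup F] [NormedSpace ℝ F] {n : WithTop ℕ∞} {η : X → ℝ} {f : X → F}
    (hη : ContDiff ℝ n η) (hf : ∀ x ∈ tsupport η, ContDiffAt ℝ n f x) :
    ContDiff ℝ n fun x => η x • f x := by
  refine contDiff_iff_contDiffAt.2 fun x => ?_
  by_cases hx : x ∈ tsupport η
  · exact hη.contDiffAt.smul (hf x hx)
  · refine contDiffAt_const (c := (0 : F)) |>.congr_of_eventuallyEq ?_
    filter_upwards [notMem_tsupport_iff_eventuallyEq.1 hx] with y hy
    simp [hy]

/-- Solving a scalar equation that increases in the last variable: the zero set is a graph, the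
negative set lies below it, and the graph function can be taken to be globally `C²`. -/
theorem exists_graph_of_fderiv_pos {X : Type*} [NormedAddCommGroup X] [NormedSpace ℝ X]
    [FiniteDimensional ℝ X] {f : X × ℝ → ℝ} {u : X × ℝ} (hf : ContDiffAt ℝ 2 f u) (hfu : f u = 0)
    (hpos : 0 < fderiv ℝ f u (0, 1)) :
    ∃ h : X → ℝ, ContDiff ℝ 2 h ∧ ∀ᶠ v in 𝓝 u, f v < 0 ↔ v.2 < h v.1 := by
  have : CompleteSpace X := FiniteDimensional.complete ℝ X
  have hinv : (fderiv ℝ f u ∘L .inr ℝ X ℝ).IsInvertible := by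
    refine ⟨ContinuousLinearEquiv.unitsEquivAut ℝ (Units.mk0 _ hpos.ne'), ?_⟩
    ext
    simp
  set ψ := hf.implicitFunction two_ne_zero hinv
  have hψu : ψ u.1 = u.2 := hf.implicitFunction_apply_self two_ne_zero hinv
  have hψ : ContDiffAt ℝ 2 ψ u.1 := hf.contDiffAt_implicitFunction two_ne_zero hinv
  have hzero : ∀ᶠ x in 𝓝 u.1, f (x, ψ x) = 0 := by
    simpa only [hfu] using hf.eventually_apply_implicitFunction two_ne_zero hinv
  have hcont : ContinuousAt (fun v => fderiv ℝ f v (0, 1)) u :=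
    (hf.fderiv_right (m := 1) (by norm_num)).continuousAt.clm_apply continuousAt_const
  have hgood : ∀ᶠ v in 𝓝 u, DifferentiableAt ℝ f v ∧ 0 < fderiv ℝ f v (0, 1) := by
    refine ((hf.eventually (by simp)).mono fun v hv => hv.differentiableAt two_ne_zero).and ?_
    exact hcont.eventually (lt_mem_nhds hpos)
  have hgood' := hgood
  rw [← Prod.mk.eta (p := u), nhds_prod_eq] at hgood'
  obtain ⟨N, hN, V, hV, hNV⟩ := Filter.eventually_prod_iff.1 hgood'
  obtain ⟨ε, hε, hεV⟩ := Metric.eventually_nhds_iff_ball.1 hV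
  have hball : ∀ᶠ x in 𝓝 u.1, ψ x ∈ Metric.ball u.2 ε :=
    hψ.continuousAt.eventually (by rw [hψu]; exact Metric.ball_mem_nhds _ hε)
  have hsign : ∀ᶠ v in 𝓝 u, f v < 0 ↔ v.2 < ψ v.1 := by
    have h1 : ∀ᶠ v : X × ℝ in 𝓝 u, N v.1 ∧ ψ v.1 ∈ Metric.ball u.2 ε ∧ f (v.1, ψ v.1) = 0 :=
      continuous_fst.continuousAt.eventually (hN.and (hball.and hzero))
    have h2 : ∀ᶠ v : X × ℝ in 𝓝 u, v.2 ∈ Metric.ball u.2 ε :=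
      continuous_snd.continuousAt.eventually (Metric.ball_mem_nhds _ hε)
    filter_upwards [h1, h2] with v hv1 hv2
    have hder : ∀ r ∈ Metric.ball u.2 ε,
        HasDerivAt (fun r => f (v.1, r)) (fderiv ℝ f (v.1, r) (0, 1)) r := fun r hr =>
      (hNV hv1.1 (hεV r hr)).1.hasFDerivAt.comp_hasDerivAt r
        ((hasDerivAt_const _ _).prodMk (hasDerivAt_id r))
    -- On the vertical segment through `v`, `f` increases and vanishes at height `ψ v.1`, so its
    -- sign at `v` tells whether `v` lies below the graph.
    have hmono : StrictMonoOn (fun r => f (v.1, r)) (Metric.ball u.2 ε) := by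
      refine strictMonoOn_of_deriv_pos (convex_ball _ _)
        (fun r hr => (hder r hr).continuousAt.continuousWithinAt) fun r hr => ?_
      rw [Metric.isOpen_ball.interior_eq] at hr
      rw [(hder r hr).deriv]
      exact (hNV hv1.1 (hεV r hr)).2
    have := hmono.lt_iff_lt hv2 hv1.2.1
    simp only [hv1.2.2, Prod.mk.eta] at this
    exact this
  obtain ⟨δ, hδ, hδψ⟩ := Metric.eventually_nhds_iff_ball.1 (hψ.eventually (by simp))
  -- The implicit function is only known to be `C²` near `u.1`. The cutoff makes it globally `C²`
  -- without changing it close to `u.1`.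
  let η : ContDiffBump u.1 := ⟨δ / 4, δ / 2, by positivity, by linarith⟩
  refine ⟨fun x => η x • ψ x, contDiff_smul_of_tsupport η.contDiff fun x hx => hδψ x ?_, ?_⟩
  · rw [η.tsupport_eq] at hx
    exact Metric.closedBall_subset_ball (by change δ / 2 < δ; linarith) hx
  · filter_upwards [hsign,
      continuous_fst.continuousAt.eventually (η.eventuallyEq_one)] with v hv hv1
    simp only [hv, hv1, Pi.one_apply, one_smul]

/-- At a boundary point, take the vertical axis along the spatial gradient of the defining function:
its vertical derivative is then `‖∇ρ‖ > 0` and the implicit function theorem applies. Interior and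
exterior points get charts of the same kind, so later arguments need no case distinction. -/
theorem exists_isGraphChart {T t₀ : ℝ} (hT : 0 < T) (hd : 1 ≤ d) (ht₀ : t₀ ∈ Icc 0 T)
    {Ω : ℝ → Set (Space d)} (hΩ : IsMovingDomain (Icc 0 T) Ω) (x₀ : Space d) :
    ∃ (A : (Space (d - 1) × ℝ) ≃L[ℝ] Space d) (h : ℝ × Space (d - 1) → ℝ) (a b : ℝ)
      (U : Set (Space d)), IsTimeInterval (Icc 0 T) t₀ a b ∧ x₀ ∈ U ∧
        IsGraphChart Ω (Icc a b) U A h := by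
  obtain ⟨ρ, hρ, hρΩ, hgrad⟩ := hΩ.exists_definingFunction t₀ ht₀ x₀
  by_cases h0 : ρ (t₀, x₀) = 0
  · set g := gradient (fun x => ρ (t₀, x)) x₀
    have hg : g ≠ 0 := hgrad h0
    obtain ⟨A, hA, hAe⟩ := exists_isOrthogonalFrame (‖g‖⁻¹ • g) (by
      rw [norm_smul, norm_inv, norm_norm, inv_mul_cancel₀ (norm_ne_zero_iff.2 hg)])
    let Θ : (ℝ × Space (d - 1)) × ℝ → ℝ × Space d := fun v => (v.1.1, A (v.1.2, v.2))
    set u : (ℝ × Space (d - 1)) × ℝ := ((t₀, (A.symm x₀).1), (A.symm x₀).2)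
    have hΘu : Θ u = (t₀, x₀) := by simp [Θ, u]
    have hΘ : ContDiff ℝ 2 Θ := by fun_prop
    have hρ' : ContDiffAt ℝ 2 ρ (Θ u) := by rwa [hΘu]
    have hf : ContDiffAt ℝ 2 (ρ ∘ Θ) u := hρ'.comp u hΘ.contDiffAt
    have hDΘ : HasFDerivAt Θ ((ContinuousLinearMap.fst ℝ ℝ (Space (d - 1)) ∘L
        ContinuousLinearMap.fst ℝ _ ℝ).prod ((A : (Space (d - 1) × ℝ) →L[ℝ] Space d) ∘L
        ((ContinuousLinearMap.snd ℝ ℝ (Space (d - 1)) ∘L ContinuousLinearMap.fst ℝ _ ℝ).prod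
        (ContinuousLinearMap.snd ℝ _ ℝ)))) u :=
      (hasFDerivAt_fst.comp u hasFDerivAt_fst).prodMk (A.toContinuousLinearMap.hasFDerivAt.comp u
        ((hasFDerivAt_snd.comp u hasFDerivAt_fst).prodMk hasFDerivAt_snd))
    have hderiv : fderiv ℝ (ρ ∘ Θ) u (0, 1) = ‖g‖ := by
      rw [((hρ'.differentiableAt two_ne_zero).hasFDerivAt.comp u hDΘ).fderiv, hΘu]
      have hslice : HasFDerivAt (fun x => ρ (t₀, x))
          ((fderiv ℝ ρ (t₀, x₀)) ∘L .inr ℝ ℝ (Space d)) x₀ :=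
        (hρ.differentiableAt two_ne_zero).hasFDerivAt.comp x₀ (hasFDerivAt_prodMk_right t₀ x₀)
      have h1 : fderiv ℝ ρ (t₀, x₀) (0, A (0, 1)) = ⟪g, A (0, 1)⟫ := by
        have h2 := hslice.differentiableAt.hasGradientAt.hasFDerivAt.unique hslice
        have h3 := congrArg (fun l => l (A (0, 1))) h2
        simpa [g] using h3.symm
      have h4 : ⟪g, A (0, 1)⟫ = ‖g‖ := by
        rw [hAe, inner_smul_right, real_inner_self_eq_norm_sq]
        field_simp
      simpa [← h4] using h1
    obtain ⟨h, hh, hev⟩ := exists_graph_of_fderiv_pos hf (by simp [hΘu, h0])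
      (by rw [hderiv]; exact norm_pos_iff.2 hg)
    have hcont : ContinuousAt (fun p : ℝ × Space d => ((p.1, (A.symm p.2).1), (A.symm p.2).2))
        (t₀, x₀) := by fun_prop
    obtain ⟨a, b, U, hab, hxU, hch⟩ := exists_isGraphChart_of_eventually (Ω := Ω) hT ht₀ hA hh (by
      filter_upwards [hρΩ, hcont.eventually hev] with p hp1 hp2 hp3
      rw [hp1 hp3, ← hp2]
      simp [Θ])
    exact ⟨A, h, a, b, U, hab, hxU, hch⟩
  -- Away from the boundary any frame will do. A constant graph placed one unit above or below `x₀`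
  -- leaves all nearby points inside or outside, respectively.
  · have : Nonempty (Fin d) := ⟨⟨0, hd⟩⟩
    obtain ⟨A, hA, -⟩ := exists_isOrthogonalFrame
      (EuclideanSpace.single (Classical.arbitrary (Fin d)) (1 : ℝ)) (by simp)
    have hcont2 : ContinuousAt (fun p : ℝ × Space d => (A.symm p.2).2) (t₀, x₀) := by fun_prop
    rcases lt_or_gt_of_ne h0 with hneg | hpos
    · obtain ⟨a, b, U, hab, hxU, hch⟩ := exists_isGraphChart_of_eventually (Ω := Ω) hT ht₀ hA
        (h := fun _ => (A.symm x₀).2 + 1) contDiff_const (by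
          filter_upwards [hρΩ, hρ.continuousAt.eventually (gt_mem_nhds hneg),
            hcont2.eventually (gt_mem_nhds (lt_add_one _))] with p hp1 hp2 hp3 hp4
          simp only [hp1 hp4, hp2, true_iff]
          exact hp3)
      exact ⟨A, _, a, b, U, hab, hxU, hch⟩
    · obtain ⟨a, b, U, hab, hxU, hch⟩ := exists_isGraphChart_of_eventually (Ω := Ω) hT ht₀ hA
        (h := fun _ => (A.symm x₀).2 - 1) contDiff_const (by
          filter_upwards [hρΩ, hρ.continuousAt.eventually (lt_mem_nhds hpos),
            hcont2.eventually (lt_mem_nhds (sub_one_lt _))] with p hp1 hp2 hp3 hp4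
          rw [hp1 hp4]
          exact ⟨fun h => absurd h hp2.not_gt, fun h => absurd h hp3.not_gt⟩)
      exact ⟨A, _, a, b, U, hab, hxU, hch⟩

end ChartExistence

/-! ### Flattening in spacetime -/

section Spacetime

variable {Y E : Type*} [NormedAddCommGroup Y] [InnerProductSpace ℝ Y] [NormedAddCommGroup E]
  [InnerProductSpace ℝ E]

theorem closure_lt_graph (A : (Y × ℝ) ≃L[ℝ] E) {h : Y → ℝ} (hh : Continuous h) :
    closure {x | (A.symm x).2 < h (A.symm x).1} = subgraph A h := by
  let e : E ≃ₜ Y × ℝ := ⟨⟨unshear A h, shear A h, shear_unshear A h, unshear_shear A h⟩,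
    continuous_unshear A hh, continuous_shear A hh⟩
  have h1 : {x | (A.symm x).2 < h (A.symm x).1} = e ⁻¹' (univ ×ˢ Iio 0) := by
    ext x; simp [e, unshear]
  have h2 : subgraph A h = e ⁻¹' (univ ×ˢ Iic 0) := by
    ext x; simp [e, unshear, subgraph]
  rw [h1, h2, ← e.preimage_closure, closure_prod_eq, closure_univ, closure_Iio]

/-- The spacetime region below a moving graph. -/
def stSubgraph (J : Set ℝ) (A : (Y × ℝ) ≃L[ℝ] E) (h : ℝ × Y → ℝ) : Set (ℝ × E) :=
  {p | p.1 ∈ J ∧ p.2 ∈ subgraph A (fun y => h (p.1, y))}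

/-- The shear in spacetime that flattens a moving graph. -/
def stShear (A : (Y × ℝ) ≃L[ℝ] E) (h : ℝ × Y → ℝ) (p : ℝ × (Y × ℝ)) : ℝ × E :=
  (p.1, shear A (fun y => h (p.1, y)) p.2)

theorem stShear_mem_stSubgraph_iff (J : Set ℝ) (A : (Y × ℝ) ≃L[ℝ] E) (h : ℝ × Y → ℝ)
    (p : ℝ × (Y × ℝ)) : stShear A h p ∈ stSubgraph J A h ↔ p ∈ J ×ˢ lowerHalf Y :=
  and_congr_right fun _ => shear_mem_subgraph_iff A _ _

theorem contDiff_stShear (A : (Y × ℝ) ≃L[ℝ] E) {h : ℝ × Y → ℝ} {n : WithTop ℕ∞}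
    (hh : ContDiff ℝ n h) : ContDiff ℝ n (stShear A h) := by
  unfold stShear shear; fun_prop

theorem hasFDerivAt_stShear (A : (Y × ℝ) ≃L[ℝ] E) {h : ℝ × Y → ℝ} (hh : ContDiff ℝ 1 h)
    (p : ℝ × (Y × ℝ)) : ∃ D : ℝ × (Y × ℝ) →L[ℝ] ℝ × E, HasFDerivAt (stShear A h) D p ∧
      ∀ τ v r, D (τ, v, r) = (τ, A (v, r + fderiv ℝ h (p.1, p.2.1) (τ, v))) := by
  have h1 : HasFDerivAt (fun p : ℝ × (Y × ℝ) => p.2.1) (ContinuousLinearMap.fst ℝ Y ℝ ∘L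
    ContinuousLinearMap.snd ℝ ℝ (Y × ℝ)) p := hasFDerivAt_fst.comp p hasFDerivAt_snd
  have h2 : HasFDerivAt (fun p : ℝ × (Y × ℝ) => p.2.2) (ContinuousLinearMap.snd ℝ Y ℝ ∘L
    ContinuousLinearMap.snd ℝ ℝ (Y × ℝ)) p := hasFDerivAt_snd.comp p hasFDerivAt_snd
  refine ⟨_, hasFDerivAt_fst.prodMk (A.toContinuousLinearMap.hasFDerivAt.comp p
    (h1.prodMk (h2.add ((hh.differentiable one_ne_zero
      (p.1, p.2.1)).hasFDerivAt.comp p (hasFDerivAt_fst.prodMk h1))))), fun τ v r => rfl⟩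

theorem uniqueDiffOn_stSubgraph {J : Set ℝ} (hJ : UniqueDiffOn ℝ J) (A : (Y × ℝ) ≃L[ℝ] E)
    {h : ℝ × Y → ℝ} (hh : ContDiff ℝ 1 h) : UniqueDiffOn ℝ (stSubgraph J A h) := by
  have himg : stSubgraph J A h = stShear A h '' (J ×ˢ lowerHalf Y) := by
    ext ⟨t, x⟩
    constructor
    · intro hx
      have hx' : stShear A h (t, unshear A (fun y => h (t, y)) x) = (t, x) := by
        simp [stShear, shear_unshear]
      refine ⟨_, ?_, hx'⟩
      rwa [← stShear_mem_stSubgraph_iff J A h, hx']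
    · rintro ⟨p, hp, hpx⟩
      rw [← hpx]
      exact (stShear_mem_stSubgraph_iff J A h p).2 hp
  choose D hD hDv using fun p => hasFDerivAt_stShear A hh p
  rw [himg]
  refine (hJ.prod uniqueDiffOn_lowerHalf).image (fun p _ => (hD p).hasFDerivWithinAt)
    fun p _ => Function.Surjective.denseRange fun q => ?_
  refine ⟨(q.1, (A.symm q.2).1, (A.symm q.2).2 -
    fderiv ℝ h (p.1, p.2.1) (q.1, (A.symm q.2).1)), ?_⟩
  rw [hDv]
  simp

theorem contDiff_slice {h : ℝ × Y → ℝ} {n : WithTop ℕ∞} (hh : ContDiff ℝ n h) (t : ℝ) :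
    ContDiff ℝ n fun y => h (t, y) := by fun_prop

theorem fderiv_slice {h : ℝ × Y → ℝ} (hh : ContDiff ℝ 1 h) (t : ℝ) (y : Y) :
    fderiv ℝ (fun y => h (t, y)) y = (fderiv ℝ h (t, y)) ∘L .inr ℝ ℝ Y :=
  ((hh.differentiable one_ne_zero (t, y)).hasFDerivAt.comp y (hasFDerivAt_prodMk_right t y)).fderiv

end Spacetime

/-! ### Closure, boundary, normal and tangency in a chart -/

section Chart

variable {d : ℕ} {Ω : ℝ → Set (Space d)} {J : Set ℝ} {U : Set (Space d)}
  {A : (Space (d - 1) × ℝ) ≃L[ℝ] Space d} {h : ℝ × Space (d - 1) → ℝ}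

namespace IsGraphChart

variable (H : IsGraphChart Ω J U A h)

include H

theorem contDiff_one : ContDiff ℝ 1 h := H.contDiff.of_le (by norm_num)

/-- Closure is local on the open set `U`, so it can be computed for the strict subgraph that agrees
with the domain there. -/
theorem mem_closure_iff {t : ℝ} (ht : t ∈ J) {x : Space d} (hx : x ∈ U) :
    x ∈ closure (Ω t) ↔ (A.symm x).2 ≤ h (t, (A.symm x).1) := by
  have hh := (contDiff_slice H.contDiff t).continuous
  have hset : U ∩ Ω t = U ∩ {x | (A.symm x).2 < h (t, (A.symm x).1)} := by
    ext z; exact and_congr_right fun hz => H.mem_iff t ht z hz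
  have key : ∀ s : Set (Space d), x ∈ closure s ↔ x ∈ closure (U ∩ s) := fun s =>
    ⟨fun h => H.isOpen.inter_closure ⟨hx, h⟩, fun h => closure_mono inter_subset_right h⟩
  rw [key, hset, ← key, closure_lt_graph A hh]
  rfl

theorem mem_interior_iff {t : ℝ} (ht : t ∈ J) {x : Space d} (hx : x ∈ U) :
    x ∈ interior (Ω t) ↔ (A.symm x).2 < h (t, (A.symm x).1) := by
  have hh := (contDiff_slice H.contDiff t).continuous
  refine ⟨fun h => (H.mem_iff t ht x hx).1 (interior_subset h), fun hlt => ?_⟩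
  have hop : IsOpen {x | (A.symm x).2 < h (t, (A.symm x).1)} :=
    isOpen_lt (by fun_prop) (hh.comp (by fun_prop : Continuous fun x => (A.symm x).1))
  refine mem_interior.2 ⟨U ∩ {x | (A.symm x).2 < h (t, (A.symm x).1)},
    fun z hz => (H.mem_iff t ht z hz.1).2 hz.2, H.isOpen.inter hop, hx, hlt⟩

theorem mem_frontier_iff {t : ℝ} (ht : t ∈ J) {x : Space d} (hx : x ∈ U) :
    x ∈ frontier (Ω t) ↔ (A.symm x).2 = h (t, (A.symm x).1) := by
  rw [frontier, Set.mem_sdiff, H.mem_closure_iff ht hx, H.mem_interior_iff ht hx, not_lt]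
  exact ⟨fun h => le_antisymm h.1 h.2, fun h => ⟨h.le, h.ge⟩⟩

theorem closure_eventuallyEq {t : ℝ} (ht : t ∈ J) {x : Space d} (hx : x ∈ U) :
    (closure (Ω t) : Set (Space d)) =ᶠ[𝓝 x] subgraph A (fun y => h (t, y)) := by
  filter_upwards [H.isOpen.mem_nhds hx] with z hz
  exact propext (H.mem_closure_iff ht hz)

theorem graphMap_mem_frontier_iff {t : ℝ} (ht : t ∈ J) {y : Space (d - 1)}
    (hy : graphMap A (fun y => h (t, y)) y ∈ U) :
    graphMap A (fun y => h (t, y)) y ∈ frontier (Ω t) := by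
  rw [H.mem_frontier_iff ht hy]
  simp [graphMap]

theorem eq_graphMap {t : ℝ} (ht : t ∈ J) {x : Space d} (hx : x ∈ U) (hxf : x ∈ frontier (Ω t)) :
    graphMap A (fun y => h (t, y)) (A.symm x).1 = x := by
  rw [H.mem_frontier_iff ht hx] at hxf
  simp [graphMap, ← hxf]

end IsGraphChart

/-- Derivatives within a set depend only on its germ, so this equality replaces the region by a set
that the shear flattens. -/
theorem region_eventuallyEq {I : Set ℝ} {t₀ a b : ℝ} (hab : IsTimeInterval I t₀ a b)
    (H : IsGraphChart Ω (Icc a b) U A h) {x : Space d} (hx : x ∈ U) :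
    region I Ω =ᶠ[𝓝 (t₀, x)] stSubgraph (Icc a b) A h := by
  obtain ⟨N, hN, hNI⟩ := mem_nhdsWithin_iff_exists_mem_nhds_inter.1 hab.mem_nhdsWithin
  filter_upwards [prod_mem_nhds hN (H.isOpen.mem_nhds hx)] with p hp
  refine propext ⟨fun hpr => ?_, fun hpr => ?_⟩
  · have ht := hNI ⟨hp.1, hpr.1⟩
    exact ⟨ht, (H.mem_closure_iff ht hp.2).1 hpr.2⟩
  · exact ⟨hab.subset hpr.1, (H.mem_closure_iff hpr.1 hp.2).2 hpr.2⟩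

/-- A direction `v` with `⟪n₁, v⟫ < 0` enters the domain to first order, hence cannot have `⟪n₂, v⟫
> 0`. Such an inclusion of half-spaces forces the unit normals to agree. Uniqueness lets the chosen
`outerNormal` be computed from any defining function. -/
theorem IsOuterUnitNormal.unique {U : Set (Space d)} {x n₁ n₂ : Space d}
    (h₁ : IsOuterUnitNormal U x n₁) (h₂ : IsOuterUnitNormal U x n₂) : n₁ = n₂ := by
  obtain ⟨hn₁, ρ₁, hρ₁, hx₁, hU₁, c₁, hc₁, hg₁⟩ := h₁
  obtain ⟨hn₂, ρ₂, hρ₂, hx₂, hU₂, c₂, hc₂, hg₂⟩ := h₂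
  have hline : ∀ (ρ : Space d → ℝ) (c : ℝ) (n : Space d), ContDiffAt ℝ 1 ρ x →
      gradient ρ x = c • n → ∀ v : Space d,
      HasDerivAt (fun s : ℝ => ρ (x + s • v)) (c * ⟪n, v⟫) 0 := fun ρ c n hρ hg v => by
    have h1 : HasDerivAt (fun s : ℝ => x + s • v) v 0 := by
      simpa using ((hasDerivAt_id (0 : ℝ)).smul_const v).const_add x
    have h2 := (hρ.differentiableAt one_ne_zero).hasGradientAt.hasFDerivAt
    rw [hg] at h2
    have h3 : HasFDerivAt ρ ((InnerProductSpace.toDual ℝ (Space d)) (c • n))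
        ((fun s : ℝ => x + s • v) 0) := by simpa using h2
    have := h3.comp_hasDerivAt (0 : ℝ) h1
    convert! this using 1
    simp
  have key : ∀ v, ⟪n₁, v⟫ < 0 → ⟪n₂, v⟫ ≤ 0 := by
    intro v hv
    by_contra! hpos
    have h1 := hline ρ₁ c₁ n₁ hρ₁ hg₁ v
    have h2 := hline ρ₂ c₂ n₂ hρ₂ hg₂ v
    have hcont : Tendsto (fun s : ℝ => x + s • v) (𝓝[>] 0) (𝓝 x) := by
      have : Continuous fun s : ℝ => x + s • v := by fun_prop
      simpa using (this.tendsto 0).mono_left (nhdsWithin_le_nhds (s := Ioi 0))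
    have e1 : ∀ᶠ s in 𝓝[>] (0 : ℝ), ρ₁ (x + s • v) < 0 := by
      have := (hasDerivWithinAt_iff_tendsto_slope' (s := Ioi (0 : ℝ)) (by simp)).1
        h1.hasDerivWithinAt
      filter_upwards [this.eventually (gt_mem_nhds (mul_neg_of_pos_of_neg hc₁ hv)),
        self_mem_nhdsWithin] with s hs hs0
      simp only [slope, zero_smul, add_zero, hx₁, sub_zero, vsub_eq_sub, smul_eq_mul] at hs
      have hs0' : (0 : ℝ) < s := hs0
      by_contra! hcon
      exact absurd hs (not_lt.2 (by positivity))
    have e2 : ∀ᶠ s in 𝓝[>] (0 : ℝ), 0 < ρ₂ (x + s • v) := by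
      have := (hasDerivWithinAt_iff_tendsto_slope' (s := Ioi (0 : ℝ)) (by simp)).1
        h2.hasDerivWithinAt
      filter_upwards [this.eventually (lt_mem_nhds (mul_pos hc₂ hpos)),
        self_mem_nhdsWithin] with s hs hs0
      simp only [slope, zero_smul, add_zero, hx₂, sub_zero, vsub_eq_sub, smul_eq_mul] at hs
      have hs0' : (0 : ℝ) < s := hs0
      exact (pos_iff_pos_of_mul_pos hs).1 (inv_pos.2 hs0')
    obtain ⟨s, hs1, hs2, hs3, hs4⟩ := (e1.and (e2.and ((hcont.eventually hU₁).and
      (hcont.eventually hU₂)))).exists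
    exact absurd (hs4.1 (hs3.2 hs1)) hs2.not_gt
  have hs0 : 0 ≤ ⟪n₁, n₂⟫ := by
    have := key (-n₁) (by rw [inner_neg_right, real_inner_self_eq_norm_sq, hn₁]; norm_num)
    rw [inner_neg_right, real_inner_comm] at this
    linarith
  have hs1 : ⟪n₁, n₂⟫ ≤ 1 := by simpa [hn₁, hn₂] using real_inner_le_norm n₁ n₂
  refine (inner_eq_one_iff_of_norm_eq_one hn₁ hn₂).1 (le_antisymm hs1 ?_)
  by_contra! hlt
  set s := ⟪n₁, n₂⟫
  -- If `s = ⟪n₁, n₂⟫ < 1`, this vector pairs with `n₁` to `-(1 - s²)/2 < 0` and with `n₂` to `(1 -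
  -- s²)(1 - s/2) > 0`, contradicting `key`.
  have := key (n₂ - (s + (1 - s ^ 2) / 2) • n₁) (by
    rw [inner_sub_right, inner_smul_right, real_inner_self_eq_norm_sq, hn₁]
    change s - _ < 0
    nlinarith)
  rw [inner_sub_right, inner_smul_right, real_inner_self_eq_norm_sq, hn₂, real_inner_comm] at this
  change 1 ^ 2 - (s + (1 - s ^ 2) / 2) * s ≤ 0 at this
  nlinarith [mul_pos (sub_pos.2 hlt) (sub_pos.2 hlt)]

theorem outerNormal_eq {U : Set (Space d)} {x n : Space d} (h : IsOuterUnitNormal U x n) :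
    outerNormal U x = n :=
  (Classical.epsilon_spec (p := IsOuterUnitNormal U x) ⟨n, h⟩).unique h

/-- The conormal `(-∇h, 1)` of the graph of `h`. -/
def conormal (A : (Space (d - 1) × ℝ) ≃L[ℝ] Space d) (h : Space (d - 1) → ℝ)
    (y : Space (d - 1)) : Space d := A (-gradient h y, 1)

theorem inner_conormal {A : (Space (d - 1) × ℝ) ≃L[ℝ] Space d} (hA : IsOrthogonalFrame A)
    {h : Space (d - 1) → ℝ} {y : Space (d - 1)} (w : Space d) :
    ⟪w, conormal A h y⟫ = (A.symm w).2 - fderiv ℝ h y (A.symm w).1 := by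
  obtain ⟨p, rfl⟩ := A.surjective w
  rw [conormal, hA, A.symm_apply_apply, inner_neg_right, gradient,
    real_inner_comm, InnerProductSpace.toDual_symm_apply]
  ring

theorem norm_conormal {A : (Space (d - 1) × ℝ) ≃L[ℝ] Space d} (hA : IsOrthogonalFrame A)
    (h : Space (d - 1) → ℝ) (y : Space (d - 1)) : ‖conormal A h y‖ = graphDensity h y := by
  rw [graphDensity, ← Real.sqrt_sq (norm_nonneg (conormal A h y)), conormal, hA.norm_sq]
  simp [gradient, add_comm]

theorem graphDensity_pos (h : Space (d - 1) → ℝ) (y : Space (d - 1)) : 0 < graphDensity h y :=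
  Real.sqrt_pos.2 (by positivity)

/-- The vertical coordinate minus `h` defines the domain locally, and its gradient is the conormal,
of length equal to the surface density. -/
theorem IsGraphChart.outerNormal_eq (H : IsGraphChart Ω J U A h) {t : ℝ} (ht : t ∈ J)
    {x : Space d} (hx : x ∈ U) (hxf : x ∈ frontier (Ω t)) :
    outerNormal (Ω t) x = (graphDensity (fun y => h (t, y)) (A.symm x).1)⁻¹ •
      conormal A (fun y => h (t, y)) (A.symm x).1 := by
  have hpos := graphDensity_pos (d := d) (fun y => h (t, y)) (A.symm x).1
  have hslice := contDiff_slice H.contDiff_one t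
  refine FreeBoundaryMHD.outerNormal_eq ⟨?_, fun x => (A.symm x).2 - h (t, (A.symm x).1), ?_, ?_,
    ?_, graphDensity (fun y => h (t, y)) (A.symm x).1, hpos, ?_⟩
  · rw [norm_smul, norm_conormal H.frame, norm_inv, Real.norm_of_nonneg hpos.le,
      inv_mul_cancel₀ hpos.ne']
  · have := H.contDiff_one
    exact ContDiff.contDiffAt (by fun_prop)
  · exact sub_eq_zero.2 ((H.mem_frontier_iff ht hx).1 hxf)
  · filter_upwards [H.isOpen.mem_nhds hx] with z hz
    rw [H.mem_iff t ht z hz, sub_neg]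
  · rw [smul_inv_smul₀ hpos.ne']
    have h1 : HasFDerivAt (fun x : Space d => (A.symm x).2 - h (t, (A.symm x).1))
        (ContinuousLinearMap.snd ℝ _ ℝ ∘L (A.symm : Space d →L[ℝ] Space (d - 1) × ℝ) -
          fderiv ℝ (fun y => h (t, y)) (A.symm x).1 ∘L ContinuousLinearMap.fst ℝ _ ℝ ∘L
          (A.symm : Space d →L[ℝ] Space (d - 1) × ℝ)) x :=
      (hasFDerivAt_snd.comp x A.symm.toContinuousLinearMap.hasFDerivAt).sub
        (((hslice.differentiable one_ne_zero _).hasFDerivAt).comp x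
          (hasFDerivAt_fst.comp x A.symm.toContinuousLinearMap.hasFDerivAt))
    refine ext_inner_left ℝ fun w => ?_
    rw [inner_conormal H.frame, real_inner_comm, gradient, InnerProductSpace.toDual_symm_apply,
      h1.fderiv]
    rfl

/-- Tangency of `∂_t + V · ∇` to the moving graph. -/
theorem IsGraphChart.snd_eq_of_isTangent {I : Set ℝ} {t₀ a b : ℝ} (hab : IsTimeInterval I t₀ a b)
    (H : IsGraphChart Ω (Icc a b) U A h) {V : ℝ → Space d → Space d} (hV : IsTangent I Ω V)
    {x : Space d} (hx : x ∈ U) (hxf : x ∈ frontier (Ω t₀)) :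
    (A.symm (V t₀ x)).2 = fderiv ℝ h (t₀, (A.symm x).1) (1, (A.symm (V t₀ x)).1) := by
  have hmem : (t₀, x) ∈ freeSurface I Ω := ⟨hab.subset hab.mem, hxf⟩
  have h1 : HasFDerivAt (fun p : ℝ × Space d => (A.symm p.2).1)
    (ContinuousLinearMap.fst ℝ _ ℝ ∘L (A.symm : Space d →L[ℝ] Space (d - 1) × ℝ) ∘L
      ContinuousLinearMap.snd ℝ ℝ (Space d)) (t₀, x) :=
    hasFDerivAt_fst.comp (t₀, x) (A.symm.toContinuousLinearMap.hasFDerivAt.comp (t₀, x)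
      hasFDerivAt_snd)
  have h2 : HasFDerivAt (fun p : ℝ × Space d => (A.symm p.2).2)
    (ContinuousLinearMap.snd ℝ _ ℝ ∘L (A.symm : Space d →L[ℝ] Space (d - 1) × ℝ) ∘L
      ContinuousLinearMap.snd ℝ ℝ (Space d)) (t₀, x) :=
    hasFDerivAt_snd.comp (t₀, x) (A.symm.toContinuousLinearMap.hasFDerivAt.comp (t₀, x)
      hasFDerivAt_snd)
  have h3 := h2.sub (((H.contDiff_one.differentiable one_ne_zero
    (t₀, (A.symm x).1)).hasFDerivAt).comp (t₀, x) (hasFDerivAt_fst.prodMk h1))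
  -- The function defining the graph vanishes on the free surface, so `0` is one of its derivatives
  -- within the surface. All such derivatives agree on tangent vectors, and the full derivative
  -- applied to `(1, V)` gives the asserted equation.
  have hzero : (fun p : ℝ × Space d => (A.symm p.2).2 - h (p.1, (A.symm p.2).1))
      =ᶠ[𝓝[freeSurface I Ω] (t₀, x)] fun _ => 0 := by
    obtain ⟨N, hN, hNI⟩ := mem_nhdsWithin_iff_exists_mem_nhds_inter.1 hab.mem_nhdsWithin
    filter_upwards [self_mem_nhdsWithin, mem_nhdsWithin_of_mem_nhds
      (prod_mem_nhds hN (H.isOpen.mem_nhds hx))] with p hp hpN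
    rw [(H.mem_frontier_iff (hNI ⟨hpN.1, hp.1⟩) hpN.2).1 hp.2, sub_self]
  have h4 : HasFDerivWithinAt (fun p : ℝ × Space d => (A.symm p.2).2 - h (p.1, (A.symm p.2).1))
      (0 : ℝ × Space d →L[ℝ] ℝ) (freeSurface I Ω) (t₀, x) :=
    (hasFDerivWithinAt_const (0 : ℝ) _ _).congr_of_eventuallyEq hzero
      (hzero.self_of_nhdsWithin hmem)
  have h5 := h3.hasFDerivWithinAt.unique_on h4 (hV _ hmem)
  exact sub_eq_zero.1 h5

end Chart

end FreeBoundaryMHD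

namespace FreeBoundaryMHD

open scoped Manifold ContDiff

/-! ### Calculus on the closed moving domain -/

section Region

variable {d : ℕ} {T : ℝ} {Ω : ℝ → Set (Space d)} {F : Type*} [NormedAddCommGroup F]
  [NormedSpace ℝ F]

/-- Unique differentiability holds for subgraphs over nondegenerate time intervals and depends only
on the germ of the set. It gives meaning to derivatives up to the boundary and at the endpoint
times. -/
theorem IsMovingDomain.uniqueDiffOn_region (hΩ : IsMovingDomain (Icc 0 T) Ω) (hT : 0 < T)
    (hd : 1 ≤ d) : UniqueDiffOn ℝ (region (Icc 0 T) Ω) := by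
  rintro ⟨t, x⟩ hp
  obtain ⟨A, h, a, b, U, hab, hx, H⟩ := exists_isGraphChart hT hd hp.1 hΩ x
  have heq := region_eventuallyEq hab H hx
  rw [uniqueDiffWithinAt_congr (nhdsWithin_eq_iff_eventuallyEq.2 heq)]
  exact uniqueDiffOn_stSubgraph (uniqueDiffOn_Icc hab.lt) A H.contDiff_one _
    (heq.mem_iff.self_of_nhds.1 hp)

theorem IsMovingDomain.uniqueDiffOn_closure (hΩ : IsMovingDomain (Icc 0 T) Ω) (hT : 0 < T)
    (hd : 1 ≤ d) {t : ℝ} (ht : t ∈ Icc 0 T) : UniqueDiffOn ℝ (closure (Ω t)) := by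
  intro x hx
  obtain ⟨A, h, a, b, U, hab, hxU, H⟩ := exists_isGraphChart hT hd ht hΩ x
  have heq := H.closure_eventuallyEq hab.mem hxU
  rw [uniqueDiffWithinAt_congr (nhdsWithin_eq_iff_eventuallyEq.2 heq)]
  exact uniqueDiffOn_subgraph A (contDiff_slice H.contDiff_one t) _ (heq.mem_iff.self_of_nhds.1 hx)

theorem IsMovingDomain.isOpen (hΩ : IsMovingDomain (Icc 0 T) Ω) (hT : 0 < T)
    (hd : 1 ≤ d) {t : ℝ} (ht : t ∈ Icc 0 T) : IsOpen (Ω t) := by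
  refine isOpen_iff_mem_nhds.2 fun x hx => ?_
  obtain ⟨A, h, a, b, U, hab, hxU, H⟩ := exists_isGraphChart hT hd ht hΩ x
  exact mem_interior_iff_mem_nhds.1
    ((H.mem_interior_iff hab.mem hxU).2 ((H.mem_iff t hab.mem x hxU).1 hx))

theorem IsMovingDomain.isCompact_closure (hΩ : IsMovingDomain (Icc 0 T) Ω) {t : ℝ}
    (ht : t ∈ Icc 0 T) : IsCompact (closure (Ω t)) := by
  obtain ⟨R, hR⟩ := hΩ.bounded
  exact (Metric.isBounded_ball.subset (hR t ht)).isCompact_closure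

theorem IsMovingDomain.isCompact_frontier (hΩ : IsMovingDomain (Icc 0 T) Ω) {t : ℝ}
    (ht : t ∈ Icc 0 T) : IsCompact (frontier (Ω t)) :=
  (hΩ.isCompact_closure ht).of_isClosed_subset isClosed_frontier frontier_subset_closure

theorem freeSurface_subset_region (I : Set ℝ) (Ω : ℝ → Set (Space d)) :
    freeSurface I Ω ⊆ region I Ω :=
  fun _ hp => ⟨hp.1, frontier_subset_closure hp.2⟩

theorem integrableOn_of_continuousOn_closure {F : Type*} [NormedAddCommGroup F]
    (hΩ : IsMovingDomain (Icc 0 T) Ω) {t : ℝ}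
    (ht : t ∈ Icc 0 T) {f : Space d → F} (hf : ContinuousOn f (closure (Ω t))) :
    IntegrableOn f (Ω t) :=
  (hf.integrableOn_compact (hΩ.isCompact_closure ht)).mono_set subset_closure

/-- Decomposition of a field on a moving domain by a partition of unity. -/
theorem IsMovingDomain.induction_on_cutoff (hΩ : IsMovingDomain (Icc 0 T) Ω)
    {p : (ℝ → Space d → F) → Prop} (hzero : p fun _ _ => 0)
    (hadd : ∀ f g, p f → p g → p fun t x => f t x + g t x)
    (hcongr : ∀ f g, p f → (∀ t ∈ Icc 0 T, ∀ x ∈ closure (Ω t), f t x = g t x) → p g)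
    (f : ℝ → Space d → F)
    (hloc : ∀ x₀ : Space d, ∃ U ∈ 𝓝 x₀, ∀ χ : Space d → ℝ, ContDiff ℝ ∞ χ → HasCompactSupport χ →
      tsupport χ ⊆ U → p fun t x => χ x • f t x) : p f := by
  obtain ⟨R, hR⟩ := hΩ.bounded
  choose U hU hUp using hloc
  -- One ball contains all the domains, so the partition of unity can be finite and independent of
  -- time. The unit balls give its members compact support.
  obtain ⟨s, -, hs⟩ := (isCompact_closedBall (0 : Space d) R).elim_nhds_subcover
    (fun x => interior (U x) ∩ Metric.ball x 1)
    fun x _ => inter_mem (interior_mem_nhds.2 (hU x)) (Metric.ball_mem_nhds x one_pos)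
  obtain ⟨χ, hχ⟩ := SmoothPartitionOfUnity.exists_isSubordinate 𝓘(ℝ, Space d)
    (Metric.isClosed_closedBall (x := (0 : Space d)) (ε := R))
    (fun i : s => interior (U i) ∩ Metric.ball (i : Space d) 1)
    (fun i => isOpen_interior.inter Metric.isOpen_ball) (fun x hx => by
      obtain ⟨i, hi, hxi⟩ := mem_iUnion₂.1 (hs hx)
      exact mem_iUnion.2 ⟨⟨i, hi⟩, hxi⟩)
  have hp : ∀ i : s, p fun t x => χ i x • f t x := fun i => by
    refine hUp i (χ i) (χ i).contMDiff.contDiff ?_ ?_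
    · exact HasCompactSupport.of_support_subset_isCompact (isCompact_closedBall (i : Space d) 1)
        ((subset_tsupport _).trans ((hχ i).trans (inter_subset_right.trans
          Metric.ball_subset_closedBall)))
    · exact (hχ i).trans (inter_subset_left.trans interior_subset)
  have hsum : ∀ σ : Finset s, p fun t x => ∑ i ∈ σ, χ i x • f t x := fun σ => by
    induction σ using Finset.induction_on with
    | empty => simpa using hzero
    | insert i σ hi ih =>
      simp only [Finset.sum_insert hi]
      exact hadd _ _ (hp i) ih
  refine hcongr _ _ (hsum Finset.univ) fun t ht x hx => ?_
  have hxR : x ∈ Metric.closedBall (0 : Space d) R :=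
    closure_minimal ((hR t ht).trans Metric.ball_subset_closedBall) Metric.isClosed_closedBall hx
  rw [← Finset.sum_smul, ← finsum_eq_sum_of_fintype, χ.sum_eq_one hxR, one_smul]

/-! ### Derivatives at a fixed time -/

variable {f : ℝ → Space d → F}

theorem hasFDerivWithinAt_slice {I : Set ℝ} (hf : ContDiffOn ℝ 1 (Function.uncurry f) (region I Ω))
    {t : ℝ} (ht : t ∈ I) {x : Space d} (hx : x ∈ closure (Ω t)) :
    HasFDerivWithinAt (f t) ((fderivWithin ℝ (Function.uncurry f) (region I Ω) (t, x)) ∘L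
      .inr ℝ ℝ (Space d)) (closure (Ω t)) x :=
  (hf.differentiableOn one_ne_zero (t, x) ⟨ht, hx⟩).hasFDerivWithinAt.comp x
    (hasFDerivAt_prodMk_right t x).hasFDerivWithinAt fun _ hz => ⟨ht, hz⟩

theorem contDiffOn_slice {I : Set ℝ} {n : WithTop ℕ∞}
    (hf : ContDiffOn ℝ n (Function.uncurry f) (region I Ω))
    {t : ℝ} (ht : t ∈ I) : ContDiffOn ℝ n (f t) (closure (Ω t)) :=
  hf.comp (f := fun x => (t, x)) (by fun_prop) fun _ hz => ⟨ht, hz⟩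

theorem spaceDeriv_eq (hΩ : IsMovingDomain (Icc 0 T) Ω) (hT : 0 < T) (hd : 1 ≤ d)
    (hf : ContDiffOn ℝ 1 (Function.uncurry f) (region (Icc 0 T) Ω))
    {t : ℝ} (ht : t ∈ Icc 0 T) {x : Space d} (hx : x ∈ closure (Ω t)) :
    spaceDeriv Ω f t x = (fderivWithin ℝ (Function.uncurry f) (region (Icc 0 T) Ω) (t, x)) ∘L
      .inr ℝ ℝ (Space d) :=
  (hasFDerivWithinAt_slice hf ht hx).fderivWithin (hΩ.uniqueDiffOn_closure hT hd ht x hx)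

theorem matDeriv_sub_matDeriv (hΩ : IsMovingDomain (Icc 0 T) Ω) (hT : 0 < T) (hd : 1 ≤ d)
    (hf : ContDiffOn ℝ 1 (Function.uncurry f) (region (Icc 0 T) Ω)) (V V' : ℝ → Space d → Space d)
    {t : ℝ} (ht : t ∈ Icc 0 T) {x : Space d} (hx : x ∈ closure (Ω t)) :
    matDeriv (Icc 0 T) Ω V f t x - matDeriv (Icc 0 T) Ω V' f t x =
      spaceDeriv Ω f t x (V t x - V' t x) := by
  rw [spaceDeriv_eq hΩ hT hd hf ht hx, matDeriv, matDeriv, ← map_sub]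
  simp

theorem continuousOn_matDeriv (hΩ : IsMovingDomain (Icc 0 T) Ω) (hT : 0 < T) (hd : 1 ≤ d)
    (hf : ContDiffOn ℝ 1 (Function.uncurry f) (region (Icc 0 T) Ω))
    {V : ℝ → Space d → Space d} {t : ℝ} (ht : t ∈ Icc 0 T)
    (hV : ContinuousOn (V t) (closure (Ω t))) :
    ContinuousOn (matDeriv (Icc 0 T) Ω V f t) (closure (Ω t)) :=
  ((hf.continuousOn_fderivWithin (hΩ.uniqueDiffOn_region hT hd) le_rfl).comp
    (f := fun x => (t, x)) (by fun_prop) fun _ hz => ⟨ht, hz⟩).clm_apply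
    (continuousOn_const.prodMk hV)

theorem continuousOn_spaceDeriv (hΩ : IsMovingDomain (Icc 0 T) Ω) (hT : 0 < T) (hd : 1 ≤ d)
    (hf : ContDiffOn ℝ 1 (Function.uncurry f) (region (Icc 0 T) Ω)) {t : ℝ} (ht : t ∈ Icc 0 T) :
    ContinuousOn (spaceDeriv Ω f t) (closure (Ω t)) :=
  (contDiffOn_slice hf ht).continuousOn_fderivWithin (hΩ.uniqueDiffOn_closure hT hd ht) le_rfl

theorem inner_grad (P : ℝ → Space d → ℝ) (t : ℝ) (x v : Space d) :
    ⟪grad Ω P t x, v⟫ = spaceDeriv Ω P t x v := by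
  rw [grad, gradientWithin, InnerProductSpace.toDual_symm_apply, spaceDeriv]

theorem div_eq_trace (w : ℝ → Space d → Space d) (t : ℝ) (x : Space d) :
    div Ω w t x = LinearMap.trace ℝ (Space d) (spaceDeriv Ω w t x) := by
  rw [LinearMap.trace_eq_sum_inner _ (EuclideanSpace.basisFun (Fin d) ℝ), div]
  simp [EuclideanSpace.inner_single_left]

/-- The fixed-time gradient is the spatial part of the spacetime derivative of `P`, which is `C¹`
jointly in time and space. -/
theorem contDiffOn_grad (hΩ : IsMovingDomain (Icc 0 T) Ω) (hT : 0 < T) (hd : 1 ≤ d)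
    {P : ℝ → Space d → ℝ} (hP : ContDiffOn ℝ 2 (Function.uncurry P) (region (Icc 0 T) Ω)) :
    ContDiffOn ℝ 1 (Function.uncurry (grad Ω P)) (region (Icc 0 T) Ω) := by
  have h1 := hP.fderivWithin (m := 1) (hΩ.uniqueDiffOn_region hT hd) (by norm_num)
  have h2 : ContDiffOn ℝ 1 (fun p => (InnerProductSpace.toDual ℝ (Space d)).symm
      ((fderivWithin ℝ (Function.uncurry P) (region (Icc 0 T) Ω) p) ∘L .inr ℝ ℝ (Space d)))
      (region (Icc 0 T) Ω) :=
    (InnerProductSpace.toDual ℝ (Space d)).symm.toContinuousLinearEquiv.contDiff.comp_contDiffOn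
      (h1.clm_comp contDiffOn_const)
  refine h2.congr fun p hp => ?_
  rw [← spaceDeriv_eq hΩ hT hd (hP.of_le (by norm_num)) hp.1 hp.2]
  rfl

end Region

/-! ### Volume and surface integrals in a chart -/

section Integrals

variable {d : ℕ} {Ω : ℝ → Set (Space d)} {J : Set ℝ} {U : Set (Space d)}
  {A : (Space (d - 1) × ℝ) ≃L[ℝ] Space d} {h : ℝ × Space (d - 1) → ℝ}

/-- Off `U` the chart says nothing, but the integrands vanish. Two functions are allowed so that a
derivative within the domain may become one within the subgraph. -/
theorem IsGraphChart.setIntegral_eq (H : IsGraphChart Ω J U A h) {t : ℝ} (ht : t ∈ J)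
    (hΩt : MeasurableSet (Ω t)) {g₁ g₂ : Space d → ℝ} (heq : ∀ x ∈ U, g₁ x = g₂ x)
    (h₁ : ∀ x ∉ U, g₁ x = 0) (h₂ : ∀ x ∉ U, g₂ x = 0) :
    ∫ x in Ω t, g₁ x = ∫ p in lowerHalf (Space (d - 1)), g₂ (shear A (fun y => h (t, y)) p) := by
  have hh := (contDiff_slice H.contDiff t).continuous
  have hop : MeasurableSet {x : Space d | (A.symm x).2 < h (t, (A.symm x).1)} :=
    (isOpen_lt (by fun_prop)
      (hh.comp (by fun_prop : Continuous fun x => (A.symm x).1))).measurableSet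
  rw [← H.frame.setIntegral_lt_graph hh, ← integral_indicator hΩt, ← integral_indicator hop]
  congr 1
  ext x
  by_cases hx : x ∈ U
  · simp only [indicator, H.mem_iff t ht x hx, heq x hx, Set.mem_ofPred_eq]
  · simp [indicator, h₁ x hx, h₂ x hx]

theorem IsGraphChart.integral_surfaceMeasure_eq (H : IsGraphChart Ω J U A h) {t : ℝ} (ht : t ∈ J)
    {g : Space d → ℝ} (hg : ∀ x ∉ U, g x = 0) :
    ∫ x, g x ∂(surfaceMeasure Ω t) =
      ∫ y, graphDensity (fun y => h (t, y)) y * g (graphMap A (fun y => h (t, y)) y) := by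
  have hh := contDiff_slice H.contDiff_one t
  have hr : MeasurableSet (range (graphMap A (fun y => h (t, y)))) :=
    (isClosedEmbedding_graphMap A hh.continuous).isClosed_range.measurableSet
  rw [← setIntegral_range_graphMap H.frame hh, finrank_euclideanSpace_fin, surfaceMeasure,
    ← integral_indicator isClosed_frontier.measurableSet, ← integral_indicator hr]
  congr 1
  ext x
  by_cases hx : x ∈ U
  · have : x ∈ range (graphMap A (fun y => h (t, y))) ↔ x ∈ frontier (Ω t) := by
      refine ⟨?_, fun hxf => ⟨_, H.eq_graphMap ht hx hxf⟩⟩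
      rintro ⟨y, rfl⟩
      exact H.graphMap_mem_frontier_iff ht hx
    by_cases hxf : x ∈ frontier (Ω t)
    · rw [indicator_of_mem hxf, indicator_of_mem (this.2 hxf)]
    · rw [indicator_of_notMem hxf, indicator_of_notMem (mt this.1 hxf)]
  · simp [indicator, hg x hx]

/-- By compactness finiteness is local, and a bounded piece of a graph has finite area because the
surface density is continuous. -/
theorem isFiniteMeasure_surfaceMeasure {T : ℝ} (hΩ : IsMovingDomain (Icc 0 T) Ω) (hT : 0 < T)
    (hd : 1 ≤ d) {t : ℝ} (ht : t ∈ Icc 0 T) : IsFiniteMeasure (surfaceMeasure Ω t) := by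
  refine ⟨?_⟩
  rw [surfaceMeasure, Measure.restrict_apply_univ]
  refine (hΩ.isCompact_frontier ht).measure_lt_top_of_nhdsWithin fun x _ => ?_
  obtain ⟨A, h, a, b, U, hab, hxU, H⟩ := exists_isGraphChart hT hd ht hΩ x
  have hh := contDiff_slice H.contDiff_one t
  have hemb := (isClosedEmbedding_graphMap A hh.continuous).measurableEmbedding
  set B : Set (Space (d - 1)) := (fun x => (A.symm x).1) '' Metric.closedBall x 1
  have hB : IsCompact B := (isCompact_closedBall x 1).image (by fun_prop)
  refine ⟨frontier (Ω t) ∩ (U ∩ Metric.closedBall x 1), inter_mem_nhdsWithin _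
    (inter_mem (H.isOpen.mem_nhds hxU) (Metric.closedBall_mem_nhds x one_pos)), ?_⟩
  have hsub : frontier (Ω t) ∩ (U ∩ Metric.closedBall x 1) ⊆
      graphMap A (fun y => h (t, y)) '' B := fun z hz =>
    ⟨_, ⟨z, hz.2.2, rfl⟩, H.eq_graphMap hab.mem hz.2.1 hz.1⟩
  refine (measure_mono hsub).trans_lt ?_
  have hcomap := comap_graphMap_euclideanHausdorffMeasure H.frame hh
  rw [finrank_euclideanSpace_fin] at hcomap
  rw [← hemb.comap_apply, hcomap, withDensity_apply _ hB.measurableSet]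
  exact ((continuous_graphDensity hh).continuousOn.integrableOn_compact hB).lintegral_lt_top

theorem integrable_surfaceMeasure_of_continuousOn {T : ℝ} (hΩ : IsMovingDomain (Icc 0 T) Ω)
    (hT : 0 < T) (hd : 1 ≤ d) {t : ℝ} (ht : t ∈ Icc 0 T) {g : Space d → ℝ}
    (hg : ContinuousOn g (frontier (Ω t))) : Integrable g (surfaceMeasure Ω t) := by
  have := isFiniteMeasure_surfaceMeasure hΩ hT hd ht
  obtain ⟨C, hC⟩ := (hΩ.isCompact_frontier ht).exists_bound_of_continuousOn hg
  refine Integrable.of_bound (hg.aestronglyMeasurable isClosed_frontier.measurableSet) C ?_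
  exact (ae_restrict_mem isClosed_frontier.measurableSet).mono hC

end Integrals

/-- Regularity on `S` is needed only where the cutoff is supported. This carries functions from the
moving domain to the whole subgraph, extended by zero outside the chart. -/
theorem contDiffOn_smul_of_isClosed {X F : Type*} [NormedAddCommGroup X] [NormedSpace ℝ X]
    [NormedAddCommGroup F] [NormedSpace ℝ F] {n : WithTop ℕ∞} {η : X → ℝ} {f : X → F}
    {S S' C V : Set X} (hη : ContDiff ℝ n η) (hf : ContDiffOn ℝ n f S) (hC : IsClosed C)
    (hηC : ∀ x ∉ C, η x = 0) (hV : IsOpen V) (hCV : C ⊆ V) (hS : S' ∩ V ⊆ S) :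
    ContDiffOn ℝ n (fun x => η x • f x) S' := by
  intro x hx
  by_cases hxC : x ∈ C
  · refine hη.contDiffWithinAt.smul ((hf x (hS ⟨hx, hCV hxC⟩)).mono_of_mem_nhdsWithin ?_)
    filter_upwards [self_mem_nhdsWithin, mem_nhdsWithin_of_mem_nhds (hV.mem_nhds (hCV hxC))]
      with z hz hzV using hS ⟨hz, hzV⟩
  · refine (contDiffWithinAt_const (c := (0 : F))).congr_of_eventuallyEq ?_ (by simp [hηC x hxC])
    filter_upwards [mem_nhdsWithin_of_mem_nhds (hC.isOpen_compl.mem_nhds hxC)] with z hz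
    simp [hηC z hz]

/-! ### Regularity of the normal and of the Taylor coefficient -/

section Normal

variable {d : ℕ} {T : ℝ} {Ω : ℝ → Set (Space d)}

section GraphFunction

variable {Y : Type*} [NormedAddCommGroup Y] [InnerProductSpace ℝ Y]

theorem contDiff_gradient_slice [FiniteDimensional ℝ Y] {h : ℝ × Y → ℝ} (hh : ContDiff ℝ 2 h) :
    ContDiff ℝ 1 fun p : ℝ × Y => gradient (fun y => h (p.1, y)) p.2 := by
  have h1 : ContDiff ℝ 1 fun p : ℝ × Y => (fderiv ℝ h p) ∘L .inr ℝ ℝ Y :=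
    (hh.fderiv_right (m := 1) (by norm_num)).clm_comp contDiff_const
  have h2 := (InnerProductSpace.toDual ℝ Y).symm.toContinuousLinearEquiv.contDiff.comp h1
  convert h2 using 1
  funext p
  rw [gradient, fderiv_slice (hh.of_le (by norm_num))]
  rfl

theorem graphDensity_eq [FiniteDimensional ℝ Y] (h : Y → ℝ) (y : Y) :
    graphDensity h y = √(1 + ‖gradient h y‖ ^ 2) := by
  simp [graphDensity, gradient]

theorem contDiff_graphDensity [FiniteDimensional ℝ Y] {h : ℝ × Y → ℝ} (hh : ContDiff ℝ 2 h) :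
    ContDiff ℝ 1 fun p : ℝ × Y => graphDensity (fun y => h (p.1, y)) p.2 := by
  simp only [graphDensity_eq]
  exact (contDiff_const.add ((contDiff_gradient_slice hh).norm_sq ℝ)).sqrt fun p => by positivity

end GraphFunction

/-- In a chart the normal is a smooth expression in `∇h`, which costs one of the two derivatives of
`h`. -/
theorem contDiffOn_outerNormal (hΩ : IsMovingDomain (Icc 0 T) Ω) (hT : 0 < T) (hd : 1 ≤ d) :
    ContDiffOn ℝ 1 (fun p : ℝ × Space d => outerNormal (Ω p.1) p.2)
      (freeSurface (Icc 0 T) Ω) := by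
  rintro ⟨t, x⟩ hp
  obtain ⟨A, h, a, b, U, hab, hx, H⟩ := exists_isGraphChart hT hd hp.1 hΩ x
  have hy : ContDiff ℝ 1 fun p : ℝ × Space d => (p.1, (A.symm p.2).1) := by fun_prop
  have hJ := (contDiff_graphDensity H.contDiff).comp hy
  have hG := (contDiff_gradient_slice H.contDiff).comp hy
  have hN : ContDiff ℝ 1 fun p : ℝ × Space d =>
      (graphDensity (fun y => h (p.1, y)) (A.symm p.2).1)⁻¹ •
        conormal A (fun y => h (p.1, y)) (A.symm p.2).1 :=
    (hJ.inv fun p => (graphDensity_pos (d := d) _ _).ne').smul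
      (A.contDiff.comp (hG.neg.prodMk contDiff_const))
  refine hN.contDiffWithinAt.congr_of_eventuallyEq ?_ (H.outerNormal_eq hab.mem hx hp.2)
  obtain ⟨N, hN, hNI⟩ := mem_nhdsWithin_iff_exists_mem_nhds_inter.1 hab.mem_nhdsWithin
  filter_upwards [self_mem_nhdsWithin, mem_nhdsWithin_of_mem_nhds
    (prod_mem_nhds hN (H.isOpen.mem_nhds hx))] with p hp hpN
  exact H.outerNormal_eq (hNI ⟨hpN.1, hp.1⟩) hpN.2 hp.2

theorem continuousOn_outerNormal (hΩ : IsMovingDomain (Icc 0 T) Ω) (hT : 0 < T) (hd : 1 ≤ d)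
    {t : ℝ} (ht : t ∈ Icc 0 T) : ContinuousOn (outerNormal (Ω t)) (frontier (Ω t)) :=
  (contDiffOn_outerNormal hΩ hT hd).continuousOn.comp (f := fun x => (t, x)) (by fun_prop)
    fun _ hx => ⟨ht, hx⟩

theorem norm_outerNormal (hΩ : IsMovingDomain (Icc 0 T) Ω) (hT : 0 < T) (hd : 1 ≤ d)
    {t : ℝ} (ht : t ∈ Icc 0 T) {x : Space d} (hx : x ∈ frontier (Ω t)) :
    ‖outerNormal (Ω t) x‖ = 1 := by
  obtain ⟨A, h, a, b, U, hab, hxU, H⟩ := exists_isGraphChart hT hd ht hΩ x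
  have hpos := graphDensity_pos (d := d) (fun y => h (t, y)) (A.symm x).1
  rw [H.outerNormal_eq hab.mem hxU hx, norm_smul, norm_conormal H.frame, norm_inv,
    Real.norm_of_nonneg hpos.le, inv_mul_cancel₀ hpos.ne']

theorem contDiffOn_taylorCoeff (hΩ : IsMovingDomain (Icc 0 T) Ω) (hT : 0 < T) (hd : 1 ≤ d)
    {P : ℝ → Space d → ℝ} (hP : ContDiffOn ℝ 2 (Function.uncurry P) (region (Icc 0 T) Ω)) :
    ContDiffOn ℝ 1 (Function.uncurry (taylorCoeff Ω P)) (freeSurface (Icc 0 T) Ω) :=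
  (((contDiffOn_grad hΩ hT hd hP).mono (freeSurface_subset_region _ _)).inner ℝ
    (contDiffOn_outerNormal hΩ hT hd)).neg

end Normal

/-! ### The divergence theorem on the moving domain -/

section Divergence

variable {d : ℕ} {T : ℝ} {Ω : ℝ → Set (Space d)}

theorem fderivWithin_smul_eq_zero {X F : Type*} [NormedAddCommGroup X] [NormedSpace ℝ X]
    [NormedAddCommGroup F] [NormedSpace ℝ F] {χ : X → ℝ} (f : X → F) (S : Set X) {x : X}
    (hx : x ∉ tsupport χ) : fderivWithin ℝ (fun x => χ x • f x) S x = 0 := by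
  have h0 : (fun x => χ x • f x) =ᶠ[𝓝 x] fun _ => 0 := by
    filter_upwards [notMem_tsupport_iff_eventuallyEq.1 hx] with z hz
    simp [hz]
  rw [h0.fderivWithin_eq_of_nhds]
  simp

/-- Flattened boundary values pair the field with the unnormalized conormal. Its length is the
surface density, so the result is the flux through the unit normal with respect to surface measure.
-/
theorem divergence_theorem_of_chart {J : Set ℝ} {U : Set (Space d)}
    {A : (Space (d - 1) × ℝ) ≃L[ℝ] Space d} {h : ℝ × Space (d - 1) → ℝ}
    (H : IsGraphChart Ω J U A h) {t : ℝ} (ht : t ∈ J) (hΩt : MeasurableSet (Ω t))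
    {F : Space d → Space d} (hF : ContDiffOn ℝ 1 F (closure (Ω t))) {χ : Space d → ℝ}
    (hχ : ContDiff ℝ ∞ χ) (hχc : HasCompactSupport χ) (hχU : tsupport χ ⊆ U) :
    ∫ x in Ω t, LinearMap.trace ℝ (Space d)
        (fderivWithin ℝ (fun x => χ x • F x) (closure (Ω t)) x) =
      ∫ x, ⟪χ x • F x, outerNormal (Ω t) x⟫ ∂(surfaceMeasure Ω t) := by
  have hχ0 : ∀ x ∉ tsupport χ, χ x = 0 := fun x hx => image_eq_zero_of_notMem_tsupport hx
  have hh := contDiff_slice H.contDiff t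
  have hF' : ContDiffOn ℝ 1 (fun x => χ x • F x) (subgraph A (fun y => h (t, y))) :=
    contDiffOn_smul_of_isClosed (hχ.of_le (by simp)) hF (isClosed_tsupport χ) hχ0 H.isOpen hχU
      fun x hx => (H.mem_closure_iff ht hx.2).2 hx.1
  rw [H.setIntegral_eq ht hΩt (g₂ := fun x => LinearMap.trace ℝ (Space d)
      (fderivWithin ℝ (fun x => χ x • F x) (subgraph A (fun y => h (t, y))) x)),
    setIntegral_trace_fderivWithin_subgraph hh hF' hχc
      (fun x _ hx => by simp [hχ0 x hx]), H.integral_surfaceMeasure_eq ht]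
  · refine integral_congr_ae (.of_forall fun y => ?_)
    simp only
    by_cases hy : graphMap A (fun y => h (t, y)) y ∈ U
    · rw [H.outerNormal_eq ht hy (H.graphMap_mem_frontier_iff ht hy), inner_smul_right,
        inner_conormal H.frame, ← mul_assoc]
      have h1 : (A.symm (graphMap A (fun y => h (t, y)) y)).1 = y := by simp [graphMap]
      rw [h1, mul_inv_cancel₀ (graphDensity_pos _ _).ne', one_mul]
    · simp [hχ0 _ fun hc => hy (hχU hc)]
  · intro x hx
    simp [hχ0 _ fun hc => hx (hχU hc)]
  · intro x hx
    rw [fderivWithin_congr_set (H.closure_eventuallyEq ht hx)]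
  · intro x hx
    rw [fderivWithin_smul_eq_zero F _ fun hc => hx (hχU hc)]
    simp
  · intro x hx
    rw [fderivWithin_smul_eq_zero F _ fun hc => hx (hχU hc)]
    simp

theorem continuousOn_trace_fderivWithin (hΩ : IsMovingDomain (Icc 0 T) Ω) (hT : 0 < T)
    (hd : 1 ≤ d) {t : ℝ} (ht : t ∈ Icc 0 T) {F : Space d → Space d}
    (hF : ContDiffOn ℝ 1 F (closure (Ω t))) :
    ContinuousOn (fun x => LinearMap.trace ℝ (Space d) (fderivWithin ℝ F (closure (Ω t)) x))
      (closure (Ω t)) := by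
  have h1 := hF.continuousOn_fderivWithin (hΩ.uniqueDiffOn_closure hT hd ht) le_rfl
  have h2 : Continuous fun M : Space d →L[ℝ] Space d => LinearMap.trace ℝ (Space d) M :=
    LinearMap.continuous_of_finiteDimensional
      ((LinearMap.trace ℝ (Space d)) ∘ₗ (ContinuousLinearMap.coeLM ℝ))
  exact h2.comp_continuousOn h1

/-- **Divergence theorem** on the domain `Ω t`. -/
theorem divergence_theorem (hΩ : IsMovingDomain (Icc 0 T) Ω) (hT : 0 < T) (hd : 1 ≤ d) {t : ℝ}
    (ht : t ∈ Icc 0 T) {F : Space d → Space d} (hF : ContDiffOn ℝ 1 F (closure (Ω t))) :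
    ∫ x in Ω t, LinearMap.trace ℝ (Space d) (fderivWithin ℝ F (closure (Ω t)) x) =
      ∫ x, ⟪F x, outerNormal (Ω t) x⟫ ∂(surfaceMeasure Ω t) := by
  have hu := hΩ.uniqueDiffOn_closure hT hd ht
  have hn := continuousOn_outerNormal hΩ hT hd ht
  have hm := (hΩ.isOpen hT hd ht).measurableSet
  -- Regularity is carried along with the identity, because splitting the integrals of a sum
  -- requires integrability.
  refine (hΩ.induction_on_cutoff (F := Space d) (p := fun f =>
    ContDiffOn ℝ 1 (f t) (closure (Ω t)) ∧
    ∫ x in Ω t, LinearMap.trace ℝ (Space d) (fderivWithin ℝ (f t) (closure (Ω t)) x) =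
      ∫ x, ⟪f t x, outerNormal (Ω t) x⟫ ∂(surfaceMeasure Ω t)) ?_ ?_ ?_ (fun _ => F) ?_).2
  · exact ⟨contDiffOn_const, by simp⟩
  · rintro f g ⟨hf, hf'⟩ ⟨hg, hg'⟩
    refine ⟨hf.add hg, ?_⟩
    simp only [inner_add_left]
    rw [integral_add, ← hf', ← hg', ← integral_add]
    · refine setIntegral_congr_fun hm fun x hx => ?_
      have hx' := subset_closure hx
      have := fderivWithin_add (hu x hx') (hf.differentiableOn one_ne_zero x hx')
        (hg.differentiableOn one_ne_zero x hx')
      change LinearMap.trace ℝ (Space d) (fderivWithin ℝ (f t + g t) (closure (Ω t)) x) = _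
      rw [this]
      simp
    · exact integrableOn_of_continuousOn_closure hΩ ht
        (continuousOn_trace_fderivWithin hΩ hT hd ht hf)
    · exact integrableOn_of_continuousOn_closure hΩ ht
        (continuousOn_trace_fderivWithin hΩ hT hd ht hg)
    · exact integrable_surfaceMeasure_of_continuousOn hΩ hT hd ht
        ((hf.continuousOn.mono frontier_subset_closure).inner hn)
    · exact integrable_surfaceMeasure_of_continuousOn hΩ hT hd ht
        ((hg.continuousOn.mono frontier_subset_closure).inner hn)
  · rintro f g ⟨hf, hf'⟩ hfg
    have hfg' : EqOn (g t) (f t) (closure (Ω t)) := fun x hx => (hfg t ht x hx).symm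
    refine ⟨hf.congr hfg', ?_⟩
    rw [setIntegral_congr_fun hm fun x hx => by
      rw [fderivWithin_congr hfg' (hfg' (subset_closure hx))], hf']
    refine integral_congr_ae ?_
    filter_upwards [ae_restrict_mem isClosed_frontier.measurableSet] with x hx
    rw [hfg' (frontier_subset_closure hx)]
  · intro x
    obtain ⟨A, h, a, b, U, hab, hxU, H⟩ := exists_isGraphChart hT hd ht hΩ x
    exact ⟨U, H.isOpen.mem_nhds hxU, fun χ hχ hχc hχU =>
      ⟨(hχ.of_le (by simp)).contDiffOn.smul hF,
        divergence_theorem_of_chart H hab.mem hm hF hχ hχc hχU⟩⟩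

end Divergence

/-! ### Reynolds' transport theorem -/

section Reynolds

variable {d : ℕ} {T : ℝ} {Ω : ℝ → Set (Space d)}

theorem trace_smulRight (l : Space d →L[ℝ] ℝ) (v : Space d) :
    LinearMap.trace ℝ (Space d) (l.smulRight v : Space d →L[ℝ] Space d) = l v := by
  rw [LinearMap.trace_eq_sum_inner _ (EuclideanSpace.basisFun (Fin d) ℝ)]
  conv_rhs => rw [← (EuclideanSpace.basisFun (Fin d) ℝ).sum_repr' v, map_sum]
  simp [inner_smul_right, mul_comm]

/-- Integration by parts against a divergence-free field. -/
theorem setIntegral_fderivWithin_apply_eq (hΩ : IsMovingDomain (Icc 0 T) Ω) (hT : 0 < T)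
    (hd : 1 ≤ d) {t : ℝ} (ht : t ∈ Icc 0 T) {φ : Space d → ℝ} {Z : Space d → Space d}
    (hφ : ContDiffOn ℝ 1 φ (closure (Ω t))) (hZ : ContDiffOn ℝ 1 Z (closure (Ω t)))
    (hdiv : ∀ x ∈ Ω t, LinearMap.trace ℝ (Space d) (fderivWithin ℝ Z (closure (Ω t)) x) = 0) :
    ∫ x in Ω t, fderivWithin ℝ φ (closure (Ω t)) x (Z x) =
      ∫ x, φ x * ⟪Z x, outerNormal (Ω t) x⟫ ∂(surfaceMeasure Ω t) := by
  have h := divergence_theorem hΩ hT hd ht (F := fun x => φ x • Z x) (hφ.smul hZ)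
  simp only [inner_smul_left, conj_trivial] at h
  rw [← h]
  refine setIntegral_congr_fun (hΩ.isOpen hT hd ht).measurableSet fun x hx => ?_
  have hx' := subset_closure hx
  rw [fderivWithin_fun_smul (hΩ.uniqueDiffOn_closure hT hd ht x hx')
    (hφ.differentiableOn one_ne_zero x hx') (hZ.differentiableOn one_ne_zero x hx')]
  have h1 := trace_smulRight (fderivWithin ℝ φ (closure (Ω t)) x) (Z x)
  simp only [ContinuousLinearMap.toLinearMap_add, ContinuousLinearMap.toLinearMap_smul, map_add,
    map_smul, hdiv x hx, h1]
  simp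

/-- The vertical velocity field of a moving graph. -/
def graphVelocity (A : (Space (d - 1) × ℝ) ≃L[ℝ] Space d) (h : ℝ × Space (d - 1) → ℝ) (t : ℝ)
    (x : Space d) : Space d := A (0, fderiv ℝ h (t, (A.symm x).1) (1, 0))

theorem contDiff_graphVelocity (A : (Space (d - 1) × ℝ) ≃L[ℝ] Space d)
    {h : ℝ × Space (d - 1) → ℝ} (hh : ContDiff ℝ 2 h) (t : ℝ) :
    ContDiff ℝ 1 (graphVelocity A h t) := by
  have h1 : ContDiff ℝ 1 fun x : Space d => fderiv ℝ h (t, (A.symm x).1) (1, 0) :=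
    ((hh.fderiv_right (m := 1) (by norm_num)).comp
      (by fun_prop : ContDiff ℝ 1 fun x : Space d => (t, (A.symm x).1))).clm_apply contDiff_const
  exact A.contDiff.comp (contDiff_const.prodMk h1)

/-- The velocity is vertical and does not depend on the vertical coordinate. -/
theorem trace_fderiv_graphVelocity (A : (Space (d - 1) × ℝ) ≃L[ℝ] Space d)
    {h : ℝ × Space (d - 1) → ℝ} (hh : ContDiff ℝ 2 h) (t : ℝ) (x : Space d) :
    LinearMap.trace ℝ (Space d) (fderiv ℝ (graphVelocity A h t) x) = 0 := by
  have hβ : ContDiff ℝ 1 fun y => fderiv ℝ h (t, y) (1, 0) :=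
    ((hh.fderiv_right (m := 1) (by norm_num)).comp
      (by fun_prop : ContDiff ℝ 1 fun y : Space (d - 1) => (t, y))).clm_apply contDiff_const
  have h1 := (hβ.differentiable one_ne_zero (A.symm x).1).hasFDerivAt.comp x
    (hasFDerivAt_fst.comp x A.symm.toContinuousLinearMap.hasFDerivAt)
  have h2 := A.toContinuousLinearMap.hasFDerivAt.comp x
    ((hasFDerivAt_const (0 : Space (d - 1)) x).prodMk h1)
  change HasFDerivAt (graphVelocity A h t) _ x at h2
  rw [h2.fderiv, trace_eq_sum_frame A (EuclideanSpace.basisFun (Fin (d - 1)) ℝ)]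
  simp

theorem tsupport_comp_snd_subset {X F : Type*} [TopologicalSpace X] [TopologicalSpace F]
    (χ : X → ℝ) : tsupport (fun p : F × X => χ p.2) ⊆ Prod.snd ⁻¹' tsupport χ :=
  tsupport_comp_subset_preimage χ continuous_snd

theorem uncurry_smul_eq {F : Type*} [NormedAddCommGroup F] [NormedSpace ℝ F] (χ : Space d → ℝ)
    (f : ℝ → Space d → F) : Function.uncurry (fun t x => χ x • f t x) =
      fun p : ℝ × Space d => (fun p : ℝ × Space d => χ p.2) p • Function.uncurry f p := rfl

theorem fderivWithin_uncurry_smul_eq_zero {F : Type*} [NormedAddCommGroup F] [NormedSpace ℝ F]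
    {χ : Space d → ℝ} (f : ℝ → Space d → F) (S : Set (ℝ × Space d)) {t : ℝ} {x : Space d}
    (hx : x ∉ tsupport χ) :
    fderivWithin ℝ (Function.uncurry fun t x => χ x • f t x) S (t, x) = 0 := by
  rw [uncurry_smul_eq]
  exact fderivWithin_smul_eq_zero _ _ fun h => hx (tsupport_comp_snd_subset χ h)

/-- The shear makes the domain of integration fixed and preserves volume. By the chain rule, the
time derivative in flattened coordinates is the material derivative along the graph velocity, with
no divergence term. -/
theorem hasDerivWithinAt_setIntegral_of_chart (hΩ : IsMovingDomain (Icc 0 T) Ω) (hT : 0 < T)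
    (hd : 1 ≤ d) {f : ℝ → Space d → ℝ}
    (hf : ContDiffOn ℝ 1 (Function.uncurry f) (region (Icc 0 T) Ω)) {t₀ a b : ℝ}
    (hab : IsTimeInterval (Icc 0 T) t₀ a b) {U : Set (Space d)}
    {A : (Space (d - 1) × ℝ) ≃L[ℝ] Space d} {h : ℝ × Space (d - 1) → ℝ}
    (H : IsGraphChart Ω (Icc a b) U A h) {χ : Space d → ℝ}
    (hχ : ContDiff ℝ ∞ χ) (hχc : HasCompactSupport χ) (hχU : tsupport χ ⊆ U) :
    HasDerivWithinAt (fun t => ∫ x in Ω t, χ x • f t x)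
      (∫ x in Ω t₀, matDeriv (Icc 0 T) Ω (graphVelocity A h) (fun t x => χ x • f t x) t₀ x)
      (Icc 0 T) t₀ := by
  set k : ℝ → Space d → ℝ := fun t x => χ x • f t x
  have hχ0 : ∀ x ∉ tsupport χ, χ x = 0 := fun x hx => image_eq_zero_of_notMem_tsupport hx
  have hχU0 : ∀ x ∉ U, χ x = 0 := fun x hx => hχ0 x fun hc => hx (hχU hc)
  have hk : ContDiffOn ℝ 1 (Function.uncurry k) (stSubgraph (Icc a b) A h) :=
    contDiffOn_smul_of_isClosed (η := fun p : ℝ × Space d => χ p.2)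
      ((hχ.of_le (by simp)).comp contDiff_snd) hf
      ((isClosed_tsupport χ).preimage continuous_snd) (fun p hp => hχ0 _ hp)
      (H.isOpen.preimage continuous_snd) (fun p hp => hχU hp)
      fun p hp => ⟨hab.subset hp.1.1, (H.mem_closure_iff hp.1.1 hp.2).2 hp.1.2⟩
  have hmaps : MapsTo (stShear A h) (Icc a b ×ˢ lowerHalf (Space (d - 1)))
      (stSubgraph (Icc a b) A h) := fun p hp => (stShear_mem_stSubgraph_iff _ A h p).2 hp
  have hkk : ContDiffOn ℝ 1 (Function.uncurry k ∘ stShear A h)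
      (Icc a b ×ˢ lowerHalf (Space (d - 1))) :=
    hk.comp (contDiff_stShear A H.contDiff_one).contDiffOn hmaps
  set K : Set (Space (d - 1) × ℝ) :=
    (fun p : ℝ × Space d => unshear A (fun y => h (p.1, y)) p.2) '' (Icc a b ×ˢ tsupport χ)
  have hK : IsCompact K := by
    refine (isCompact_Icc.prod hχc).image ?_
    have := H.contDiff.continuous
    unfold unshear
    fun_prop
  have hsupp : ∀ t ∈ Icc a b, ∀ p ∈ lowerHalf (Space (d - 1)), p ∉ K →
      (Function.uncurry k ∘ stShear A h) (t, p) = 0 := fun t ht p _ hpK => by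
    have : shear A (fun y => h (t, y)) p ∉ tsupport χ := fun hc =>
      hpK ⟨(t, _), ⟨ht, hc⟩, unshear_shear A _ p⟩
    simp [stShear, k, hχ0 _ this]
  have hleib := hasDerivWithinAt_setIntegral_of_contDiffOn (μ := volume) hab.lt
    isClosed_lowerHalf uniqueDiffOn_lowerHalf hkk hK hsupp hab.mem
  have hint : ∀ t ∈ Icc a b, ∫ x in Ω t, k t x =
      ∫ p in lowerHalf (Space (d - 1)), (Function.uncurry k ∘ stShear A h) (t, p) := fun t ht => by
    rw [H.setIntegral_eq ht (hΩ.isOpen hT hd (hab.subset ht)).measurableSet (g₂ := k t)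
      (fun _ _ => rfl) (fun x hx => by simp [k, hχU0 x hx]) (fun x hx => by simp [k, hχU0 x hx])]
    rfl
  have hderiv : ∫ x in Ω t₀, matDeriv (Icc 0 T) Ω (graphVelocity A h) k t₀ x =
      ∫ p in lowerHalf (Space (d - 1)), fderivWithin ℝ (Function.uncurry k ∘ stShear A h)
        (Icc a b ×ˢ lowerHalf (Space (d - 1))) (t₀, p) (1, 0) := by
    rw [H.setIntegral_eq hab.mem (hΩ.isOpen hT hd (hab.subset hab.mem)).measurableSet
      (g₂ := fun x => fderivWithin ℝ (Function.uncurry k) (stSubgraph (Icc a b) A h) (t₀, x)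
        (1, graphVelocity A h t₀ x))]
    · refine setIntegral_congr_fun isClosed_lowerHalf.measurableSet fun p hp => ?_
      have hp' : (t₀, p) ∈ Icc a b ×ˢ lowerHalf (Space (d - 1)) := ⟨hab.mem, hp⟩
      obtain ⟨D, hD, hDv⟩ := hasFDerivAt_stShear A H.contDiff_one (t₀, p)
      have h1 := ((hk.differentiableOn one_ne_zero _ (hmaps hp')).hasFDerivWithinAt).comp _
        hD.hasFDerivWithinAt hmaps
      rw [h1.fderivWithin (((uniqueDiffOn_Icc hab.lt).prod uniqueDiffOn_lowerHalf) _ hp'),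
        ContinuousLinearMap.comp_apply, show D (1, 0) = _ from hDv 1 0 0]
      simp [graphVelocity, stShear, shear]
    · intro x hx
      rw [matDeriv, fderivWithin_congr_set (region_eventuallyEq hab H hx)]
    · intro x hx
      rw [matDeriv, fderivWithin_uncurry_smul_eq_zero f _ fun hc => hx (hχU hc)]
      rfl
    · intro x hx
      rw [fderivWithin_uncurry_smul_eq_zero f _ fun hc => hx (hχU hc)]
      rfl
  rw [hderiv]
  exact (hleib.congr hint (hint t₀ hab.mem)).mono_of_mem_nhdsWithin hab.mem_nhdsWithin

/-- **Reynolds transport theorem** for a divergence-free velocity field tangent to the moving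
boundary. -/
theorem hasDerivWithinAt_setIntegral (hΩ : IsMovingDomain (Icc 0 T) Ω) (hT : 0 < T)
    (hd : 1 ≤ d) {V : ℝ → Space d → Space d}
    (hV : ContDiffOn ℝ 1 (Function.uncurry V) (region (Icc 0 T) Ω)) {t₀ : ℝ}
    (ht₀ : t₀ ∈ Icc 0 T) (hdiv : ∀ x ∈ Ω t₀, div Ω V t₀ x = 0) (htan : IsTangent (Icc 0 T) Ω V)
    {f : ℝ → Space d → ℝ} (hf : ContDiffOn ℝ 1 (Function.uncurry f) (region (Icc 0 T) Ω)) :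
    HasDerivWithinAt (fun t => ∫ x in Ω t, f t x)
      (∫ x in Ω t₀, matDeriv (Icc 0 T) Ω V f t₀ x) (Icc 0 T) t₀ := by
  have hur := hΩ.uniqueDiffOn_region hT hd
  have hm := fun t ht => (hΩ.isOpen hT hd (t := t) ht).measurableSet
  have hVc := (contDiffOn_slice hV ht₀).continuousOn
  have hint : ∀ f : ℝ → Space d → ℝ, ContDiffOn ℝ 1 (Function.uncurry f) (region (Icc 0 T) Ω) →
      IntegrableOn (matDeriv (Icc 0 T) Ω V f t₀) (Ω t₀) := fun f hf =>
    integrableOn_of_continuousOn_closure hΩ ht₀ (continuousOn_matDeriv hΩ hT hd hf ht₀ hVc)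
  refine (hΩ.induction_on_cutoff (F := ℝ) (p := fun f =>
    ContDiffOn ℝ 1 (Function.uncurry f) (region (Icc 0 T) Ω) ∧
    HasDerivWithinAt (fun t => ∫ x in Ω t, f t x)
      (∫ x in Ω t₀, matDeriv (Icc 0 T) Ω V f t₀ x) (Icc 0 T) t₀) ?_ ?_ ?_ f ?_).2
  · refine ⟨contDiffOn_const, ?_⟩
    have : matDeriv (Icc 0 T) Ω V (fun _ _ => (0 : ℝ)) t₀ = fun _ => 0 := by
      funext x
      have : Function.uncurry (fun (_ : ℝ) (_ : Space d) => (0 : ℝ)) = fun _ => 0 := rfl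
      rw [matDeriv, this]
      simp
    rw [this]
    simpa using hasDerivWithinAt_const t₀ (Icc 0 T) (0 : ℝ)
  · rintro f g ⟨hf, hf'⟩ ⟨hg, hg'⟩
    refine ⟨hf.add hg, ?_⟩
    have h1 : ∫ x in Ω t₀, matDeriv (Icc 0 T) Ω V (fun t x => f t x + g t x) t₀ x =
        (∫ x in Ω t₀, matDeriv (Icc 0 T) Ω V f t₀ x) +
          ∫ x in Ω t₀, matDeriv (Icc 0 T) Ω V g t₀ x := by
      rw [← integral_add (hint f hf) (hint g hg)]
      refine setIntegral_congr_fun (hm t₀ ht₀) fun x hx => ?_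
      have hx' : (t₀, x) ∈ region (Icc 0 T) Ω := ⟨ht₀, subset_closure hx⟩
      have := fderivWithin_add (hur _ hx') (hf.differentiableOn one_ne_zero _ hx')
        (hg.differentiableOn one_ne_zero _ hx')
      change fderivWithin ℝ (Function.uncurry f + Function.uncurry g) _ _ _ = _
      rw [this]
      rfl
    have h2 : ∀ t ∈ Icc 0 T, ∫ x in Ω t, (f t x + g t x) =
        (∫ x in Ω t, f t x) + ∫ x in Ω t, g t x := fun t ht =>
      integral_add
        (integrableOn_of_continuousOn_closure hΩ ht (contDiffOn_slice hf ht).continuousOn)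
        (integrableOn_of_continuousOn_closure hΩ ht (contDiffOn_slice hg ht).continuousOn)
    rw [h1]
    exact (hf'.add hg').congr h2 (h2 t₀ ht₀)
  · rintro f g ⟨hf, hf'⟩ hfg
    have hfg' : EqOn (Function.uncurry g) (Function.uncurry f) (region (Icc 0 T) Ω) :=
      fun p hp => (hfg p.1 hp.1 p.2 hp.2).symm
    refine ⟨hf.congr hfg', ?_⟩
    have h1 : ∫ x in Ω t₀, matDeriv (Icc 0 T) Ω V g t₀ x =
        ∫ x in Ω t₀, matDeriv (Icc 0 T) Ω V f t₀ x := by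
      refine setIntegral_congr_fun (hm t₀ ht₀) fun x hx => ?_
      have hx' : (t₀, x) ∈ region (Icc 0 T) Ω := ⟨ht₀, subset_closure hx⟩
      simp only [matDeriv]
      rw [fderivWithin_congr hfg' (hfg' hx')]
    have h2 : ∀ t ∈ Icc 0 T, ∫ x in Ω t, g t x = ∫ x in Ω t, f t x := fun t ht =>
      setIntegral_congr_fun (hm t ht) fun x hx => (hfg t ht x (subset_closure hx)).symm
    rw [h1]
    exact hf'.congr h2 (h2 t₀ ht₀)
  · intro x
    obtain ⟨A, h, a, b, U, hab, hxU, H⟩ := exists_isGraphChart hT hd ht₀ hΩ x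
    refine ⟨U, H.isOpen.mem_nhds hxU, fun χ hχ hχc hχU => ?_⟩
    have hk : ContDiffOn ℝ 1 (Function.uncurry fun t x => χ x • f t x) (region (Icc 0 T) Ω) :=
      ((hχ.of_le (by simp)).comp contDiff_snd).contDiffOn.smul hf
    refine ⟨hk, ?_⟩
    have hloc := hasDerivWithinAt_setIntegral_of_chart hΩ hT hd hf hab H hχ hχc hχU
    set k : ℝ → Space d → ℝ := fun t x => χ x • f t x
    have hV₀ := contDiff_graphVelocity A H.contDiff t₀
    have hus := hΩ.uniqueDiffOn_closure hT hd ht₀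
    have hVs := contDiffOn_slice hV ht₀
    -- The material derivatives along `V` and along the graph velocity differ by a derivative along
    -- a divergence-free field, whose integral is a boundary flux.
    have hgreen := setIntegral_fderivWithin_apply_eq hΩ hT hd ht₀ (contDiffOn_slice hk ht₀)
      (hVs.sub hV₀.contDiffOn) (fun x hx => by
        have hx' := subset_closure hx
        have h1 := fderivWithin_sub (hus x hx') (hVs.differentiableOn one_ne_zero x hx')
          ((hV₀.differentiable one_ne_zero x).differentiableWithinAt)
        have h2 := hdiv x hx
        rw [div_eq_trace, spaceDeriv] at h2
        change LinearMap.trace ℝ (Space d) (fderivWithin ℝ (V t₀ - graphVelocity A h t₀) _ _) = 0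
        rw [h1, (hV₀.differentiable one_ne_zero x).fderivWithin (hus x hx')]
        simp only [ContinuousLinearMap.toLinearMap_sub, map_sub, h2,
          trace_fderiv_graphVelocity A H.contDiff, sub_zero])
    -- Tangency says that `V` and the graph velocity have the same normal component, so the flux
    -- vanishes pointwise.
    have hflux : ∫ x, k t₀ x * ⟪V t₀ x - graphVelocity A h t₀ x, outerNormal (Ω t₀) x⟫
        ∂(surfaceMeasure Ω t₀) = 0 := by
      rw [← integral_zero (Space d) ℝ (μ := surfaceMeasure Ω t₀)]
      refine integral_congr_ae ?_
      filter_upwards [ae_restrict_mem isClosed_frontier.measurableSet] with x hxf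
      by_cases hx : x ∈ U
      · have htan' := H.snd_eq_of_isTangent hab htan hx hxf
        have hsplit : ((1 : ℝ), (A.symm (V t₀ x)).1) = (1, 0) + (0, (A.symm (V t₀ x)).1) := by simp
        rw [hsplit, map_add] at htan'
        rw [H.outerNormal_eq hab.mem hx hxf, inner_smul_right, inner_conormal H.frame,
          fderiv_slice H.contDiff_one]
        simp [graphVelocity, htan']
      · have : χ x = 0 := image_eq_zero_of_notMem_tsupport fun hc => hx (hχU hc)
        simp [k, this]
    have heq : ∫ x in Ω t₀, matDeriv (Icc 0 T) Ω V k t₀ x =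
        ∫ x in Ω t₀, matDeriv (Icc 0 T) Ω (graphVelocity A h) k t₀ x := by
      rw [← sub_eq_zero, ← integral_sub (hint k hk) (integrableOn_of_continuousOn_closure hΩ ht₀
        (continuousOn_matDeriv hΩ hT hd hk ht₀ hV₀.continuous.continuousOn))]
      refine Eq.trans ?_ (hgreen.trans hflux)
      exact setIntegral_congr_fun (hm t₀ ht₀) fun x hx =>
        matDeriv_sub_matDeriv hΩ hT hd hk _ _ ht₀ (subset_closure hx)
    rw [heq]
    exact hloc

end Reynolds

/-! ### Stretching of the surface element -/

section GraphStrain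

variable {Y E : Type*} [NormedAddCommGroup Y] [InnerProductSpace ℝ Y] [NormedAddCommGroup E]
  [InnerProductSpace ℝ E]

/-- The rate of change of the surface element of a graph transported by a trace-free flow with
gradient `M`. -/
theorem graph_strain_identity {A : (Y × ℝ) ≃L[ℝ] E} (hA : IsOrthogonalFrame A) {G : Y}
    {M : E →L[ℝ] E} (htr : LinearMap.trace ℝ E M = 0) {J δ : ℝ} (hJ : 0 < J)
    (hJ2 : J ^ 2 = 1 + ‖G‖ ^ 2)
    (hδ : J * δ = (A.symm (M (A (G, ⟪G, G⟫)))).2 - ⟪G, (A.symm (M (A (G, ⟪G, G⟫)))).1⟫)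
    {ι : Type*} [Fintype ι] (b : OrthonormalBasis ι ℝ Y) :
    δ + J * ∑ j, ⟪b j, (A.symm (M (A (b j, ⟪G, b j⟫)))).1⟫ =
      -(J * ⟪M (J⁻¹ • A (-G, 1)), J⁻¹ • A (-G, 1)⟫) := by
  set N : (Y × ℝ) →L[ℝ] (Y × ℝ) :=
    (A.symm : E →L[ℝ] Y × ℝ) ∘L M ∘L (A : (Y × ℝ) →L[ℝ] E)
  have hN : ∀ p, A.symm (M (A p)) = N p := fun p => rfl
  have hMA : ∀ p, M (A p) = A (N p) := fun p => by simp [N]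
  rw [trace_eq_sum_frame A b] at htr
  simp only [hN] at htr hδ ⊢
  -- Both numbers pair an image under `M` with the conormal, for the vertical vector and for the
  -- conormal itself. Since `(G, |G|²) = J² (0, 1) - (-G, 1)`, the hypothesis reads `J δ = J² α -
  -- β`. The trace condition makes the horizontal divergence `-α`, so the `α` terms cancel and only
  -- the normal strain `β / J²` survives.
  set α := (N (0, 1)).2 - ⟪G, (N (0, 1)).1⟫
  set β := (N (-G, 1)).2 - ⟪G, (N (-G, 1)).1⟫
  have hGG : N (G, ⟪G, G⟫) = J ^ 2 • N (0, 1) - N (-G, 1) := by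
    rw [← map_smul, ← map_sub]
    congr 1
    ext <;> simp [hJ2]
  have hsum : ∑ j, ⟪b j, (N (b j, ⟪G, b j⟫)).1⟫ = -α := by
    have h1 : ∀ j, N (b j, ⟪G, b j⟫) = N (b j, 0) + ⟪G, b j⟫ • N (0, 1) := fun j => by
      rw [← map_smul, ← map_add]
      congr 1
      ext <;> simp
    simp only [h1, Prod.fst_add, Prod.smul_fst, inner_add_right, inner_smul_right,
      Finset.sum_add_distrib, b.sum_inner_mul_inner]
    simp only [α]
    linarith
  have hin : ⟪M (J⁻¹ • A (-G, 1)), J⁻¹ • A (-G, 1)⟫ = J⁻¹ ^ 2 * β := by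
    rw [map_smul, hMA, inner_smul_left, inner_smul_right, hA, inner_neg_right, real_inner_comm]
    simp only [β, conj_trivial]
    ring
  rw [hGG] at hδ
  have hδ' : J * δ = J ^ 2 * α - β := by
    rw [hδ]
    simp only [Prod.snd_sub, Prod.smul_snd, Prod.fst_sub, Prod.smul_fst, inner_sub_right,
      inner_smul_right, smul_eq_mul, α, β]
    ring
  rw [hsum, hin]
  apply mul_left_cancel₀ hJ.ne'
  rw [mul_add, hδ']
  field_simp
  ring

variable {h : ℝ × Y → ℝ}

theorem inner_gradient_slice [FiniteDimensional ℝ Y] (hh : ContDiff ℝ 1 h) (p : ℝ × Y) (u : Y) :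
    ⟪gradient (fun y => h (p.1, y)) p.2, u⟫ = fderiv ℝ h p (0, u) := by
  rw [gradient, InnerProductSpace.toDual_symm_apply, fderiv_slice hh]
  rfl

/-- The derivative of the surface element of a moving graph. -/
theorem graphDensity_mul_fderiv [FiniteDimensional ℝ Y] (hh : ContDiff ℝ 2 h) (p v : ℝ × Y) :
    graphDensity (fun y => h (p.1, y)) p.2 *
        fderiv ℝ (fun p : ℝ × Y => graphDensity (fun y => h (p.1, y)) p.2) p v =
      fderiv ℝ (fderiv ℝ h) p (0, gradient (fun y => h (p.1, y)) p.2) v := by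
  have hh1 : ContDiff ℝ 1 h := hh.of_le (by norm_num)
  set Gf : ℝ × Y → Y := fun p => gradient (fun y => h (p.1, y)) p.2
  set Jf : ℝ × Y → ℝ := fun p => graphDensity (fun y => h (p.1, y)) p.2
  have hG := ((contDiff_gradient_slice hh).differentiable one_ne_zero p).hasFDerivAt
  have hJ := ((contDiff_graphDensity hh).differentiable one_ne_zero p).hasFDerivAt
  have hsq : ∀ q, Jf q ^ 2 = 1 + ‖Gf q‖ ^ 2 := fun q => by
    simp only [Jf, graphDensity_eq]
    rw [Real.sq_sqrt (by positivity)]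
  have h1 := hJ.pow 2
  have h2 := hG.norm_sq.const_add 1
  have h3 : Jf p * fderiv ℝ Jf p v = ⟪Gf p, fderiv ℝ Gf p v⟫ := by
    have : (fun q => Jf q ^ 2) = fun q => 1 + ‖Gf q‖ ^ 2 := funext hsq
    change HasFDerivAt (fun q => Jf q ^ 2) _ p at h1
    rw [this] at h1
    have h4 := congrArg (fun l => l v) (h1.unique h2)
    rw [smul_apply, smul_apply, ContinuousLinearMap.comp_apply, innerSL_apply_apply] at h4
    simp only [smul_eq_mul, nsmul_eq_mul, Nat.cast_ofNat, Nat.add_one_sub_one, pow_one] at h4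
    linarith
  have hD2 : HasFDerivAt (fderiv ℝ h) (fderiv ℝ (fderiv ℝ h) p) p :=
    ((hh.fderiv_right (m := 1) (by norm_num)).differentiable one_ne_zero p).hasFDerivAt
  -- With one factor frozen at `p`, `⟪Gf q, Gf p⟫` is the derivative of `h` at `q` in a fixed
  -- direction, so differentiating it gives a second derivative of `h`, which is symmetric.
  have h5 : ⟪Gf p, fderiv ℝ Gf p v⟫ = fderiv ℝ (fderiv ℝ h) p v (0, Gf p) := by
    have h6 := hG.inner ℝ (hasFDerivAt_const (Gf p) p)
    have h7 := hD2.clm_apply (hasFDerivAt_const ((0 : ℝ), Gf p) p)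
    have : (fun q => ⟪Gf q, Gf p⟫) = fun q => fderiv ℝ h q (0, Gf p) :=
      funext fun q => inner_gradient_slice hh1 q _
    change HasFDerivAt (fun q => ⟪Gf q, Gf p⟫) _ p at h6
    rw [this] at h6
    have h8 := congrArg (fun l => l v) (h6.unique h7)
    simp only [ContinuousLinearMap.comp_apply, ContinuousLinearMap.prod_apply,
      fderivInnerCLM_apply] at h8
    rw [real_inner_comm]
    simpa using h8
  rw [h3, h5]
  exact (hh.contDiffAt.isSymmSndFDerivAt (by simp)).eq _ _

variable [FiniteDimensional ℝ Y] [MeasurableSpace Y] [BorelSpace Y] [FiniteDimensional ℝ E]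
  [MeasurableSpace E] [BorelSpace E]

theorem integral_sum_inner_fderiv_eq_zero {Z : Y → Y} (hZ : ContDiff ℝ 1 Z)
    (hc : HasCompactSupport Z) {ι : Type*} [Fintype ι] (b : OrthonormalBasis ι ℝ Y) :
    Integrable (fun y => ∑ j, ⟪b j, fderiv ℝ Z y (b j)⟫) ∧
      ∫ y, ∑ j, ⟪b j, fderiv ℝ Z y (b j)⟫ = 0 := by
  have h1 : ∀ j y, ⟪b j, fderiv ℝ Z y (b j)⟫ = fderiv ℝ (fun y => ⟪b j, Z y⟫) y (b j) :=
    fun j y => by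
      have := ((innerSL ℝ (b j)).hasFDerivAt (x := Z y)).comp y
        (hZ.differentiable one_ne_zero y).hasFDerivAt
      change HasFDerivAt (fun y => ⟪b j, Z y⟫) _ y at this
      rw [this.fderiv]
      rfl
  have h2 : ∀ j, ContDiff ℝ 1 fun y => ⟪b j, Z y⟫ := fun j => contDiff_const.inner ℝ hZ
  have h3 : ∀ j, HasCompactSupport fun y => ⟪b j, Z y⟫ := fun j =>
    hc.comp_left (g := fun z => ⟪b j, z⟫) (inner_zero_right _)
  have h4 : ∀ j, Integrable fun y => fderiv ℝ (fun y => ⟪b j, Z y⟫) y (b j) := fun j =>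
    (((h2 j).continuous_fderiv one_ne_zero).clm_apply
      continuous_const).integrable_of_hasCompactSupport ((h3 j).fderiv_apply (𝕜 := ℝ) (b j))
  simp only [h1]
  refine ⟨integrable_finsetSum _ fun j _ => h4 j, ?_⟩
  rw [integral_finsetSum _ fun j _ => h4 j]
  exact Finset.sum_eq_zero fun j _ => integral_fderiv_eq_zero (h2 j) (h3 j) _

end GraphStrain

/-! ### Material derivatives on the free surface -/

section SurfaceDerivative

variable {d : ℕ} {I : Set ℝ} {Ω : ℝ → Set (Space d)} {V : ℝ → Space d → Space d}
  {F : Type*} [NormedAddCommGroup F] [NormedSpace ℝ F] {g : ℝ → Space d → F}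

theorem surfMatDeriv_eq (hV : IsTangent I Ω V) {t : ℝ} (ht : t ∈ I) {x : Space d}
    (hx : x ∈ frontier (Ω t)) {g' : ℝ × Space d →L[ℝ] F}
    (hg : HasFDerivWithinAt (Function.uncurry g) g' (freeSurface I Ω) (t, x)) :
    surfMatDeriv I Ω V g t x = g' (1, V t x) :=
  hg.differentiableWithinAt.hasFDerivWithinAt.unique_on hg (hV (t, x) ⟨ht, hx⟩)

/-- A derivative within the surface is determined only in tangential directions, so the chosen one
need not be continuous. Locally `C¹` regularity supplies a continuous family of such derivatives,
and evaluation on the tangent vector `(1, V)` does not see the choice. -/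
theorem continuousOn_surfMatDeriv (hV : IsTangent I Ω V)
    (hg : ContDiffOn ℝ 1 (Function.uncurry g) (freeSurface I Ω)) {t : ℝ} (ht : t ∈ I)
    (hVc : ContinuousOn (V t) (frontier (Ω t))) :
    ContinuousOn (surfMatDeriv I Ω V g t) (frontier (Ω t)) := by
  intro x hx
  have hp : (t, x) ∈ freeSurface I Ω := ⟨ht, hx⟩
  have h0 : ContDiffWithinAt ℝ (0 + 1) (Function.uncurry g) (freeSurface I Ω) (t, x) := by
    simpa using hg _ hp
  obtain ⟨u, hu, -, -, g', hg', hc⟩ := (contDiffWithinAt_succ_iff_hasFDerivWithinAt' (by simp)).1 h0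
  rw [insert_eq_of_mem hp] at hu
  have htend : Tendsto (fun z : Space d => (t, z)) (𝓝[frontier (Ω t)] x)
      (𝓝[freeSurface I Ω] (t, x)) :=
    tendsto_nhdsWithin_iff.2
      ⟨(by fun_prop : Continuous fun z : Space d => (t, z)).continuousAt.mono_left
        nhdsWithin_le_nhds, eventually_mem_nhdsWithin.mono fun z hz => ⟨ht, hz⟩⟩
  have hc' : ContinuousWithinAt (fun z => g' (t, z)) (frontier (Ω t)) x :=
    hc.continuousWithinAt.tendsto.comp htend
  have hcont : ContinuousWithinAt (fun z => g' (t, z) (1, V t z)) (frontier (Ω t)) x :=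
    hc'.clm_apply (continuousWithinAt_const.prodMk (hVc x hx))
  have heq : ∀ z ∈ frontier (Ω t), (t, z) ∈ u → surfMatDeriv I Ω V g t z = g' (t, z) (1, V t z) :=
    fun z hz hzu => surfMatDeriv_eq hV ht hz (hg' _ hzu)
  refine hcont.congr_of_eventuallyEq ?_ (heq x hx (mem_of_mem_nhdsWithin hp hu))
  filter_upwards [self_mem_nhdsWithin, htend hu] with z hz hzu using heq z hz hzu

theorem continuousOn_normalStrain {T : ℝ} (hΩ : IsMovingDomain (Icc 0 T) Ω) (hT : 0 < T)
    (hd : 1 ≤ d) (hV : ContDiffOn ℝ 1 (Function.uncurry V) (region (Icc 0 T) Ω)) {t : ℝ}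
    (ht : t ∈ Icc 0 T) : ContinuousOn (normalStrain Ω V t) (frontier (Ω t)) := by
  have hn := continuousOn_outerNormal hΩ hT hd ht
  have hD := (continuousOn_spaceDeriv hΩ hT hd hV ht).mono frontier_subset_closure
  exact (hD.clm_apply hn).inner hn

/-- The divergence vanishes inside and is continuous up to the boundary. The surface transport
identity needs it on `Γ_t`. -/
theorem trace_spaceDeriv_eq_zero {T : ℝ} (hΩ : IsMovingDomain (Icc 0 T) Ω) (hT : 0 < T)
    (hd : 1 ≤ d) (hV : ContDiffOn ℝ 1 (Function.uncurry V) (region (Icc 0 T) Ω)) {t : ℝ}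
    (ht : t ∈ Icc 0 T) (hdiv : ∀ x ∈ Ω t, div Ω V t x = 0) {x : Space d}
    (hx : x ∈ closure (Ω t)) : LinearMap.trace ℝ (Space d) (spaceDeriv Ω V t x) = 0 := by
  have h1 : EqOn (fun x => LinearMap.trace ℝ (Space d) (spaceDeriv Ω V t x)) (fun _ => 0) (Ω t) :=
    fun x hx => by rw [← hdiv x hx, div_eq_trace]
  exact h1.of_subset_closure (continuousOn_trace_fderivWithin hΩ hT hd ht (contDiffOn_slice hV ht))
    continuousOn_const subset_closure Subset.rfl hx

end SurfaceDerivative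

/-! ### Transport theorem on the free surface -/

section SurfaceTransport

/-- The parametrization of a moving graph in spacetime. -/
def stGraph {Y E : Type*} [NormedAddCommGroup Y] [NormedSpace ℝ Y] [NormedAddCommGroup E]
    [NormedSpace ℝ E] (A : (Y × ℝ) ≃L[ℝ] E) (h : ℝ × Y → ℝ) (p : ℝ × Y) : ℝ × E :=
  (p.1, A (p.2, h p))

variable {d : ℕ} {T : ℝ} {Ω : ℝ → Set (Space d)} {V : ℝ → Space d → Space d} {t₀ a b : ℝ}
  {U : Set (Space d)} {A : (Space (d - 1) × ℝ) ≃L[ℝ] Space d} {h : ℝ × Space (d - 1) → ℝ}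

theorem contDiff_stGraph (A : (Space (d - 1) × ℝ) ≃L[ℝ] Space d) {n : WithTop ℕ∞}
    (hh : ContDiff ℝ n h) : ContDiff ℝ n (stGraph A h) := by
  unfold stGraph; fun_prop

theorem hasFDerivAt_stGraph (A : (Space (d - 1) × ℝ) ≃L[ℝ] Space d) (hh : ContDiff ℝ 1 h)
    (p : ℝ × Space (d - 1)) : ∃ D : ℝ × Space (d - 1) →L[ℝ] ℝ × Space d,
      HasFDerivAt (stGraph A h) D p ∧ ∀ v, D v = (v.1, A (v.2, fderiv ℝ h p v)) :=
  ⟨_, hasFDerivAt_fst.prodMk (A.toContinuousLinearMap.hasFDerivAt.comp p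
    (hasFDerivAt_snd.prodMk (hh.differentiable one_ne_zero p).hasFDerivAt)), fun _ => rfl⟩

theorem IsGraphChart.stGraph_mem_freeSurface {I : Set ℝ} (hab : IsTimeInterval I t₀ a b)
    (H : IsGraphChart Ω (Icc a b) U A h) {p : ℝ × Space (d - 1)} (hp : p.1 ∈ Icc a b)
    (hpU : (stGraph A h p).2 ∈ U) : stGraph A h p ∈ freeSurface I Ω :=
  ⟨hab.subset hp, H.graphMap_mem_frontier_iff hp hpU⟩

theorem eventually_stGraph_snd_mem (hU : IsOpen U) (hh : ContDiff ℝ 1 h)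
    {p : ℝ × Space (d - 1)} (hp : (stGraph A h p).2 ∈ U) : ∀ᶠ q in 𝓝 p, (stGraph A h q).2 ∈ U :=
  (contDiff_stGraph A hh).continuous.snd.continuousAt.eventually (hU.mem_nhds hp)

/-- The derivative, in graph coordinates, of a field on the closed domain. -/
theorem IsGraphChart.hasFDerivAt_comp_stGraph (H : IsGraphChart Ω (Icc a b) U A h)
    (ht : t₀ ∈ Icc a b) {y : Space (d - 1)} (hy : (stGraph A h (t₀, y)).2 ∈ U)
    (hV : DifferentiableWithinAt ℝ (V t₀) (closure (Ω t₀)) (stGraph A h (t₀, y)).2) :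
    ∃ D : Space (d - 1) →L[ℝ] Space (d - 1) × ℝ,
      HasFDerivAt (fun y => A.symm (V t₀ (stGraph A h (t₀, y)).2)) D y ∧
      ∀ w, D w = A.symm (spaceDeriv Ω V t₀ (stGraph A h (t₀, y)).2
        (A (w, ⟪gradient (fun y => h (t₀, y)) y, w⟫))) := by
  obtain ⟨D, hD, hDv⟩ := hasFDerivAt_stGraph A H.contDiff_one (t₀, y)
  have h1 := hasFDerivAt_snd.comp y (hD.comp y (hasFDerivAt_prodMk_right t₀ y))
  have h2 : ∀ᶠ y' in 𝓝 y, (stGraph A h (t₀, y')).2 ∈ closure (Ω t₀) := by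
    have hc : ContinuousAt (fun y' : Space (d - 1) => (t₀, y')) y := by fun_prop
    filter_upwards [hc.eventually (eventually_stGraph_snd_mem H.isOpen H.contDiff_one hy)] with z hz
    exact frontier_subset_closure (H.graphMap_mem_frontier_iff ht hz)
  have h3 := A.symm.toContinuousLinearMap.hasFDerivAt.comp y
    (hV.hasFDerivWithinAt.comp_hasFDerivAt y h1 h2)
  refine ⟨_, h3, fun w => ?_⟩
  simp only [inner_gradient_slice H.contDiff_one (t₀, y)]
  change A.symm (spaceDeriv Ω V t₀ _ (D (0, w)).2) = _
  rw [hDv]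

/-- The transport identity for the surface element in graph coordinates. -/
theorem IsGraphChart.graphDensity_transport (hΩ : IsMovingDomain (Icc 0 T) Ω) (hT : 0 < T)
    (hd : 1 ≤ d) (hV : ContDiffOn ℝ 1 (Function.uncurry V) (region (Icc 0 T) Ω))
    (hdiv : ∀ x ∈ Ω t₀, div Ω V t₀ x = 0) (htan : IsTangent (Icc 0 T) Ω V)
    (hab : IsTimeInterval (Icc 0 T) t₀ a b) (H : IsGraphChart Ω (Icc a b) U A h)
    {k : ℝ → Space d → ℝ} {φ : ℝ × Space (d - 1) → ℝ}
    (hφ : ∀ p, φ p = graphDensity (fun y => h (p.1, y)) p.2 * Function.uncurry k (stGraph A h p))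
    {y : Space (d - 1)} (hy : (stGraph A h (t₀, y)).2 ∈ U)
    (hk : DifferentiableWithinAt ℝ (Function.uncurry k) (freeSurface (Icc 0 T) Ω)
      (stGraph A h (t₀, y)))
    {ι : Type*} [Fintype ι] (e : OrthonormalBasis ι ℝ (Space (d - 1))) :
    fderivWithin ℝ φ (Icc a b ×ˢ univ) (t₀, y) (1, 0) +
      ∑ j, ⟪e j,
        fderiv ℝ (fun y => φ (t₀, y) • (A.symm (V t₀ (stGraph A h (t₀, y)).2)).1) y (e j)⟫ =
    graphDensity (fun y => h (t₀, y)) y *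
      (surfMatDeriv (Icc 0 T) Ω V k t₀ (stGraph A h (t₀, y)).2 -
        k t₀ (stGraph A h (t₀, y)).2 * normalStrain Ω V t₀ (stGraph A h (t₀, y)).2) := by
  have ht₀ := hab.subset hab.mem
  set x := (stGraph A h (t₀, y)).2
  have hx : stGraph A h (t₀, y) = (t₀, x) := rfl
  have hxf : x ∈ frontier (Ω t₀) := H.graphMap_mem_frontier_iff hab.mem hy
  have hAx : A.symm x = (y, h (t₀, y)) := A.symm_apply_apply _
  have hhd := H.contDiff_one.differentiable one_ne_zero
  set G := gradient (fun y => h (t₀, y)) y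
  have hG : ∀ u, ⟪G, u⟫ = fderiv ℝ h (t₀, y) (0, u) :=
    inner_gradient_slice H.contDiff_one (t₀, y)
  set Jf : ℝ × Space (d - 1) → ℝ := fun p => graphDensity (fun y => h (p.1, y)) p.2
  set J := graphDensity (fun y => h (t₀, y)) y
  have hJpos : 0 < J := graphDensity_pos (d := d) _ _
  have hJ2 : J ^ 2 = 1 + ‖G‖ ^ 2 := by
    simp only [J, G, graphDensity_eq]
    rw [Real.sq_sqrt (by positivity)]
  have hVd := fun x hx => (contDiffOn_slice hV ht₀).differentiableOn one_ne_zero x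
    (frontier_subset_closure hx)
  obtain ⟨D, hD, hDw⟩ := H.hasFDerivAt_comp_stGraph hab.mem hy (hVd x hxf)
  set M := spaceDeriv Ω V t₀ x
  set v := A.symm (V t₀ x)
  have htan0 : v.2 = fderiv ℝ h (t₀, y) (1, v.1) := by
    have := H.snd_eq_of_isTangent hab htan hy hxf
    rwa [hAx] at this
  -- differentiate the tangency condition along the graph
  have hδ : J * fderiv ℝ Jf (t₀, y) (1, v.1) = (A.symm (M (A (G, ⟪G, G⟫)))).2 -
      ⟪G, (A.symm (M (A (G, ⟪G, G⟫)))).1⟫ := by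
    have h1 : (fun y => (A.symm (V t₀ (stGraph A h (t₀, y)).2)).2) =ᶠ[𝓝 y]
        fun y => fderiv ℝ h (t₀, y) (1, (A.symm (V t₀ (stGraph A h (t₀, y)).2)).1) := by
      have hc : ContinuousAt (fun y' : Space (d - 1) => (t₀, y')) y := by fun_prop
      filter_upwards [hc.eventually
        (eventually_stGraph_snd_mem H.isOpen H.contDiff_one hy)] with z hz
      have := H.snd_eq_of_isTangent hab htan hz (H.graphMap_mem_frontier_iff hab.mem hz)
      rwa [show A.symm (stGraph A h (t₀, z)).2 = (z, h (t₀, z)) from A.symm_apply_apply _] at this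
    have hD2 : HasFDerivAt (fderiv ℝ h) (fderiv ℝ (fderiv ℝ h) (t₀, y)) (t₀, y) :=
      ((H.contDiff.fderiv_right (m := 1) (by norm_num)).differentiable one_ne_zero _).hasFDerivAt
    have h2 := (hD2.comp y (hasFDerivAt_prodMk_right t₀ y)).clm_apply
      ((hasFDerivAt_const (1 : ℝ) y).prodMk (hasFDerivAt_fst.comp y hD))
    have h3 := congrArg (fun l => l G) ((hasFDerivAt_snd.comp y hD).unique
      (h2.congr_of_eventuallyEq h1))
    have h4 : (D G).2 = fderiv ℝ h (t₀, y) (0, (D G).1) +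
        fderiv ℝ (fderiv ℝ h) (t₀, y) (0, G) (1, v.1) := h3
    have h5 := graphDensity_mul_fderiv H.contDiff (t₀, y) (1, v.1)
    rw [← hDw, h4, hG]
    linarith
  have hstrain := graph_strain_identity H.frame
    (trace_spaceDeriv_eq_zero hΩ hT hd hV ht₀ hdiv (frontier_subset_closure hxf)) hJpos hJ2 hδ e
  have hN : normalStrain Ω V t₀ x = ⟪M (J⁻¹ • A (-G, 1)), J⁻¹ • A (-G, 1)⟫ := by
    rw [normalStrain, H.outerNormal_eq hab.mem hy hxf, hAx]
    rfl
  rw [← hN] at hstrain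
  -- the derivative of the pulled back function
  obtain ⟨Dγ, hDγ, hDγv⟩ := hasFDerivAt_stGraph A H.contDiff_one (t₀, y)
  have hS : {p : ℝ × Space (d - 1) | p.1 ∈ Icc a b ∧ (stGraph A h p).2 ∈ U} ∈
      𝓝[Icc a b ×ˢ univ] (t₀, y) := by
    filter_upwards [self_mem_nhdsWithin, mem_nhdsWithin_of_mem_nhds
      (eventually_stGraph_snd_mem H.isOpen H.contDiff_one hy)] with q hq hqU using ⟨hq.1, hqU⟩
  have hkγ := (hk.hasFDerivWithinAt.comp (t₀, y) hDγ.hasFDerivWithinAt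
    (s := {p : ℝ × Space (d - 1) | p.1 ∈ Icc a b ∧ (stGraph A h p).2 ∈ U})
    fun p hp => H.stGraph_mem_freeSurface hab hp.1 hp.2).mono_of_mem_nhdsWithin hS
  have hJd := ((contDiff_graphDensity H.contDiff).differentiable one_ne_zero (t₀, y)).hasFDerivAt
  obtain ⟨φ', hφ', hφv⟩ : ∃ φ' : ℝ × Space (d - 1) →L[ℝ] ℝ,
      HasFDerivWithinAt φ φ' (Icc a b ×ˢ univ) (t₀, y) ∧ φ' (1, v.1) =
        J * surfMatDeriv (Icc 0 T) Ω V k t₀ x + k t₀ x * fderiv ℝ Jf (t₀, y) (1, v.1) := by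
    refine ⟨_, (hJd.hasFDerivWithinAt.mul hkγ).congr (fun p _ => hφ p) (hφ _), ?_⟩
    -- By tangency, moving with the horizontal velocity in the parameter space is moving with `V` on
    -- the surface.
    have : Dγ (1, v.1) = (1, V t₀ x) := by
      rw [hDγv, ← htan0]
      exact congrArg (Prod.mk 1) (A.apply_symm_apply _)
    rw [add_apply, smul_apply, smul_apply, ContinuousLinearMap.comp_apply, this]
    rfl
  have hφs : HasFDerivAt (fun y => φ (t₀, y)) (φ' ∘L .inr ℝ ℝ (Space (d - 1))) y :=
    hasFDerivWithinAt_univ.1 (hφ'.comp y (hasFDerivAt_prodMk_right t₀ y).hasFDerivWithinAt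
      fun _ _ => ⟨hab.mem, mem_univ _⟩)
  have hsum : ∑ j, φ' (0, e j) * ⟪e j, v.1⟫ = φ' (0, v.1) := by
    have : φ' (0, v.1) = (φ' ∘L .inr ℝ ℝ (Space (d - 1))) (∑ j, ⟪e j, v.1⟫ • e j) := by
      rw [e.sum_repr']
      rfl
    rw [this, map_sum]
    exact Finset.sum_congr rfl fun j _ => by rw [map_smul, smul_eq_mul, mul_comm]; rfl
  have hZ : ∀ w, fderiv ℝ (fun y => φ (t₀, y) • (A.symm (V t₀ (stGraph A h (t₀, y)).2)).1) y w =
      φ (t₀, y) • (A.symm (M (A (w, ⟪G, w⟫)))).1 + φ' (0, w) • v.1 := fun w => by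
    have h1 := hφs.smul (hasFDerivAt_fst.comp y hD)
    change HasFDerivAt (fun y => φ (t₀, y) • (A.symm (V t₀ (stGraph A h (t₀, y)).2)).1) _ y at h1
    rw [h1.fderiv, ← hDw]
    rfl
  simp only [hZ, inner_add_right, inner_smul_right, Finset.sum_add_distrib, ← Finset.mul_sum, hsum]
  rw [hφ'.fderivWithin (((uniqueDiffOn_Icc hab.lt).prod uniqueDiffOn_univ) _
    ⟨hab.mem, mem_univ _⟩), hφ (t₀, y)]
  -- Together with `∂_t φ`, the part of the horizontal divergence that differentiates `φ` forms its
  -- material derivative. The remaining part, `φ` times the divergence of the horizontal velocity,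
  -- is absorbed by `hstrain`.
  have hadd : φ' (1, v.1) = φ' (1, 0) + φ' (0, v.1) := by
    rw [← map_add]
    simp
  have hk0 : Function.uncurry k (stGraph A h (t₀, y)) = k t₀ x := rfl
  rw [hk0]
  linear_combination hφv - hadd + k t₀ x * hstrain

/-- In graph coordinates the integral runs over the fixed space with density `φ = J k`, so
differentiation passes under it. Adding a horizontal divergence of integral zero converts `∂_t φ`
into the integrand of the transport identity. -/
theorem hasDerivWithinAt_surfaceIntegral_of_chart (hΩ : IsMovingDomain (Icc 0 T) Ω) (hT : 0 < T)
    (hd : 1 ≤ d) (hV : ContDiffOn ℝ 1 (Function.uncurry V) (region (Icc 0 T) Ω))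
    (hdiv : ∀ x ∈ Ω t₀, div Ω V t₀ x = 0) (htan : IsTangent (Icc 0 T) Ω V) {g : ℝ → Space d → ℝ}
    (hg : ContDiffOn ℝ 1 (Function.uncurry g) (freeSurface (Icc 0 T) Ω))
    (hab : IsTimeInterval (Icc 0 T) t₀ a b) (H : IsGraphChart Ω (Icc a b) U A h)
    {χ : Space d → ℝ} (hχ : ContDiff ℝ ∞ χ) (hχc : HasCompactSupport χ) (hχU : tsupport χ ⊆ U) :
    HasDerivWithinAt (fun t => ∫ x, χ x • g t x ∂(surfaceMeasure Ω t))
      (∫ x, (surfMatDeriv (Icc 0 T) Ω V (fun t x => χ x • g t x) t₀ x -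
        (χ x • g t₀ x) * normalStrain Ω V t₀ x) ∂(surfaceMeasure Ω t₀)) (Icc 0 T) t₀ := by
  have ht₀ := hab.subset hab.mem
  set k : ℝ → Space d → ℝ := fun t x => χ x • g t x
  have hχ0 : ∀ x ∉ tsupport χ, χ x = 0 := fun x hx => image_eq_zero_of_notMem_tsupport hx
  have hχU0 : ∀ x ∉ U, χ x = 0 := fun x hx => hχ0 x fun hc => hx (hχU hc)
  have hk : ContDiffOn ℝ 1 (Function.uncurry k) (freeSurface (Icc 0 T) Ω) :=
    ((hχ.of_le (by simp)).comp contDiff_snd).contDiffOn.smul hg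
  have hΓ := contDiff_stGraph A H.contDiff_one
  have hχΓ : ContDiff ℝ 1 fun p => χ (stGraph A h p).2 := (hχ.of_le (by simp)).comp hΓ.snd
  have hC : IsClosed ((fun p => (stGraph A h p).2) ⁻¹' tsupport χ) :=
    (isClosed_tsupport χ).preimage hΓ.continuous.snd
  have hO : IsOpen ((fun p => (stGraph A h p).2) ⁻¹' U) := H.isOpen.preimage hΓ.continuous.snd
  set S : Set (ℝ × Space (d - 1)) := {p | p.1 ∈ Icc a b ∧ (stGraph A h p).2 ∈ U}
  have hmaps : MapsTo (stGraph A h) S (freeSurface (Icc 0 T) Ω) := fun p hp =>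
    H.stGraph_mem_freeSurface hab hp.1 hp.2
  set f : ℝ × Space (d - 1) → ℝ := fun p =>
    graphDensity (fun y => h (p.1, y)) p.2 * Function.uncurry g (stGraph A h p)
  have hf : ContDiffOn ℝ 1 f S :=
    (contDiff_graphDensity H.contDiff).contDiffOn.mul (hg.comp hΓ.contDiffOn hmaps)
  set φ : ℝ × Space (d - 1) → ℝ := fun p => χ (stGraph A h p).2 • f p
  have hφk : ∀ p, φ p =
      graphDensity (fun y => h (p.1, y)) p.2 * Function.uncurry k (stGraph A h p) := fun p => by
    change χ _ * (_ * _) = _ * (χ _ * _)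
    rw [mul_left_comm]
    rfl
  have hφ : ContDiffOn ℝ 1 φ (Icc a b ×ˢ univ) :=
    contDiffOn_smul_of_isClosed hχΓ hf hC (fun p hp => hχ0 _ hp) hO (fun p hp => hχU hp)
      fun p hp => ⟨hp.1.1, hp.2⟩
  set K : Set (Space (d - 1)) := (fun x => (A.symm x).1) '' tsupport χ
  have hK : IsCompact K := hχc.image (by fun_prop)
  have hKφ : ∀ t y, y ∉ K → φ (t, y) = 0 := fun t y hy => by
    have : (stGraph A h (t, y)).2 ∉ tsupport χ := fun hc =>
      hy ⟨_, hc, congrArg Prod.fst (A.symm_apply_apply (y, h (t, y)))⟩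
    simp only [φ, hχ0 _ this, zero_smul]
  have hleib := hasDerivWithinAt_setIntegral_of_contDiffOn (μ := volume) hab.lt isClosed_univ
    uniqueDiffOn_univ hφ hK (fun t _ y _ hy => hKφ t y hy) hab.mem
  simp only [setIntegral_univ] at hleib
  have hint : ∀ t ∈ Icc a b, ∫ x, k t x ∂(surfaceMeasure Ω t) = ∫ y, φ (t, y) := fun t ht => by
    rw [H.integral_surfaceMeasure_eq ht fun x hx => by simp [k, hχU0 x hx]]
    simp only [hφk]
    rfl
  -- This is the horizontal flux of the density `φ`. It has compact support, so its divergence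
  -- integrates to zero.
  set Z : Space (d - 1) → Space (d - 1) := fun y =>
    φ (t₀, y) • (A.symm (V t₀ (stGraph A h (t₀, y)).2)).1
  have hpair : ContDiff ℝ 1 fun y : Space (d - 1) => (t₀, y) := by fun_prop
  have hZ : ContDiff ℝ 1 Z := by
    have hfV : ContDiffOn ℝ 1 (fun y => f (t₀, y) • (A.symm (V t₀ (stGraph A h (t₀, y)).2)).1)
        {y | (t₀, y) ∈ S} :=
      (hf.comp hpair.contDiffOn fun y hy => hy).smul (A.symm.contDiff.fst.comp_contDiffOn
        ((contDiffOn_slice hV ht₀).comp (hΓ.comp hpair).snd.contDiffOn fun y hy =>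
          frontier_subset_closure (hmaps hy).2))
    have hZ' := contDiffOn_smul_of_isClosed (S' := univ) (hχΓ.comp hpair) hfV
      (hC.preimage hpair.continuous) (fun p hp => hχ0 _ hp) (hO.preimage hpair.continuous)
      (fun p hp => hχU hp) fun p hp => ⟨hab.mem, hp.2⟩
    refine contDiffOn_univ.1 (hZ'.congr fun y _ => ?_)
    simp only [Z, φ, smul_assoc]
    rfl
  have hZc : HasCompactSupport Z := HasCompactSupport.intro hK fun y hy => by
    simp only [Z, hKφ t₀ y hy, zero_smul]
  set e := EuclideanSpace.basisFun (Fin (d - 1)) ℝ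
  obtain ⟨hZi, hZ0⟩ := integral_sum_inner_fderiv_eq_zero hZ hZc e
  have hkey : ∀ y, fderivWithin ℝ φ (Icc a b ×ˢ univ) (t₀, y) (1, 0) +
      ∑ j, ⟪e j, fderiv ℝ Z y (e j)⟫ = graphDensity (fun y => h (t₀, y)) y *
      (surfMatDeriv (Icc 0 T) Ω V k t₀ (stGraph A h (t₀, y)).2 -
        k t₀ (stGraph A h (t₀, y)).2 * normalStrain Ω V t₀ (stGraph A h (t₀, y)).2) := fun y => by
    by_cases hy : (stGraph A h (t₀, y)).2 ∈ U
    · exact H.graphDensity_transport hΩ hT hd hV hdiv htan hab hφk hy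
        (hk.differentiableOn one_ne_zero _ (hmaps ⟨hab.mem, hy⟩)) e
    · have hx : (stGraph A h (t₀, y)).2 ∉ tsupport χ := fun hc => hy (hχU hc)
      have hev : ∀ᶠ p in 𝓝 (t₀, y), φ p = 0 := by
        filter_upwards [hC.isOpen_compl.mem_nhds hx] with p hp
        simp only [φ, hχ0 _ hp, zero_smul]
      have h1 : φ =ᶠ[𝓝 (t₀, y)] fun _ => 0 := hev
      have h2 : Z =ᶠ[𝓝 y] fun _ => 0 := by
        filter_upwards [hpair.continuous.continuousAt.eventually hev] with z hz
        simp only [Z, hz, zero_smul]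
      rw [h1.fderivWithin_eq_of_nhds, h2.fderiv_eq, surfMatDeriv,
        fderivWithin_uncurry_smul_eq_zero g _ hx]
      simp [k, hχ0 _ hx]
  have hderiv : ∫ x, (surfMatDeriv (Icc 0 T) Ω V k t₀ x - k t₀ x * normalStrain Ω V t₀ x)
      ∂(surfaceMeasure Ω t₀) = ∫ y, fderivWithin ℝ φ (Icc a b ×ˢ univ) (t₀, y) (1, 0) := by
    rw [H.integral_surfaceMeasure_eq hab.mem]
    · refine (integral_congr_ae (ae_of_all _ fun y => (hkey y).symm)).trans ?_
      have hφi : Integrable fun y => fderivWithin ℝ φ (Icc a b ×ˢ univ) (t₀, y) (1, 0) := by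
        have hu : UniqueDiffOn ℝ (Icc a b ×ˢ (univ : Set (Space (d - 1)))) :=
          (uniqueDiffOn_Icc hab.lt).prod uniqueDiffOn_univ
        have hc : Continuous fun y => fderivWithin ℝ φ (Icc a b ×ˢ univ) (t₀, y) (1, 0) := by
          refine Continuous.clm_apply ?_ continuous_const
          exact (hφ.continuousOn_fderivWithin hu le_rfl).comp_continuous (by fun_prop)
            fun y => ⟨hab.mem, mem_univ _⟩
        refine hc.integrable_of_hasCompactSupport (HasCompactSupport.intro hK fun y hy => ?_)
        have : φ =ᶠ[𝓝 (t₀, y)] fun _ => 0 := by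
          filter_upwards [(hK.isClosed.preimage continuous_snd).isOpen_compl.mem_nhds
            (show (t₀, y) ∈ (Prod.snd ⁻¹' K)ᶜ from hy)] with p hp using hKφ p.1 p.2 hp
        rw [this.fderivWithin_eq_of_nhds]
        simp
      rw [integral_add hφi hZi, hZ0, add_zero]
    · intro x hx
      rw [surfMatDeriv, fderivWithin_uncurry_smul_eq_zero g _ fun hc => hx (hχU hc)]
      simp [k, hχU0 x hx]
  rw [hderiv]
  exact (hleib.congr hint (hint t₀ hab.mem)).mono_of_mem_nhdsWithin hab.mem_nhdsWithin

/-- **Transport theorem on the free surface** for a divergence-free velocity field. -/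
theorem hasDerivWithinAt_surfaceIntegral (hΩ : IsMovingDomain (Icc 0 T) Ω) (hT : 0 < T)
    (hd : 1 ≤ d) (hV : ContDiffOn ℝ 1 (Function.uncurry V) (region (Icc 0 T) Ω))
    (ht₀ : t₀ ∈ Icc 0 T) (hdiv : ∀ x ∈ Ω t₀, div Ω V t₀ x = 0) (htan : IsTangent (Icc 0 T) Ω V)
    {g : ℝ → Space d → ℝ}
    (hg : ContDiffOn ℝ 1 (Function.uncurry g) (freeSurface (Icc 0 T) Ω)) :
    HasDerivWithinAt (fun t => ∫ x, g t x ∂(surfaceMeasure Ω t))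
      (∫ x, (surfMatDeriv (Icc 0 T) Ω V g t₀ x - g t₀ x * normalStrain Ω V t₀ x)
        ∂(surfaceMeasure Ω t₀)) (Icc 0 T) t₀ := by
  have hVc := (contDiffOn_slice hV ht₀).continuousOn.mono frontier_subset_closure
  have hgc : ∀ g : ℝ → Space d → ℝ,
      ContDiffOn ℝ 1 (Function.uncurry g) (freeSurface (Icc 0 T) Ω) → ∀ t ∈ Icc 0 T,
      ContinuousOn (g t) (frontier (Ω t)) := fun g hg t ht =>
    hg.continuousOn.comp (f := fun x => (t, x)) (by fun_prop) fun x hx => ⟨ht, hx⟩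
  have hint : ∀ g : ℝ → Space d → ℝ,
      ContDiffOn ℝ 1 (Function.uncurry g) (freeSurface (Icc 0 T) Ω) →
      Integrable (fun x => surfMatDeriv (Icc 0 T) Ω V g t₀ x - g t₀ x * normalStrain Ω V t₀ x)
        (surfaceMeasure Ω t₀) := fun g hg =>
    integrable_surfaceMeasure_of_continuousOn hΩ hT hd ht₀
      ((continuousOn_surfMatDeriv htan hg ht₀ hVc).sub ((hgc g hg t₀ ht₀).mul
        (continuousOn_normalStrain hΩ hT hd hV ht₀)))
  refine (hΩ.induction_on_cutoff (F := ℝ) (p := fun g =>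
    ContDiffOn ℝ 1 (Function.uncurry g) (freeSurface (Icc 0 T) Ω) ∧
    HasDerivWithinAt (fun t => ∫ x, g t x ∂(surfaceMeasure Ω t))
      (∫ x, (surfMatDeriv (Icc 0 T) Ω V g t₀ x - g t₀ x * normalStrain Ω V t₀ x)
        ∂(surfaceMeasure Ω t₀)) (Icc 0 T) t₀) ?_ ?_ ?_ g ?_).2
  · refine ⟨contDiffOn_const, ?_⟩
    have h0 : surfMatDeriv (Icc 0 T) Ω V (fun _ _ => (0 : ℝ)) t₀ = fun _ => 0 := by
      funext x
      have : Function.uncurry (fun (_ : ℝ) (_ : Space d) => (0 : ℝ)) = fun _ => 0 := rfl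
      rw [surfMatDeriv, this]
      simp
    rw [h0]
    simpa using hasDerivWithinAt_const t₀ (Icc 0 T) (0 : ℝ)
  · rintro f g ⟨hf, hf'⟩ ⟨hg, hg'⟩
    refine ⟨hf.add hg, ?_⟩
    have h1 : ∫ x, (surfMatDeriv (Icc 0 T) Ω V (fun t x => f t x + g t x) t₀ x -
          (f t₀ x + g t₀ x) * normalStrain Ω V t₀ x) ∂(surfaceMeasure Ω t₀) =
        (∫ x, (surfMatDeriv (Icc 0 T) Ω V f t₀ x - f t₀ x * normalStrain Ω V t₀ x)
          ∂(surfaceMeasure Ω t₀)) +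
        ∫ x, (surfMatDeriv (Icc 0 T) Ω V g t₀ x - g t₀ x * normalStrain Ω V t₀ x)
          ∂(surfaceMeasure Ω t₀) := by
      rw [← integral_add (hint f hf) (hint g hg)]
      refine setIntegral_congr_fun isClosed_frontier.measurableSet fun x hx => ?_
      have hx' : (t₀, x) ∈ freeSurface (Icc 0 T) Ω := ⟨ht₀, hx⟩
      have h2 : surfMatDeriv (Icc 0 T) Ω V (fun t x => f t x + g t x) t₀ x =
          surfMatDeriv (Icc 0 T) Ω V f t₀ x + surfMatDeriv (Icc 0 T) Ω V g t₀ x :=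
        surfMatDeriv_eq (g := fun t x => f t x + g t x) htan ht₀ hx
          ((hf.differentiableOn one_ne_zero _ hx').hasFDerivWithinAt.add
            (hg.differentiableOn one_ne_zero _ hx').hasFDerivWithinAt)
      simp only [h2]
      ring
    have h2 : ∀ t ∈ Icc 0 T, ∫ x, (f t x + g t x) ∂(surfaceMeasure Ω t) =
        (∫ x, f t x ∂(surfaceMeasure Ω t)) + ∫ x, g t x ∂(surfaceMeasure Ω t) := fun t ht =>
      integral_add (integrable_surfaceMeasure_of_continuousOn hΩ hT hd ht (hgc f hf t ht))
        (integrable_surfaceMeasure_of_continuousOn hΩ hT hd ht (hgc g hg t ht))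
    rw [h1]
    exact (hf'.add hg').congr h2 (h2 t₀ ht₀)
  · rintro f g ⟨hf, hf'⟩ hfg
    have hfg' : EqOn (Function.uncurry g) (Function.uncurry f) (freeSurface (Icc 0 T) Ω) :=
      fun p hp => (hfg p.1 hp.1 p.2 (frontier_subset_closure hp.2)).symm
    refine ⟨hf.congr hfg', ?_⟩
    have h1 : ∫ x, (surfMatDeriv (Icc 0 T) Ω V g t₀ x - g t₀ x * normalStrain Ω V t₀ x)
          ∂(surfaceMeasure Ω t₀) =
        ∫ x, (surfMatDeriv (Icc 0 T) Ω V f t₀ x - f t₀ x * normalStrain Ω V t₀ x)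
          ∂(surfaceMeasure Ω t₀) := by
      refine setIntegral_congr_fun isClosed_frontier.measurableSet fun x hx => ?_
      have hx' : (t₀, x) ∈ freeSurface (Icc 0 T) Ω := ⟨ht₀, hx⟩
      simp only [surfMatDeriv]
      rw [fderivWithin_congr hfg' (hfg' hx'), hfg t₀ ht₀ x (frontier_subset_closure hx)]
    have h2 : ∀ t ∈ Icc 0 T, ∫ x, g t x ∂(surfaceMeasure Ω t) =
        ∫ x, f t x ∂(surfaceMeasure Ω t) := fun t ht =>
      setIntegral_congr_fun isClosed_frontier.measurableSet fun x hx =>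
        (hfg t ht x (frontier_subset_closure hx)).symm
    rw [h1]
    exact hf'.congr h2 (h2 t₀ ht₀)
  · intro x
    obtain ⟨A, h, a, b, U, hab, hxU, H⟩ := exists_isGraphChart hT hd ht₀ hΩ x
    refine ⟨U, H.isOpen.mem_nhds hxU, fun χ hχ hχc hχU => ⟨?_, ?_⟩⟩
    · exact ((hχ.of_le (by simp)).comp contDiff_snd).contDiffOn.smul hg
    · exact hasDerivWithinAt_surfaceIntegral_of_chart hΩ hT hd hV hdiv htan hg hab H hχ hχc hχU

end SurfaceTransport

end FreeBoundaryMHD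

namespace FreeBoundaryMHD

/-! ### Energy balances and bounds -/

section Energy

/-- An almost everywhere bound on a continuous function holds everywhere on an open set, and then on
the closure. This gives the gradient bound on the boundary, which the norm over `Ω_t` does not see
directly. -/
theorem norm_le_toReal_eLpNorm_top_of_isOpen {X F : Type*} [TopologicalSpace X]
    [MeasurableSpace X] [OpensMeasurableSpace X] {μ : Measure X} [μ.IsOpenPosMeasure]
    [NormedAddCommGroup F] {O : Set X} (hO : IsOpen O) {f : X → F}
    (hf : ContinuousOn f (closure O)) (hfin : eLpNorm f ∞ (μ.restrict O) ≠ ∞) {x : X}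
    (hx : x ∈ closure O) : ‖f x‖ ≤ (eLpNorm f ∞ (μ.restrict O)).toReal := by
  set c := (eLpNorm f ∞ (μ.restrict O)).toReal
  have hae : (fun x => max ‖f x‖ c) =ᵐ[μ.restrict O] fun _ => c := by
    filter_upwards [ae_le_eLpNormEssSup (f := f) (μ := μ.restrict O)] with z hz
    rw [← eLpNorm_exponent_top] at hz
    exact max_eq_right (by simpa only [toReal_enorm] using ENNReal.toReal_mono hfin hz)
  have hc : ContinuousOn (fun x => max ‖f x‖ c) (closure O) := by fun_prop
  have h1 := Measure.eqOn_open_of_ae_eq hae hO (hc.mono subset_closure) continuousOn_const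
  have h2 := h1.of_subset_closure hc continuousOn_const subset_closure Subset.rfl hx
  exact max_eq_right_iff.1 h2

variable {d : ℕ} {T : ℝ} {Ω : ℝ → Set (Space d)} {V w F : ℝ → Space d → Space d} {t₀ : ℝ}

/-- The kinetic energy balance for a field transported by `V`, with pressure `q` and force `-F`. -/
theorem hasDerivWithinAt_kineticEnergy (hΩ : IsMovingDomain (Icc 0 T) Ω) (hT : 0 < T)
    (hd : 1 ≤ d) (hV : ContDiffOn ℝ 1 (Function.uncurry V) (region (Icc 0 T) Ω))
    (ht₀ : t₀ ∈ Icc 0 T) (hdiv : ∀ x ∈ Ω t₀, div Ω V t₀ x = 0) (htan : IsTangent (Icc 0 T) Ω V)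
    (hw : ContDiffOn ℝ 1 (Function.uncurry w) (region (Icc 0 T) Ω))
    (hdivw : ∀ x ∈ Ω t₀, div Ω w t₀ x = 0) {q : ℝ → Space d → ℝ}
    (hq : ContDiffOn ℝ 1 (Function.uncurry q) (region (Icc 0 T) Ω))
    (hF : ContinuousOn (F t₀) (closure (Ω t₀)))
    (hmom : ∀ x ∈ Ω t₀, matDeriv (Icc 0 T) Ω V w t₀ x + grad Ω q t₀ x = -F t₀ x) :
    HasDerivWithinAt (fun t => (1 / 2) * ∫ x in Ω t, ‖w t x‖ ^ 2)
      (-(∫ x in Ω t₀, ⟪w t₀ x, F t₀ x⟫) -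
        ∫ x, q t₀ x * ⟪w t₀ x, outerNormal (Ω t₀) x⟫ ∂(surfaceMeasure Ω t₀)) (Icc 0 T) t₀ := by
  have hm := (hΩ.isOpen hT hd ht₀).measurableSet
  have hwc := (contDiffOn_slice hw ht₀).continuousOn
  have hqs := contDiffOn_slice hq ht₀
  have hf : ContDiffOn ℝ 1 (Function.uncurry fun t x => ‖w t x‖ ^ 2) (region (Icc 0 T) Ω) :=
    hw.norm_sq ℝ
  have h1 := (hasDerivWithinAt_setIntegral hΩ hT hd hV ht₀ hdiv htan hf).const_mul (1 / 2)
  refine h1.congr_deriv ?_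
  have hgreen := setIntegral_fderivWithin_apply_eq hΩ hT hd ht₀ hqs (contDiffOn_slice hw ht₀)
    fun x hx => by rw [← hdivw x hx, div_eq_trace, spaceDeriv]
  have hiF : IntegrableOn (fun x => ⟪w t₀ x, F t₀ x⟫) (Ω t₀) :=
    integrableOn_of_continuousOn_closure hΩ ht₀ (hwc.inner hF)
  have hiF' : IntegrableOn (fun x => -⟪w t₀ x, F t₀ x⟫) (Ω t₀) := hiF.neg
  have hiq : IntegrableOn (fun x => fderivWithin ℝ (q t₀) (closure (Ω t₀)) x (w t₀ x)) (Ω t₀) :=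
    integrableOn_of_continuousOn_closure hΩ ht₀
      ((continuousOn_spaceDeriv hΩ hT hd hq ht₀).clm_apply hwc)
  rw [← hgreen, ← integral_neg, ← integral_sub hiF' hiq, ← integral_const_mul]
  refine setIntegral_congr_fun hm fun x hx => ?_
  have hx' : (t₀, x) ∈ region (Icc 0 T) Ω := ⟨ht₀, subset_closure hx⟩
  have h2 := (hw.differentiableOn one_ne_zero _ hx').hasFDerivWithinAt.norm_sq
  have h3 : matDeriv (Icc 0 T) Ω V (fun t x => ‖w t x‖ ^ 2) t₀ x =
      2 * ⟪w t₀ x, matDeriv (Icc 0 T) Ω V w t₀ x⟫ := by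
    change fderivWithin ℝ (fun p => ‖Function.uncurry w p‖ ^ 2) _ _ _ = _
    rw [h2.fderivWithin (hΩ.uniqueDiffOn_region hT hd _ hx')]
    simp only [smul_apply, ContinuousLinearMap.comp_apply, innerSL_apply_apply, nsmul_eq_mul]
    rfl
  have h4 : fderivWithin ℝ (q t₀) (closure (Ω t₀)) x (w t₀ x) = ⟪w t₀ x, grad Ω q t₀ x⟫ := by
    rw [real_inner_comm]
    exact (inner_grad q t₀ x _).symm
  simp only [h3, h4, eq_sub_of_add_eq (hmom x hx), inner_sub_right, inner_neg_right]
  ring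

/-- The balance of the surface energy `∫ a s²`, when `∂_t + V · ∇` transports `s` with normal
velocity `w · n`. -/
theorem hasDerivWithinAt_surfaceEnergy (hΩ : IsMovingDomain (Icc 0 T) Ω) (hT : 0 < T)
    (hd : 1 ≤ d) (hV : ContDiffOn ℝ 1 (Function.uncurry V) (region (Icc 0 T) Ω))
    (ht₀ : t₀ ∈ Icc 0 T) (hdiv : ∀ x ∈ Ω t₀, div Ω V t₀ x = 0) (htan : IsTangent (Icc 0 T) Ω V)
    (hw : ContinuousOn (w t₀) (frontier (Ω t₀))) {a s : ℝ → Space d → ℝ}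
    (ha : ContDiffOn ℝ 1 (Function.uncurry a) (freeSurface (Icc 0 T) Ω))
    (hs : ContDiffOn ℝ 1 (Function.uncurry s) (freeSurface (Icc 0 T) Ω))
    (hkin : ∀ x ∈ frontier (Ω t₀), surfMatDeriv (Icc 0 T) Ω V s t₀ x -
      ⟪w t₀ x, outerNormal (Ω t₀) x⟫ = s t₀ x * normalStrain Ω V t₀ x) :
    HasDerivWithinAt (fun t => ∫ x, a t x * s t x ^ 2 ∂(surfaceMeasure Ω t))
      ((∫ x, (surfMatDeriv (Icc 0 T) Ω V a t₀ x + a t₀ x * normalStrain Ω V t₀ x) * s t₀ x ^ 2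
          ∂(surfaceMeasure Ω t₀)) +
        2 * ∫ x, a t₀ x * s t₀ x * ⟪w t₀ x, outerNormal (Ω t₀) x⟫ ∂(surfaceMeasure Ω t₀))
      (Icc 0 T) t₀ := by
  have hg : ContDiffOn ℝ 1 (Function.uncurry fun t x => a t x * s t x ^ 2)
      (freeSurface (Icc 0 T) Ω) := ha.mul (hs.pow 2)
  refine (hasDerivWithinAt_surfaceIntegral hΩ hT hd hV ht₀ hdiv htan hg).congr_deriv ?_
  have hVc := (contDiffOn_slice hV ht₀).continuousOn.mono frontier_subset_closure
  have hslice : ∀ g : ℝ → Space d → ℝ,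
      ContDiffOn ℝ 1 (Function.uncurry g) (freeSurface (Icc 0 T) Ω) →
      ContinuousOn (g t₀) (frontier (Ω t₀)) := fun g hg =>
    hg.continuousOn.comp (f := fun x => (t₀, x)) (by fun_prop) fun x hx => ⟨ht₀, hx⟩
  rw [← integral_const_mul, ← integral_add]
  · refine setIntegral_congr_fun isClosed_frontier.measurableSet fun x hx => ?_
    have hx' : (t₀, x) ∈ freeSurface (Icc 0 T) Ω := ⟨ht₀, hx⟩
    have h1 : surfMatDeriv (Icc 0 T) Ω V (fun t x => a t x * s t x ^ 2) t₀ x =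
        a t₀ x * (2 * s t₀ x * surfMatDeriv (Icc 0 T) Ω V s t₀ x) +
          s t₀ x ^ 2 * surfMatDeriv (Icc 0 T) Ω V a t₀ x := by
      have h0 := (ha.differentiableOn one_ne_zero _ hx').hasFDerivWithinAt.mul
        ((hs.differentiableOn one_ne_zero _ hx').hasFDerivWithinAt.pow 2)
      change HasFDerivWithinAt (Function.uncurry fun t x => a t x * s t x ^ 2) _ _ _ at h0
      rw [surfMatDeriv_eq htan ht₀ hx h0]
      simp only [add_apply, smul_apply, smul_eq_mul, nsmul_eq_mul, Nat.cast_ofNat,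
        Nat.add_one_sub_one, pow_one]
      rfl
    -- The kinematic equation contributes `2 a s²` times the normal strain, and the stretching of
    -- the surface element removes one copy of `a s²` times it.
    simp only [h1, sub_eq_iff_eq_add.1 (hkin x hx)]
    ring
  · exact integrable_surfaceMeasure_of_continuousOn hΩ hT hd ht₀
      (((continuousOn_surfMatDeriv htan ha ht₀ hVc).add ((hslice a ha).mul
        (continuousOn_normalStrain hΩ hT hd hV ht₀))).mul ((hslice s hs).pow 2))
  · exact integrable_surfaceMeasure_of_continuousOn hΩ hT hd ht₀
      (continuousOn_const.mul (((hslice a ha).mul (hslice s hs)).mul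
        (hw.inner (continuousOn_outerNormal hΩ hT hd ht₀))))

theorem abs_normalStrain_le (hΩ : IsMovingDomain (Icc 0 T) Ω) (hT : 0 < T) (hd : 1 ≤ d)
    (ht₀ : t₀ ∈ Icc 0 T) {x : Space d} (hx : x ∈ frontier (Ω t₀)) :
    |normalStrain Ω V t₀ x| ≤ ‖spaceDeriv Ω V t₀ x‖ := by
  have hn := norm_outerNormal hΩ hT hd ht₀ hx
  refine (abs_real_inner_le_norm _ _).trans ?_
  rw [hn, mul_one]
  simpa [hn] using (spaceDeriv Ω V t₀ x).le_opNorm (outerNormal (Ω t₀) x)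

/-- Cauchy–Schwarz and `2‖u‖‖v‖ ≤ ‖u‖² + ‖v‖²`. The right side is exactly the kinetic part of the
energy, so no constant is lost. -/
theorem abs_setIntegral_inner_le {O : Set (Space d)} (hO : MeasurableSet O)
    {u v : Space d → Space d}
    {M : Space d → Space d →L[ℝ] Space d} {c : ℝ} (hu : IntegrableOn (fun x => ‖u x‖ ^ 2) O)
    (hv : IntegrableOn (fun x => ‖v x‖ ^ 2) O) (hM : ∀ x ∈ O, ‖M x‖ ≤ c) :
    |∫ x in O, ⟪u x, M x (v x)⟫| ≤
      c * ((1 / 2) * (∫ x in O, ‖u x‖ ^ 2) + (1 / 2) * ∫ x in O, ‖v x‖ ^ 2) := by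
  rw [← integral_const_mul, ← integral_const_mul,
    ← integral_add (hu.const_mul _) (hv.const_mul _), ← integral_const_mul, ← Real.norm_eq_abs]
  refine norm_integral_le_of_norm_le (((hu.const_mul _).add (hv.const_mul _)).const_mul _) ?_
  filter_upwards [ae_restrict_mem hO] with x hx
  have h1 := (norm_inner_le_norm (𝕜 := ℝ) (u x) (M x (v x))).trans
    (mul_le_mul_of_nonneg_left ((M x).le_of_opNorm_le (hM x hx) (v x)) (norm_nonneg _))
  have h2 : 0 ≤ c := (norm_nonneg _).trans (hM x hx)
  nlinarith [mul_nonneg h2 (sq_nonneg (‖u x‖ - ‖v x‖))]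

theorem abs_surfaceIntegral_strain_le (hΩ : IsMovingDomain (Icc 0 T) Ω) (hT : 0 < T) (hd : 1 ≤ d)
    (ht₀ : t₀ ∈ Icc 0 T) {a s : ℝ → Space d → ℝ} (ha : ∀ x ∈ frontier (Ω t₀), 0 < a t₀ x)
    (hi : Integrable (fun x => a t₀ x * s t₀ x ^ 2) (surfaceMeasure Ω t₀)) {c : ℝ}
    (hc : ∀ x ∈ frontier (Ω t₀), ‖spaceDeriv Ω V t₀ x‖ ≤ c)
    (hfin : eLpNorm (fun x => (a t₀ x)⁻¹ * surfMatDeriv (Icc 0 T) Ω V a t₀ x) ∞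
      (surfaceMeasure Ω t₀) ≠ ∞) :
    |∫ x, (surfMatDeriv (Icc 0 T) Ω V a t₀ x + a t₀ x * normalStrain Ω V t₀ x) * s t₀ x ^ 2
        ∂(surfaceMeasure Ω t₀)| ≤
      ((eLpNorm (fun x => (a t₀ x)⁻¹ * surfMatDeriv (Icc 0 T) Ω V a t₀ x) ∞
        (surfaceMeasure Ω t₀)).toReal + c) * ∫ x, a t₀ x * s t₀ x ^ 2 ∂(surfaceMeasure Ω t₀) := by
  rw [← integral_const_mul, ← Real.norm_eq_abs]
  refine norm_integral_le_of_norm_le (hi.const_mul _) ?_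
  filter_upwards [ae_restrict_mem isClosed_frontier.measurableSet, ae_le_eLpNormEssSup
    (f := fun x => (a t₀ x)⁻¹ * surfMatDeriv (Icc 0 T) Ω V a t₀ x) (μ := surfaceMeasure Ω t₀)]
    with x hx hxa
  have hapos := ha x hx
  rw [← eLpNorm_exponent_top] at hxa
  set α := (eLpNorm (fun x => (a t₀ x)⁻¹ * surfMatDeriv (Icc 0 T) Ω V a t₀ x) ∞
    (surfaceMeasure Ω t₀)).toReal
  have h1 : |(a t₀ x)⁻¹ * surfMatDeriv (Icc 0 T) Ω V a t₀ x| ≤ α := by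
    simpa only [toReal_enorm, Real.norm_eq_abs] using ENNReal.toReal_mono hfin hxa
  have h2 := (abs_normalStrain_le (V := V) hΩ hT hd ht₀ hx).trans (hc x hx)
  -- Factoring out the positive weight `a s²` leaves precisely the normalized rate `a⁻¹ D_t a` and
  -- the strain.
  have h3 : (surfMatDeriv (Icc 0 T) Ω V a t₀ x + a t₀ x * normalStrain Ω V t₀ x) * s t₀ x ^ 2 =
      ((a t₀ x)⁻¹ * surfMatDeriv (Icc 0 T) Ω V a t₀ x + normalStrain Ω V t₀ x) *
        (a t₀ x * s t₀ x ^ 2) := by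
    field_simp
  have h4 : 0 ≤ a t₀ x * s t₀ x ^ 2 := by positivity
  rw [h3, Real.norm_eq_abs, abs_mul, abs_of_nonneg h4]
  exact mul_le_mul_of_nonneg_right ((abs_add_le _ _).trans (add_le_add h1 h2)) h4

/-- By `hS` the surface rate may be replaced by the mean of its two expressions. The fluxes `Q₁` and
`Q₂` then cancel, and the surface terms enter with weight one half. -/
theorem abs_energy_rate_le {I₁ I₂ S₁ S₂ Q₁ Q₂ K₁ K₂ S l₁ l₂ α₁ α₂ u₁ u₂ : ℝ}
    (hI₁ : |I₁| ≤ l₂ * (1 / 2 * K₂ + 1 / 2 * K₁)) (hI₂ : |I₂| ≤ l₁ * (1 / 2 * K₁ + 1 / 2 * K₂))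
    (hS₁ : |S₁| ≤ (α₁ + l₁) * S) (hS₂ : |S₂| ≤ (α₂ + l₂) * S) (hS : S₁ + 2 * Q₁ = S₂ + 2 * Q₂)
    (hK₁ : 0 ≤ K₁) (hK₂ : 0 ≤ K₂) (hS0 : 0 ≤ S) (hl₁ : 0 ≤ l₁) (hl₂ : 0 ≤ l₂) (hα₁ : 0 ≤ α₁)
    (hα₂ : 0 ≤ α₂) (hu₁ : 0 ≤ u₁) (hu₂ : 0 ≤ u₂) :
    |-I₂ - Q₁ + (-I₁ - Q₂) + (S₁ + 2 * Q₁)| ≤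
      1 * (u₁ + l₁ + (u₂ + l₂) + (α₁ + α₂)) * (1 / 2 * K₁ + 1 / 2 * K₂ + S) := by
  have hbound : |-I₂ - Q₁ + (-I₁ - Q₂) + (S₁ + 2 * Q₁)| ≤
      l₂ * (1 / 2 * K₂ + 1 / 2 * K₁) + l₁ * (1 / 2 * K₁ + 1 / 2 * K₂) +
        ((α₁ + l₁) * S + (α₂ + l₂) * S) / 2 := by
    rw [abs_le] at *
    constructor <;> linarith
  refine hbound.trans ?_
  have h : 0 ≤ (u₁ + u₂ + α₁ + α₂) * (1 / 2 * K₁ + 1 / 2 * K₂) +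
      (u₁ + u₂ + (l₁ + l₂ + α₁ + α₂) / 2) * S := by positivity
  linarith

end Energy

end FreeBoundaryMHD

end

open FreeBoundaryMHD

/-! ### The linearized energy estimate -/

theorem mainTheorem8 :
    ∃ C : ℝ, 0 < C ∧
      ∀ (d : ℕ) (_ : 2 ≤ d) (T : ℝ) (_ : 0 < T)
        (Ω : ℝ → Set (Space d)) (Wp Wm : ℝ → Space d → Space d) (P : ℝ → Space d → ℝ)
        (_ : IsMHDSolution (Set.Icc 0 T) Ω Wp Wm P)
        (wp wm : ℝ → Space d → Space d) (s q : ℝ → Space d → ℝ)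
        (_ : IsLinearizedSolution (Set.Icc 0 T) Ω Wp Wm P wp wm s q)
        (_ : ∀ t ∈ Set.Icc 0 T, MemLinearizedSpace Ω Wp Wm wp wm s t)
        (_ : ∃ M : ℝ≥0, ∀ t ∈ Set.Icc 0 T, linControl (Set.Icc 0 T) Ω Wp Wm P t ≤ M),
        ∀ t ∈ Set.Icc 0 T,
          DifferentiableWithinAt ℝ (linEnergy Ω P wp wm s) (Set.Icc 0 T) t ∧
          |derivWithin (linEnergy Ω P wp wm s) (Set.Icc 0 T) t| ≤
            C * (linControl (Set.Icc 0 T) Ω Wp Wm P t).toReal * linEnergy Ω P wp wm s t := by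
  refine ⟨1, one_pos, ?_⟩
  intro d hd2 T hT Ω Wp Wm P hW wp wm s q hw _ hM t ht
  have hd : 1 ≤ d := by omega
  have hΩ := hW.domain
  have hO := hΩ.isOpen hT hd ht
  obtain ⟨c₀, hc₀, hac₀⟩ := hW.taylor_sign
  set a := taylorCoeff Ω P
  have ha : ContDiffOn ℝ 1 (Function.uncurry a) (freeSurface (Icc 0 T) Ω) :=
    contDiffOn_taylorCoeff hΩ hT hd hW.regular_P
  have hapos : ∀ x ∈ frontier (Ω t), 0 < a t x := fun x hx => hc₀.trans (hac₀ t ht x hx)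
  have hDp := continuousOn_spaceDeriv hΩ hT hd hW.regular_Wp ht
  have hDm := continuousOn_spaceDeriv hΩ hT hd hW.regular_Wm ht
  have hwpc := (contDiffOn_slice hw.regular_wp ht).continuousOn
  have hwmc := (contDiffOn_slice hw.regular_wm ht).continuousOn
  -- the energy balances
  have hkm := hasDerivWithinAt_kineticEnergy (F := fun t x => spaceDeriv Ω Wm t x (wp t x))
    hΩ hT hd hW.regular_Wp ht (hW.div_Wp t ht) hW.tangent_p
    hw.regular_wm (hw.div_wm t ht) hw.regular_q (hDm.clm_apply hwpc) (hw.momentum_p t ht)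
  have hkp := hasDerivWithinAt_kineticEnergy (F := fun t x => spaceDeriv Ω Wp t x (wm t x))
    hΩ hT hd hW.regular_Wm ht (hW.div_Wm t ht) hW.tangent_m
    hw.regular_wp (hw.div_wp t ht) hw.regular_q (hDp.clm_apply hwmc) (hw.momentum_m t ht)
  have hsp := hasDerivWithinAt_surfaceEnergy hΩ hT hd hW.regular_Wp ht (hW.div_Wp t ht)
    hW.tangent_p (hwpc.mono frontier_subset_closure) ha hw.regular_s (hw.kinematic_p t ht)
  have hsm := hasDerivWithinAt_surfaceEnergy hΩ hT hd hW.regular_Wm ht (hW.div_Wm t ht)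
    hW.tangent_m (hwmc.mono frontier_subset_closure) ha hw.regular_s (hw.kinematic_m t ht)
  have hE := (hkp.add hkm).add hsp
  change HasDerivWithinAt (linEnergy Ω P wp wm s) _ _ _ at hE
  have hud := uniqueDiffOn_Icc hT t ht
  refine ⟨hE.differentiableWithinAt, ?_⟩
  -- Transport by `W⁺` and by `W⁻` computes the same derivative, which is unique even at the
  -- endpoint times. This equality allows the averaging that cancels both fluxes.
  have hspm := (hsp.derivWithin hud).symm.trans (hsm.derivWithin hud)
  -- The boundary condition for the linearized pressure gives the kinetic and surface balances the
  -- same flux integrals.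
  have hpress : ∀ u : Space d → Space d,
      ∫ x, q t x * ⟪u x, outerNormal (Ω t) x⟫ ∂(surfaceMeasure Ω t) =
        ∫ x, a t x * s t x * ⟪u x, outerNormal (Ω t) x⟫ ∂(surfaceMeasure Ω t) := fun u =>
    setIntegral_congr_fun isClosed_frontier.measurableSet fun x hx => by
      simp only [hw.pressure t ht x hx, a]
  rw [hpress, hpress] at hE
  rw [hE.derivWithin hud]
  -- the bounds
  have hfin : linControl (Icc 0 T) Ω Wp Wm P t ≠ ∞ := by
    obtain ⟨M, hM⟩ := hM
    exact ne_top_of_le_ne_top ENNReal.coe_ne_top (hM t ht)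
  simp only [linControl, w1infNorm, ENNReal.add_ne_top] at hfin
  obtain ⟨⟨⟨hp0, hp1⟩, hm0, hm1⟩, hp2, hm2⟩ := hfin
  have hbp := fun x hx => norm_le_toReal_eLpNorm_top_of_isOpen hO hDp hp1 (x := x) hx
  have hbm := fun x hx => norm_le_toReal_eLpNorm_top_of_isOpen hO hDm hm1 (x := x) hx
  have hip : IntegrableOn (fun x => ‖wp t x‖ ^ 2) (Ω t) :=
    integrableOn_of_continuousOn_closure hΩ ht (hwpc.norm.pow 2)
  have him : IntegrableOn (fun x => ‖wm t x‖ ^ 2) (Ω t) :=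
    integrableOn_of_continuousOn_closure hΩ ht (hwmc.norm.pow 2)
  have his : Integrable (fun x => a t x * s t x ^ 2) (surfaceMeasure Ω t) :=
    integrable_surfaceMeasure_of_continuousOn hΩ hT hd ht
      ((ha.mul (hw.regular_s.pow 2)).continuousOn.comp (f := fun x => (t, x)) (by fun_prop)
        fun x hx => ⟨ht, hx⟩)
  have h1 := abs_setIntegral_inner_le hO.measurableSet him hip
    fun x hx => hbm x (subset_closure hx)
  have h2 := abs_setIntegral_inner_le hO.measurableSet hip him
    fun x hx => hbp x (subset_closure hx)
  have h3 := abs_surfaceIntegral_strain_le hΩ hT hd ht hapos his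
    (fun x hx => hbp x (frontier_subset_closure hx)) hp2
  have h4 := abs_surfaceIntegral_strain_le hΩ hT hd ht hapos his
    (fun x hx => hbm x (frontier_subset_closure hx)) hm2
  have hKp : 0 ≤ ∫ x in Ω t, ‖wp t x‖ ^ 2 := integral_nonneg fun x => by positivity
  have hKm : 0 ≤ ∫ x in Ω t, ‖wm t x‖ ^ 2 := integral_nonneg fun x => by positivity
  have hS : 0 ≤ ∫ x, a t x * s t x ^ 2 ∂(surfaceMeasure Ω t) :=
    setIntegral_nonneg isClosed_frontier.measurableSet fun x hx =>
      mul_nonneg (hapos x hx).le (sq_nonneg _)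
  have hA : (linControl (Icc 0 T) Ω Wp Wm P t).toReal =
      (eLpNorm (Wp t) ∞ (volume.restrict (Ω t))).toReal +
        (eLpNorm (spaceDeriv Ω Wp t) ∞ (volume.restrict (Ω t))).toReal +
      ((eLpNorm (Wm t) ∞ (volume.restrict (Ω t))).toReal +
        (eLpNorm (spaceDeriv Ω Wm t) ∞ (volume.restrict (Ω t))).toReal) +
      ((eLpNorm (fun x => (a t x)⁻¹ * surfMatDeriv (Icc 0 T) Ω Wp a t x) ∞
          (surfaceMeasure Ω t)).toReal +
        (eLpNorm (fun x => (a t x)⁻¹ * surfMatDeriv (Icc 0 T) Ω Wm a t x) ∞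
          (surfaceMeasure Ω t)).toReal) := by
    rw [linControl, w1infNorm, w1infNorm, ENNReal.toReal_add, ENNReal.toReal_add,
      ENNReal.toReal_add hp0 hp1, ENNReal.toReal_add hm0 hm1, ENNReal.toReal_add hp2 hm2] <;>
    simp only [ne_eq, ENNReal.add_eq_top, not_or] <;> tauto
  rw [hA, linEnergy]
  exact abs_energy_rate_le h1 h2 h3 h4 hspm hKp hKm hS ENNReal.toReal_nonneg
    ENNReal.toReal_nonneg ENNReal.toReal_nonneg ENNReal.toReal_nonneg ENNReal.toReal_nonneg
    ENNReal.toReal_nonneg
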